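/- **Setting.** Let $E$ be a finite-dimensional real Euclidean space with norm $\|x\|=\sqrt{\langle x,Hx\rangle}$ ($H$ symmetric positive definite) and dual norm $\|\cdot\|_*$ on $E^*$. Let $Q\subset E$ be closed and convex, let $f,h$ be real-valued and convex on $Q$, $h$ lower semicontinuous on $Q$, and let $\varphi=f+h$ be $\mu$-strongly convex on $Q$, $\mu>0$, with minimizer $x^*\in Q$ and $\varphi^*=\varphi(x^*)$. Let $L,\sigma,V,R_0>0$, $\delta\ge 0$, $p\in[1,2]$, $\Lambda\in(0,1]$. *Oracle.* For all $x\in Q$ there are $f_{\delta,L}(x)\in\mathbb R$, $g_{\delta,L}(x)\in E^*$ with $0\le f(y)-f_{\delta,L}(x)-\langle g_{\delta,L}(x),y-x\rangle\le\frac L2\|x-y\|^2+\delta$ for all $y\in Q$. One observes $F(x,\xi),G(x,\xi)$, where $\xi$ has a fixed law, $\mathbb E F(x,\xi)=f_{\delta,L}(x)$, $\mathbb E G(x,\xi)=g_{\delta,L}(x)$, $\mathbb E\|G(x,\xi)-g_{\delta,L}(x)\|_*^2\le\sigma^2$ and $\mathbb E\exp(\|G(x,\xi)-g_{\delta,L}(x)\|_*^2/\sigma^2)\le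 e$ for all $x\in Q$. All samples of $\xi$ that are used are i.i.d. *Prox-function.* $d:E\to\mathbb R$ satisfies $d(x)\le\frac{V^2}{2}\|x\|^2$ for all $x\in E$; on the closed unit ball it is differentiable, strongly convex with parameter $1$, and minimal at $0$, with $d(0)=0$. *Constants.* $C_1=4\sqrt2$, $C_2=16\sqrt2$, $C_3=48$, $C_4=4\sqrt3$, $X=\frac{6eC_1LV^2}{\mu}$. If $p>1$ and $\delta>0$, assume $X\ge1$. *Inner method.* Given a convex set $S$, a prox-function $\tilde d$ with Bregman distance $\mathcal V(x,z)=\tilde d(x)-\tilde d(z)-\langle\nabla\tilde d(z),x-z\rangle$, a starting point $x_0\in S$ and sequences $\alpha_i,\beta_i,B_i$, put $A_k=\sum_{i\le k}\alpha_i$, $\tau_k=\alpha_{k+1}/B_{k+1}$, let $G_i$ be the oracle's answer at $x_i$, and let $y_0=\arg\min_{x\in S}\{\beta_0\tilde d(x)+\alpha_0\langle G_0,x-x_0\rangle+\alpha_0h(x)\}$. For $k\ge0$: $$z_k=\arg\min_{x\in S}\Big\{\beta_k\tilde d(x)+\sum_{i=0}^k\alpha_i\langle G_i,x-x_i\rangle+A_kh(x)\Big\},\qquad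 x_{k+1}=\tau_kz_k+(1-\tau_k)y_k,$$ $$\hat x_{k+1}=\arg\min_{x\in S}\{\beta_k\mathcal V(x,z_k)+\alpha_{k+1}\langle G_{k+1},x-z_k\rangle+\alpha_{k+1}h(x)\},$$ $$w_{k+1}=\tau_k\hat x_{k+1}+(1-\tau_k)y_k,\qquad y_{k+1}=\tfrac{A_{k+1}-B_{k+1}}{A_{k+1}}y_k+\tfrac{B_{k+1}}{A_{k+1}}w_{k+1}.$$ *Restarted method.* Let $N\ge1$ be the number of outer iterations and $u_0\in Q$ with $\|u_0-x^*\|\le R_0$. For $k=0,\dots,N-1$ put $N_k=\lceil X^{1/p}\rceil$, $$m_k=\max\left\{1,\left\lceil\frac{36e^{k+2}C_2^2\sigma^2V^2(1+\ln\frac{3N}{\Lambda})^2}{\mu^2R_0^2N_k}\right\rceil,\left\lceil\frac{144e^{k+2}C_4^2\sigma^2\ln\frac{3N}{\Lambda}}{\mu^2R_0^2N_k}\right\rceil\right\},$$ $$R_k^2=R_0^2e^{-k}+\frac{2^peC_3\delta}{\mu(e-1)}X^{\frac{p-1}p}(1-e^{-k}),\qquad Q_k=\{x\in Q:\|x-u_k\|^2\le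 R_k^2\},$$ and let $u_{k+1}=y_{N_k}$ be the point that the inner method produces in $N_k$ iterations on $S=Q_k$ from $x_0=u_k$, with prox-function $d\big(\frac{x-u_k}{R_k}\big)$, each oracle answer being the mean of $m_k$ independent answers $G(x,\xi)$, and with $a=2^{\frac{2p-1}2}$, $b=2^{\frac{5-2p}4}p^{\frac{1-2p}2}$, $$\alpha_i=\tfrac1a\big(\tfrac{i+p}p\big)^{p-1},\qquad \beta_i=LR_k^2+\frac{b\,\sigma R_k}{V\sqrt{m_k}}(i+p+1)^{\frac{2p-1}2},\qquad B_i=a\alpha_i^2.$$ **Theorem.** For every $N\ge1$, $$\mathbb P\left\{\varphi(u_N)-\varphi^*>\frac{\mu R_0^2}{2}e^{-N}+\frac{2^{p-1}eC_3}{e-1}X^{\frac{p-1}{p}}\delta\right\}\le\Lambda.$$ Consequently, if $0<\varepsilon<\mu R_0^2$, $\delta\le\frac{\varepsilon(e-1)}{2^pC_3e}X^{\frac{1-p}p}$ and $N=\left\lceil\ln\frac{\mu R_0^2}{\varepsilon}\right\rceil$, then $\mathbb P\{\varphi(u_N)-\varphi^*>\varepsilon\}\le\Lambda$, and the number $\sum_{k<N}N_km_k$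 of oracle calls in the inner iterations is at most $\mathcal T+\mathcal S$, where $\ell=1+\ln\frac{\mu R_0^2}{\varepsilon}$ and $$\mathcal T=\big(1+X^{1/p}\big)\ell,\qquad \mathcal S=\frac{36e^3C_2^2\sigma^2V^2}{\mu(e-1)\varepsilon}\Big(1+\ln\frac{3\ell}{\Lambda}\Big)^2+\frac{144e^3C_4^2\sigma^2}{\mu\varepsilon(e-1)}\ln\frac{3\ell}{\Lambda}.$$ If the $m_k$ calls at the starting point of each stage are counted too, the total $\sum_{k<N}(N_k+1)m_k$ is at most $\mathcal T+\ell+2\mathcal S$. -/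

import Mathlib

open MeasureTheory ProbabilityTheory
open scoped BigOperators

noncomputable section

namespace Sigma2

/-! ### Problem class

`E` is a finite-dimensional real Euclidean space; its inner product is the one that induces the norm
`‖x‖ = √⟨x, Hx⟩` of the problem. `E →L[ℝ] ℝ` is the dual space, `g x` is the pairing `⟨g, x⟩`, and
the operator norm on `E →L[ℝ] ℝ` is the dual norm. -/

section Problem

variable {E : Type*} [NormedAddCommGroup E] [InnerProductSpace ℝ E]

/-- `(fd, gd)` is a `(δ, L)`-oracle for `f` on `Q`. -/
def IsInexactOracle (Q : Set E) (f : E → ℝ) (L δ : ℝ) (fd : E → ℝ) (gd : E → (E →L[ℝ] ℝ)) : Prop :=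
  ∀ x ∈ Q, ∀ y ∈ Q,
    0 ≤ f y - fd x - gd x (y - x) ∧ f y - fd x - gd x (y - x) ≤ L / 2 * ‖x - y‖ ^ 2 + δ

/-- `(F, G)` is a stochastic inexact oracle for `f` on `Q`: an unbiased stochastic approximation
of the `(δ, L)`-oracle `(fd, gd)`, where the random variable `ξ` has the law `ν` and the answer in
gradient form has variance at most `σ ^ 2`. -/
structure IsStochasticInexactOracle {Ξ : Type*} [MeasurableSpace Ξ] [MeasurableSpace E]
    (ν : Measure Ξ) (Q : Set E) (f : E → ℝ) (L δ σ : ℝ)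
    (fd : E → ℝ) (gd : E → (E →L[ℝ] ℝ)) (F : E → Ξ → ℝ) (G : E → Ξ → (E →L[ℝ] ℝ)) : Prop where
  inexact : IsInexactOracle Q f L δ fd gd
  measurable_G : Measurable fun q : Q × Ξ => G q.1 q.2
  integrable_F : ∀ x ∈ Q, Integrable (F x) ν
  mean_F : ∀ x ∈ Q, ∫ s, F x s ∂ν = fd x
  integrable_G : ∀ x ∈ Q, Integrable (G x) ν
  mean_G : ∀ x ∈ Q, ∫ s, G x s ∂ν = gd x
  integrable_sq : ∀ x ∈ Q, Integrable (fun s => ‖G x s - gd x‖ ^ 2) ν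
  variance_G : ∀ x ∈ Q, ∫ s, ‖G x s - gd x‖ ^ 2 ∂ν ≤ σ ^ 2

/-- The light-tail condition `𝔼 exp (‖G(x, ξ) - g(x)‖² / σ²) ≤ exp 1`. -/
def LightTail {Ξ : Type*} [MeasurableSpace Ξ] (ν : Measure Ξ) (Q : Set E) (σ : ℝ)
    (gd : E → (E →L[ℝ] ℝ)) (G : E → Ξ → (E →L[ℝ] ℝ)) : Prop :=
  ∀ x ∈ Q, ∫⁻ s, ENNReal.ofReal (Real.exp (‖G x s - gd x‖ ^ 2 / σ ^ 2)) ∂ν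
    ≤ ENNReal.ofReal (Real.exp 1)

/-- `d` is a prox-function centred at `0`. The method evaluates `d` only at points
`(x - u) / R` with `‖x - u‖ ≤ R`, that is, on the closed unit ball; so this is where
differentiability and strong convexity with parameter `1` are asked for. -/
structure IsProxFunction (d : E → ℝ) : Prop where
  differentiableAt : ∀ x ∈ Metric.closedBall (0 : E) 1, DifferentiableAt ℝ d x
  strongConvexOn : StrongConvexOn (Metric.closedBall (0 : E) 1) 1 d
  map_zero : d 0 = 0
  isMinOn_zero : IsMinOn d (Metric.closedBall (0 : E) 1) 0

end Problem

/-! ### The Stochastic Intermediate Gradient Method -/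

section SIGM

variable {E : Type*} [NormedAddCommGroup E] [InnerProductSpace ℝ E]

/-- A minimizer of `Φ` over `S` (arbitrary if there is none). In all uses below `Φ` is strongly
convex, so that there is at most one minimizer. -/
def argminOn (S : Set E) (Φ : E → ℝ) : E :=
  Classical.epsilon fun x => x ∈ S ∧ IsMinOn Φ S x

/-- The Bregman distance `V(x, z) = d(x) - d(z) - ⟨∇d(z), x - z⟩`. -/
def bregman (d : E → ℝ) (x z : E) : ℝ :=
  d x - d z - fderiv ℝ d z (x - z)

/-- `A_k = α_0 + ... + α_k`. -/
def partialSum (α : ℕ → ℝ) (k : ℕ) : ℝ := ∑ i ∈ Finset.range (k + 1), α i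

/-- The data after `k` iterations: `x = x_k`, `z = z_k`, `y = y_k`, and the accumulated linear model
`lin v = ∑_{i ≤ k} α_i ⟨G_i, v - x_i⟩`, where `G_i` is the oracle's answer at `x_i`. -/
structure State (E : Type*) where
  x : E
  z : E
  y : E
  lin : E → ℝ

/-- The method on the feasible set `Q` with prox-function `d`, composite term `h`, coefficients
`α, β, B` and starting point `x0`. The answer of the oracle in iteration `i` at the point `x` is
`answer i x`. -/
def sigm (Q : Set E) (d h : E → ℝ) (α β B : ℕ → ℝ) (x0 : E) (answer : ℕ → E → (E →L[ℝ] ℝ)) :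
    ℕ → State E
  | 0 =>
    let G := answer 0 x0
    { x := x0
      z := argminOn Q fun v => β 0 * d v + α 0 * G (v - x0) + partialSum α 0 * h v
      y := argminOn Q fun v => β 0 * d v + α 0 * G (v - x0) + α 0 * h v
      lin := fun v => α 0 * G (v - x0) }
  | k + 1 =>
    let s := sigm Q d h α β B x0 answer k
    let τ := α (k + 1) / B (k + 1)
    let x := τ • s.z + (1 - τ) • s.y
    let G := answer (k + 1) x
    let xhat := argminOn Q fun v =>
      β k * bregman d v s.z + α (k + 1) * G (v - s.z) + α (k + 1) * h v
    let w := τ • xhat + (1 - τ) • s.y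
    let A := partialSum α (k + 1)
    let lin := fun v => s.lin v + α (k + 1) * G (v - x)
    { x := x
      z := argminOn Q fun v => β (k + 1) * d v + lin v + A * h v
      y := ((A - B (k + 1)) / A) • s.y + (B (k + 1) / A) • w
      lin := lin }

end SIGM

/-! ### The coefficients -/

/-- `a = 2^((2p-1)/2)`. -/
def coefA (p : ℝ) : ℝ := 2 ^ ((2 * p - 1) / 2)

/-- `b = 2^((5-2p)/4) p^((1-2p)/2)`. -/
def coefB (p : ℝ) : ℝ := 2 ^ ((5 - 2 * p) / 4) * p ^ ((1 - 2 * p) / 2)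

/-- `α_i`. -/
def seqAlpha (p : ℝ) (i : ℕ) : ℝ := 1 / coefA p * ((i + p) / p) ^ (p - 1)

/-- `β_i` for the constant `L`, the noise level `σ` and the radius `R`. -/
def seqBeta (p L σ R : ℝ) (i : ℕ) : ℝ :=
  L + coefB p * σ / R * (i + p + 1) ^ ((2 * p - 1) / 2)

/-- `B_i = a α_i²`. -/
def seqB (p : ℝ) (i : ℕ) : ℝ := coefA p * seqAlpha p i ^ 2

def C₁ : ℝ := 4 * √2
def C₂ : ℝ := 16 * √2
def C₃ : ℝ := 48
def C₄ : ℝ := 4 * √3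

/-! ### The restarted method -/

/-- The numerical parameters of the problem and of the method. -/
structure Params where
  /-- constant of the oracle -/
  L : ℝ
  /-- bias of the oracle -/
  δ : ℝ
  /-- noise level of the oracle -/
  σ : ℝ
  /-- strong convexity constant of the objective -/
  μ : ℝ
  /-- growth constant of the prox-function -/
  V : ℝ
  /-- bound for the distance from the starting point to the solution -/
  R0 : ℝ
  /-- exponent of the intermediate method -/
  p : ℝ
  /-- confidence level -/
  Λ : ℝ

namespace Params

variable (q : Params)

/-- `6 e C₁ L V² / μ`. -/
def X : ℝ := 6 * Real.exp 1 * C₁ * q.L * q.V ^ 2 / q.μ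

/-- The number `N_k = ⌈X^(1/p)⌉` of inner iterations of a stage (the same for all stages). -/
def inner : ℕ := ⌈q.X ^ (1 / q.p)⌉₊

/-- The batch size `m_k` of stage `k` when `N` stages are planned. -/
def batch (N k : ℕ) : ℕ :=
  max 1 (max
    ⌈36 * Real.exp (k + 2) * C₂ ^ 2 * q.σ ^ 2 * q.V ^ 2 * (1 + Real.log (3 * N / q.Λ)) ^ 2
        / (q.μ ^ 2 * q.R0 ^ 2 * q.inner)⌉₊
    ⌈144 * Real.exp (k + 2) * C₄ ^ 2 * q.σ ^ 2 * Real.log (3 * N / q.Λ)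
        / (q.μ ^ 2 * q.R0 ^ 2 * q.inner)⌉₊)

/-- The radius `R_k` of stage `k`. -/
def radius (k : ℕ) : ℝ :=
  √(q.R0 ^ 2 * Real.exp (-k)
    + 2 ^ q.p * Real.exp 1 * C₃ * q.δ / (q.μ * (Real.exp 1 - 1)) * q.X ^ ((q.p - 1) / q.p)
      * (1 - Real.exp (-k)))

/-- The bound for the residual of the objective after `N` stages. -/
def errorBound (N : ℕ) : ℝ :=
  q.μ * q.R0 ^ 2 / 2 * Real.exp (-N)
    + 2 ^ (q.p - 1) * Real.exp 1 * C₃ / (Real.exp 1 - 1) * q.X ^ ((q.p - 1) / q.p) * q.δ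

/-- The number of oracle calls in the inner iterations of `N` stages: stage `k` has `N_k`
inner iterations with `m_k` calls each. -/
def innerCalls (N : ℕ) : ℕ := ∑ k ∈ Finset.range N, q.inner * q.batch N k

/-- The number of all oracle calls in `N` stages: in addition to the calls of the inner iterations,
stage `k` makes `m_k` calls at its starting point. -/
def totalCalls (N : ℕ) : ℕ := ∑ k ∈ Finset.range N, (q.inner + 1) * q.batch N k

/-- The summand of the complexity bound that does not depend on the noise. -/
def iterTerm (ε : ℝ) : ℝ :=
  (1 + q.X ^ (1 / q.p)) * (1 + Real.log (q.μ * q.R0 ^ 2 / ε))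

/-- The summands of the complexity bound that come from the noise. -/
def noiseTerm (ε : ℝ) : ℝ :=
  36 * Real.exp 3 * C₂ ^ 2 * q.σ ^ 2 * q.V ^ 2 / (q.μ * (Real.exp 1 - 1) * ε)
      * (1 + Real.log (3 / q.Λ * (1 + Real.log (q.μ * q.R0 ^ 2 / ε)))) ^ 2
    + 144 * Real.exp 3 * C₄ ^ 2 * q.σ ^ 2 / (q.μ * ε * (Real.exp 1 - 1))
      * Real.log (3 / q.Λ * (1 + Real.log (q.μ * q.R0 ^ 2 / ε)))

end Params

section Restart

variable {E : Type*} [NormedAddCommGroup E] [InnerProductSpace ℝ E]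

/-- The averaged oracle of a batch: the mean of `m` answers at `x` for the samples
`s 0, ..., s (m-1)`. -/
def batchMean {Ξ : Type*} (G : E → Ξ → (E →L[ℝ] ℝ)) (m : ℕ) (s : ℕ → Ξ) (x : E) : E →L[ℝ] ℝ :=
  (m : ℝ)⁻¹ • ∑ j ∈ Finset.range m, G x (s j)

/-- The iterate `u_k` of the restarted method with `N` planned stages. Stage `k` runs `sigm` for
`N_k` iterations on `Q_k = {x ∈ Q | ‖x - u_k‖² ≤ R_k²}`, from `u_k`, with the prox-function
`d((x - u_k) / R_k)` and with the averaged oracle; `s k i j` is the sample of stage `k`, inner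
iteration `i`, number `j` in the batch. This prox-function is strongly convex for the norm
`‖·‖ / R_k`. For this norm the averaged oracle has the constant `L R_k²` and the noise level
`σ R_k / √m_k`, and `√(2 d((x⋆ - u_k) / R_k)) ≤ V`; these values enter the coefficients. -/
def restart {Ξ : Type*} (q : Params) (Q : Set E) (d h : E → ℝ) (G : E → Ξ → (E →L[ℝ] ℝ))
    (u0 : E) (N : ℕ) (s : ℕ → ℕ → ℕ → Ξ) : ℕ → E
  | 0 => u0
  | k + 1 =>
    let u := restart q Q d h G u0 N s k
    let R := q.radius k
    let m := q.batch N k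
    (sigm {x ∈ Q | ‖x - u‖ ^ 2 ≤ R ^ 2} (fun x => d (R⁻¹ • (x - u))) h
      (seqAlpha q.p) (seqBeta q.p (q.L * R ^ 2) (q.σ * R / √(m : ℝ)) q.V) (seqB q.p) u
      (fun i x => batchMean G m (s k i) x) q.inner).y

end Restart

end Sigma2

end

/-! One run of the inner method is an estimating-sequence argument. The model ψ_k(v) = β_k D(v) +
Σ_{i≤k} α_i (fd(x_i) + ⟨G_i, v - x_i⟩) + A_k h(v) is minimal at z_k, and A_k φ(y_k) ≤ min ψ_k plus
an explicit error (`partialSum_mul_le`). Comparing min ψ_k with ψ_k(x*) bounds the residual by four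
terms (`partialSum_mul_residual_le`): the prox term β_k D(x*), the bias δ Σ B_i, a weighted sum of
squared noises ‖ζ_i‖², and Σ α_i ζ_i(x* - z_{i-1}). The squares appear because Young's inequality
charges the noise to the growing part κ_i of β_i. The last sum is a martingale, because z_{i-1} is
fixed before batch i is drawn.

The noise of a batch mean has size σ/√m with a constant free of the dimension. Pinelis' inequality
(`exists_cosh_norm_add_le`) controls cosh(c‖sum‖) for every scale c, and averaging over a Gaussian
scale turns this into an exponential moment of the squared norm
(`IsLightTailed.lintegral_exp_sq_sum_le`). Over a run, Jensen's inequality handles the squares and a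
Chernoff bound the martingale; each fails with probability at most e^{-t} (`seqLaw_noise_le`).
Conditional expectations are replaced by resampling one entry of an i.i.d. sequence
(`lintegral_seqLaw_eq`). This needs measurable iterates, hence a measurable argmin
(`measurable_argminOn`).

For the restarts, N_k and m_k make each of the first three terms of `stageBound` at most μR_k²/(6e);
together with the bias they sum to at most μR_{k+1}²/2 (`stageBound_le`). Strong convexity then
gives ‖u_{k+1} - x*‖ ≤ R_{k+1}, so x* is feasible in the next stage and the induction continues.
With t = ln(3N/Λ) the N stages fail with total probability at most 2Λ/3. The batch sizes grow
geometrically, so the noise part of the number of calls is dominated by the last stage, where e^N is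
of order μR_0²/ε. -/

noncomputable section

namespace Sigma2

open Filter Topology
open scoped ENNReal NNReal

/-! ### Strong convexity and first-order optimality along segments -/

section Convexity

variable {E : Type*} [NormedAddCommGroup E] [InnerProductSpace ℝ E]

theorem tendsto_slope_fderiv {D : E → ℝ} {z : E} (hD : DifferentiableAt ℝ D z) (v : E) :
    Tendsto (fun t : ℝ => t⁻¹ * (D (z + t • v) - D z)) (𝓝[>] 0) (𝓝 (fderiv ℝ D z v)) := by
  have := (hD.hasFDerivAt.hasLineDerivAt v).tendsto_slope_zero_right
  simpa using this

theorem eventually_mem_Ioc : ∀ᶠ t : ℝ in 𝓝[>] 0, t ∈ Set.Ioc (0 : ℝ) 1 :=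
  Ioc_mem_nhdsGT one_pos

theorem le_fderiv_of_forall {D : E → ℝ} {z v : E} {c : ℝ} (hD : DifferentiableAt ℝ D z)
    (H : ∀ t ∈ Set.Ioc (0 : ℝ) 1, D z + t * c ≤ D (z + t • v)) : c ≤ fderiv ℝ D z v := by
  refine ge_of_tendsto (tendsto_slope_fderiv hD v) ?_
  filter_upwards [eventually_mem_Ioc] with t ht
  have := H t ht
  rw [inv_mul_eq_div, le_div_iff₀ ht.1]
  linarith

/-- The slack `t * e` vanishes in the limit; it makes room for the factor 1 - t in the quadratic
term of strong convexity. -/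
theorem fderiv_le_of_forall {D : E → ℝ} {z v : E} {c e : ℝ} (hD : DifferentiableAt ℝ D z)
    (H : ∀ t ∈ Set.Ioc (0 : ℝ) 1, D (z + t • v) ≤ D z + t * (c + t * e)) :
    fderiv ℝ D z v ≤ c := by
  have h1 : Tendsto (fun t : ℝ => c + t * e) (𝓝[>] 0) (𝓝 c) := by
    have : Tendsto (fun t : ℝ => c + t * e) (𝓝 0) (𝓝 (c + 0 * e)) :=
      Continuous.tendsto (by fun_prop) 0
    simpa using this.mono_left nhdsWithin_le_nhds
  refine le_of_tendsto_of_tendsto (tendsto_slope_fderiv hD v) h1 ?_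
  filter_upwards [eventually_mem_Ioc] with t ht
  have := H t ht
  rw [inv_mul_eq_div, div_le_iff₀ ht.1]
  linarith

theorem add_smul_sub_eq (x z : E) (t : ℝ) : z + t • (x - z) = (1 - t) • z + t • x := by
  module

theorem _root_.Convex.add_smul_sub_mem_of_Ioc {S : Set E} (hS : Convex ℝ S) {x z : E} (hx : x ∈ S)
    (hz : z ∈ S) {t : ℝ} (ht : t ∈ Set.Ioc (0 : ℝ) 1) : z + t • (x - z) ∈ S :=
  hS.add_smul_sub_mem hz hx ⟨ht.1.le, ht.2⟩

/-- A differentiable strongly convex function has a quadratic lower bound on its Bregman distance. -/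
theorem le_bregman_of_strongConvexOn {S : Set E} {D : E → ℝ} {m : ℝ} (hD : StrongConvexOn S m D)
    {x z : E} (hx : x ∈ S) (hz : z ∈ S) (hd : DifferentiableAt ℝ D z) :
    m / 2 * ‖x - z‖ ^ 2 ≤ bregman D x z := by
  have : fderiv ℝ D z (x - z) ≤ D x - D z - m / 2 * ‖x - z‖ ^ 2 := by
    refine fderiv_le_of_forall (e := m / 2 * ‖x - z‖ ^ 2) hd fun t ht => ?_
    have h := hD.2 hz hx (sub_nonneg.2 ht.2) ht.1.le (by ring)
    rw [add_smul_sub_eq]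
    simp only [smul_eq_mul, norm_sub_rev z x] at h
    nlinarith
  unfold bregman
  linarith

/-- Quadratic growth of a strongly convex function at its minimizer. -/
theorem _root_.StrongConvexOn.le_sub_of_isMinOn {S : Set E} {Φ : E → ℝ} {m : ℝ}
    (hΦ : StrongConvexOn S m Φ) {z x : E} (hz : z ∈ S) (hmin : IsMinOn Φ S z) (hx : x ∈ S) :
    m / 2 * ‖x - z‖ ^ 2 ≤ Φ x - Φ z := by
  have h1 : Tendsto (fun t : ℝ => (1 - t) * (m / 2 * ‖x - z‖ ^ 2)) (𝓝[>] 0)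
      (𝓝 (m / 2 * ‖x - z‖ ^ 2)) := by
    have : Tendsto (fun t : ℝ => (1 - t) * (m / 2 * ‖x - z‖ ^ 2)) (𝓝 0)
        (𝓝 ((1 - 0) * (m / 2 * ‖x - z‖ ^ 2))) := Continuous.tendsto (by fun_prop) 0
    simpa using this.mono_left nhdsWithin_le_nhds
  refine le_of_tendsto h1 ?_
  filter_upwards [eventually_mem_Ioc] with t ht
  have h := hΦ.2 hz hx (sub_nonneg.2 ht.2) ht.1.le (by ring)
  have h2 : Φ z ≤ Φ ((1 - t) • z + t • x) := hmin (hΦ.1 hz hx (sub_nonneg.2 ht.2) ht.1.le (by ring))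
  simp only [smul_eq_mul, norm_sub_rev z x] at h
  have h3 : t * ((1 - t) * (m / 2 * ‖x - z‖ ^ 2)) ≤ t * (Φ x - Φ z) := by nlinarith
  exact le_of_mul_le_mul_left h3 ht.1

/-- First-order optimality for the sum of a differentiable function and a convex one. -/
theorem fderiv_add_nonneg_of_isMinOn {S : Set E} {D c : E → ℝ} {β : ℝ} (hc : ConvexOn ℝ S c)
    {z x : E} (hz : z ∈ S) (hx : x ∈ S) (hd : DifferentiableAt ℝ D z) (hβ : 0 < β)
    (hmin : IsMinOn (fun v => β * D v + c v) S z) :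
    0 ≤ β * fderiv ℝ D z (x - z) + (c x - c z) := by
  have : (c z - c x) / β ≤ fderiv ℝ D z (x - z) := by
    refine le_fderiv_of_forall hd fun t ht => ?_
    have h := hc.2 hz hx (sub_nonneg.2 ht.2) ht.1.le (by ring)
    have h2 : β * D z + c z ≤ β * D (z + t • (x - z)) + c (z + t • (x - z)) :=
      hmin (hc.1.add_smul_sub_mem_of_Ioc hx hz ht)
    rw [add_smul_sub_eq] at h2 ⊢
    simp only [smul_eq_mul] at h
    have h3 : β * (D z + t * ((c z - c x) / β)) ≤ β * D ((1 - t) • z + t • x) := by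
      have : β * (D z + t * ((c z - c x) / β)) = β * D z + t * (c z - c x) := by
        field_simp
      rw [this]; linarith
    exact le_of_mul_le_mul_left h3 hβ
  rw [div_le_iff₀ hβ] at this
  linarith

end Convexity

/-! ### One-step exponential inequalities -/

section Cosh

/-- `t ↦ cosh √t` is convex: the value at a convex combination of squares is below the chord. -/
theorem cosh_le_chord {u v r a b : ℝ} (ha : 0 ≤ a) (hb : 0 ≤ b) (hab : a + b = 1)
    (hr : r ^ 2 = a * u ^ 2 + b * v ^ 2) :
    Real.cosh r ≤ a * Real.cosh u + b * Real.cosh v := by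
  -- cosh √t is a power series in t with nonnegative coefficients, so convexity holds term by term.
  refine hasSum_le (fun n => ?_) (Real.hasSum_cosh r)
    (((Real.hasSum_cosh u).mul_left a).add ((Real.hasSum_cosh v).mul_left b))
  have h := (convexOn_pow (𝕜 := ℝ) n).2 (Set.mem_Ici.2 (sq_nonneg u)) (Set.mem_Ici.2 (sq_nonneg v))
    ha hb hab
  simp only [smul_eq_mul] at h
  rw [pow_mul, pow_mul, pow_mul, hr, ← mul_div_assoc, ← mul_div_assoc, ← add_div]
  gcongr

theorem self_le_sinh_of_nonneg {r : ℝ} (hr : 0 ≤ r) : r ≤ Real.sinh r :=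
  Real.self_le_sinh_iff.2 hr

theorem sinh_le_cosh (r : ℝ) : Real.sinh r ≤ Real.cosh r := (Real.sinh_lt_cosh r).le

/-- Pinelis' inequality for one step of a vector-valued martingale in a Hilbert space. -/
theorem exists_cosh_norm_add_le {H : Type*} [NormedAddCommGroup H] [InnerProductSpace ℝ H] (s : H) :
    ∃ T : H →L[ℝ] ℝ, ∀ x, Real.cosh ‖s + x‖
      ≤ T x + Real.cosh ‖s‖ * (Real.exp ‖x‖ - ‖x‖) := by
  -- This is the gradient of cosh ‖·‖ at s. For s = 0 division by zero gives the zero functional,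
  -- again the gradient.
  refine ⟨(Real.sinh ‖s‖ / ‖s‖) • innerSL ℝ s, fun x => ?_⟩
  have hc1 : 1 ≤ Real.cosh ‖s‖ := Real.one_le_cosh _
  rcases eq_or_ne ‖s‖ 0 with hs | hs
  · have : s = 0 := norm_eq_zero.1 hs
    subst this
    simp only [zero_add, norm_zero, Real.sinh_zero, zero_div, zero_smul, Real.cosh_zero, one_mul,
      zero_apply]
    rw [← Real.cosh_add_sinh]
    linarith [self_le_sinh_of_nonneg (norm_nonneg x)]
  rcases eq_or_ne ‖x‖ 0 with hx | hx
  · have : x = 0 := norm_eq_zero.1 hx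
    subst this
    simp
  have hs0 : 0 < ‖s‖ := lt_of_le_of_ne (norm_nonneg _) (Ne.symm hs)
  have hx0 : 0 < ‖x‖ := lt_of_le_of_ne (norm_nonneg _) (Ne.symm hx)
  set a := ‖s‖
  set r := ‖x‖
  set θ := inner ℝ s x / (a * r) with hθ
  have hθabs : |θ| ≤ 1 := abs_real_inner_div_norm_mul_norm_le_one s x
  obtain ⟨h1, h2⟩ := abs_le.1 hθabs
  have hin : inner ℝ s x = θ * (a * r) := by rw [hθ]; field_simp
  -- With θ the cosine of the angle, ‖s + x‖² is the convex combination of (a + r)² and (a - r)²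
  -- with weights (1 ± θ)/2. The chord becomes cosh a cosh r + θ sinh a sinh r.
  have hch := cosh_le_chord (u := a + r) (v := a - r) (r := ‖s + x‖) (a := (1 + θ) / 2)
    (b := (1 - θ) / 2) (by linarith) (by linarith) (by ring) (by
      rw [norm_add_sq_real, hin]; ring)
  rw [Real.cosh_add, Real.cosh_sub] at hch
  have hsr := self_le_sinh_of_nonneg hx0.le
  have hsa := sinh_le_cosh a
  have hsa0 : 0 ≤ Real.sinh a := Real.sinh_nonneg_iff.2 hs0.le
  simp only [smul_apply, innerSL_apply_apply, smul_eq_mul]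
  rw [hin, ← Real.cosh_add_sinh r]
  have e1 : Real.sinh a / a * (θ * (a * r)) = θ * Real.sinh a * r := by field_simp
  rw [e1]
  have e2 : θ * Real.sinh a * (Real.sinh r - r) ≤ Real.cosh a * (Real.sinh r - r) := by
    refine mul_le_mul_of_nonneg_right ?_ (by linarith)
    nlinarith
  nlinarith

/-- The noise lives in the dual space; the Riesz isometry carries the Hilbert space inequality over.
-/
theorem exists_cosh_norm_add_le_dual {E : Type*} [NormedAddCommGroup E] [InnerProductSpace ℝ E]
    [CompleteSpace E] (s : E →L[ℝ] ℝ) :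
    ∃ T : (E →L[ℝ] ℝ) →L[ℝ] ℝ, ∀ x, Real.cosh ‖s + x‖
      ≤ T x + Real.cosh ‖s‖ * (Real.exp ‖x‖ - ‖x‖) := by
  set J := (InnerProductSpace.toDual ℝ E).symm
  obtain ⟨T, hT⟩ := exists_cosh_norm_add_le (J s)
  refine ⟨T.comp (J.toContinuousLinearEquiv.toContinuousLinearMap : (E →L[ℝ] ℝ) →L[ℝ] E),
    fun x => ?_⟩
  have := hT (J x)
  rw [← map_add, J.norm_map, J.norm_map, J.norm_map] at this
  exact this

/-- Scalar analogue of the Pinelis step: a linear part, which will have mean zero, and a remainder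
depending on the size only. It holds because e^x - x increases on x ≥ 0 and, for negative g, because
-g ≤ sinh(-g). -/
theorem exp_le_add_exp_sub {g r : ℝ} (h : |g| ≤ r) : Real.exp g ≤ g + (Real.exp r - r) := by
  have hr : 0 ≤ r := (abs_nonneg g).trans h
  have key : ∀ {x y : ℝ}, 0 ≤ x → x ≤ y → Real.exp x - x ≤ Real.exp y - y := by
    intro x y hx hxy
    have h1 : Real.exp y = Real.exp x * Real.exp (y - x) := by rw [← Real.exp_add]; ring_nf
    have h2 := Real.add_one_le_exp (y - x)
    have h3 : 1 ≤ Real.exp x := Real.one_le_exp hx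
    nlinarith
  rcases le_total 0 g with hg | hg
  · rw [abs_of_nonneg hg] at h
    linarith [key hg h]
  · rw [abs_of_nonpos hg] at h
    have h1 := key (neg_nonneg.2 hg) h
    have h2 := self_le_sinh_of_nonneg (neg_nonneg.2 hg)
    rw [Real.sinh_eq, neg_neg] at h2
    linarith

/-- Removing the linear term leaves a quadratic exponent: for r ≤ 1 the left side is at most 1 + r².
-/
theorem exp_sub_self_le_exp_sq {r : ℝ} (hr : 0 ≤ r) : Real.exp r - r ≤ Real.exp (r ^ 2) := by
  rcases le_total r 1 with h | h
  · have h1 := (abs_le.1 (Real.abs_exp_sub_one_sub_id_le (x := r) (by rwa [abs_of_nonneg hr]))).2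
    linarith [Real.add_one_le_exp (r ^ 2)]
  · have : Real.exp r ≤ Real.exp (r ^ 2) := Real.exp_le_exp.2 (by nlinarith)
    linarith

end Cosh

/-- Young's inequality, by completing the square in ‖v‖. It trades a noise term for a share of the
quadratic term. -/
theorem neg_sq_div_le {E : Type*} [NormedAddCommGroup E] [NormedSpace ℝ E] (ζ : E →L[ℝ] ℝ) (v : E)
    {a c : ℝ} (ha : 0 < a) (hc : 0 < c) :
    -(a ^ 2 * ‖ζ‖ ^ 2 / (2 * c)) ≤ a * ζ v + c / 2 * ‖v‖ ^ 2 := by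
  have h1 : -(‖ζ‖ * ‖v‖) ≤ ζ v := (abs_le.1 ((Real.norm_eq_abs _).symm ▸ ζ.le_opNorm v)).1
  have h2 : a ^ 2 * ‖ζ‖ ^ 2 / (2 * c) = c / 2 * (a * ‖ζ‖ / c) ^ 2 := by field_simp
  have h3 : a * (‖ζ‖ * ‖v‖) = c * (a * ‖ζ‖ / c) * ‖v‖ := by field_simp
  have h4 := sq_nonneg (a * ‖ζ‖ / c - ‖v‖)
  have h5 : a * -(‖ζ‖ * ‖v‖) ≤ a * ζ v := mul_le_mul_of_nonneg_left h1 ha.le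
  rw [h2]
  nlinarith

/-! ### Estimating sequence for one run with arbitrary answers -/

section Deterministic

variable {E : Type*} [NormedAddCommGroup E] [InnerProductSpace ℝ E]

omit [InnerProductSpace ℝ E] in
theorem argminOn_spec {S : Set E} {Φ : E → ℝ} (h : ∃ x ∈ S, IsMinOn Φ S x) :
    argminOn S Φ ∈ S ∧ IsMinOn Φ S (argminOn S Φ) :=
  Classical.epsilon_spec (p := fun x => x ∈ S ∧ IsMinOn Φ S x) h

omit [NormedAddCommGroup E] [InnerProductSpace ℝ E] in
theorem isMinOn_congr_add_const {S : Set E} {Φ Ψ : E → ℝ} {c : ℝ} (h : ∀ v, Φ v = Ψ v + c) (x : E) :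
    IsMinOn Φ S x ↔ IsMinOn Ψ S x := by
  simp only [isMinOn_iff, h, add_le_add_iff_right]

omit [InnerProductSpace ℝ E] in
-- Lets affine models be replaced by their slopes, the only data on which solvability and
-- measurability have to be studied.
theorem argminOn_congr_add_const {S : Set E} {Φ Ψ : E → ℝ} {c : ℝ} (h : ∀ v, Φ v = Ψ v + c) :
    argminOn S Φ = argminOn S Ψ := by
  unfold argminOn
  simp only [isMinOn_congr_add_const h]

/-- The requirements on the feasible set `S`, the prox-function `D` and the composite term `h` of
one run of the method: `D` is `ρ`-strongly convex on `S`, minimal at the starting point, and the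
auxiliary problems are solvable. -/
structure IsProxSetup (S : Set E) (D h : E → ℝ) (x0 : E) (ρ : ℝ) : Prop where
  convex : Convex ℝ S
  mem : x0 ∈ S
  convexOn : ConvexOn ℝ S h
  diff : ∀ x ∈ S, DifferentiableAt ℝ D x
  le_bregman : ∀ x ∈ S, ∀ z ∈ S, ρ / 2 * ‖x - z‖ ^ 2 ≤ bregman D x z
  le_prox : ∀ x ∈ S, ρ / 2 * ‖x - x0‖ ^ 2 ≤ D x
  solvable : ∀ β A : ℝ, 0 < β → 0 < A → ∀ ℓ : E →L[ℝ] ℝ,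
    ∃ x ∈ S, IsMinOn (fun v => β * D v + ℓ v + A * h v) S x

/-- The requirements on the coefficients of the method: `κ` bounds from below the part of
`β` that remains after the oracle constant `L` is absorbed. -/
structure IsStepSequence (α β B κ : ℕ → ℝ) (L ρ : ℝ) : Prop where
  alpha_pos : ∀ i, 0 < α i
  beta_pos : ∀ i, 0 < β i
  beta_mono : ∀ i, β i ≤ β (i + 1)
  kappa_pos : ∀ i, 0 < κ i
  alpha_le : ∀ i, α i ≤ B i
  le_partialSum : ∀ i, B i ≤ partialSum α i
  kappa_zero : α 0 * L + κ 0 * ρ ≤ β 0 * ρ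
  kappa_succ : ∀ i, L * (α (i + 1) ^ 2 / B (i + 1)) + κ (i + 1) * ρ ≤ β i * ρ

variable {S : Set E} {D h : E → ℝ} {α β B κ : ℕ → ℝ} {x0 : E} {ρ L : ℝ}

theorem IsStepSequence.partialSum_pos (hs : IsStepSequence α β B κ L ρ) (k : ℕ) :
    0 < partialSum α k :=
  (hs.alpha_pos k).trans_le ((hs.alpha_le k).trans (hs.le_partialSum k))

theorem partialSum_succ (α : ℕ → ℝ) (k : ℕ) :
    partialSum α (k + 1) = partialSum α k + α (k + 1) := by
  simp [partialSum, Finset.sum_range_succ]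

theorem partialSum_zero (α : ℕ → ℝ) : partialSum α 0 = α 0 := by
  simp [partialSum]

/-- The point `z_{i-1}`, where `z_{-1}` is the starting point. -/
def prevZ (S : Set E) (D h : E → ℝ) (α β B : ℕ → ℝ) (x0 : E) (answer : ℕ → E → (E →L[ℝ] ℝ)) :
    ℕ → E
  | 0 => x0
  | k + 1 => (sigm S D h α β B x0 answer k).z

variable (S D h α β B x0) (answer : ℕ → E → (E →L[ℝ] ℝ))

local notation "st" => sigm S D h α β B x0 answer

/-- The slope of the accumulated linear model. -/
def slope (k : ℕ) : E →L[ℝ] ℝ :=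
  ∑ i ∈ Finset.range (k + 1), α i • answer i (st i).x

/-- The solution of the second auxiliary problem in iteration `k + 1`. -/
def auxPoint (k : ℕ) : E :=
  argminOn S fun v => β k * bregman D v (st k).z
    + α (k + 1) * answer (k + 1) (st (k + 1)).x (v - (st k).z) + α (k + 1) * h v

theorem sigm_x_succ (k : ℕ) : (st (k + 1)).x =
    (α (k + 1) / B (k + 1)) • (st k).z + (1 - α (k + 1) / B (k + 1)) • (st k).y := rfl

theorem sigm_y_succ (k : ℕ) : (st (k + 1)).y =
    ((partialSum α (k + 1) - B (k + 1)) / partialSum α (k + 1)) • (st k).y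
      + (B (k + 1) / partialSum α (k + 1)) •
        ((α (k + 1) / B (k + 1)) • auxPoint S D h α β B x0 answer k
          + (1 - α (k + 1) / B (k + 1)) • (st k).y) := rfl

theorem sigm_lin_succ (k : ℕ) (v : E) : (st (k + 1)).lin v =
    (st k).lin v + α (k + 1) * answer (k + 1) (st (k + 1)).x (v - (st (k + 1)).x) := rfl

theorem sigm_lin_eq_sum (k : ℕ) (v : E) : (st k).lin v =
    ∑ i ∈ Finset.range (k + 1), α i * answer i (st i).x (v - (st i).x) := by
  induction k with
  | zero => simp [sigm]
  | succ k ih => rw [sigm_lin_succ, ih, Finset.sum_range_succ _ (k + 1)]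

theorem sigm_lin_eq (k : ℕ) : ∃ c : ℝ, ∀ v, (st k).lin v =
    slope S D h α β B x0 answer k v + c := by
  refine ⟨-∑ i ∈ Finset.range (k + 1), α i * answer i (st i).x (st i).x, fun v => ?_⟩
  rw [sigm_lin_eq_sum, slope, ← sub_eq_add_neg, sum_apply, ← Finset.sum_sub_distrib]
  refine Finset.sum_congr rfl fun i _ => ?_
  simp [mul_sub]

theorem sigm_z_eq_argminOn_lin (k : ℕ) : (st k).z =
    argminOn S fun v => β k * D v + (st k).lin v + partialSum α k * h v := by
  cases k <;> rfl

theorem sigm_z_eq (k : ℕ) : (st k).z =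
    argminOn S fun v => β k * D v + slope S D h α β B x0 answer k v + partialSum α k * h v := by
  obtain ⟨c, hc⟩ := sigm_lin_eq S D h α β B x0 answer k
  rw [sigm_z_eq_argminOn_lin]
  exact argminOn_congr_add_const (c := c) fun v => by rw [hc]; ring

theorem sigm_y_zero : (st 0).y = (st 0).z := by
  simp [sigm, partialSum_zero]

/-- The Bregman distance is D minus an affine function, so the second auxiliary problem has the
shape β D + linear + A h of the first; one existence and one measurability result serve both. -/
theorem auxPoint_eq (k : ℕ) : auxPoint S D h α β B x0 answer k =
    argminOn S fun v => β k * D v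
      + (α (k + 1) • answer (k + 1) (st (k + 1)).x - β k • fderiv ℝ D (st k).z) v
      + α (k + 1) * h v := by
  refine argminOn_congr_add_const
    (c := -(α (k + 1) * answer (k + 1) (st (k + 1)).x (st k).z) - β k * D (st k).z
      + β k * fderiv ℝ D (st k).z (st k).z) fun v => ?_
  simp only [bregman, map_sub, sub_apply, smul_apply, smul_eq_mul]
  ring

variable (gd : E → (E →L[ℝ] ℝ))

/-- The error of the oracle's answer in iteration `i`. -/
def stepNoise (i : ℕ) : E →L[ℝ] ℝ :=
  answer i (st i).x - gd (st i).x

local notation "ζ" => stepNoise S D h α β B x0 answer gd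
local notation "zp" => prevZ S D h α β B x0 answer

/-- The accumulated error of the estimating sequence. -/
def accumError (δ ρ : ℝ) (κ : ℕ → ℝ) (k : ℕ) : ℝ :=
  ∑ i ∈ Finset.range (k + 1), (B i * δ + α i ^ 2 * ‖ζ i‖ ^ 2 / (2 * (κ i * ρ))
    - α i * ζ i (zp i - (st i).x))

variable {S D h α β B x0}

variable (hP : IsProxSetup S D h x0 ρ) (hs : IsStepSequence α β B κ L ρ)
include hP hs

theorem sigm_z_spec (k : ℕ) : (st k).z ∈ S ∧
    IsMinOn (fun v => β k * D v + (st k).lin v + partialSum α k * h v) S (st k).z := by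
  have := argminOn_spec (hP.solvable _ _ (hs.beta_pos k) (hs.partialSum_pos k)
    (slope S D h α β B x0 answer k))
  rw [← sigm_z_eq] at this
  obtain ⟨c, hc⟩ := sigm_lin_eq S D h α β B x0 answer k
  exact ⟨this.1, (isMinOn_congr_add_const (c := c) (fun v => by rw [hc]; ring) _).2 this.2⟩

theorem auxPoint_spec (k : ℕ) : auxPoint S D h α β B x0 answer k ∈ S ∧
    IsMinOn (fun v => β k * bregman D v (st k).z
      + α (k + 1) * answer (k + 1) (st (k + 1)).x (v - (st k).z) + α (k + 1) * h v) S
      (auxPoint S D h α β B x0 answer k) := by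
  have := hP.solvable _ _ (hs.beta_pos k) (hs.alpha_pos (k + 1))
    (α (k + 1) • answer (k + 1) (st (k + 1)).x - β k • fderiv ℝ D (st k).z)
  obtain ⟨x, hx, hmin⟩ := this
  refine argminOn_spec ⟨x, hx, ?_⟩
  refine (isMinOn_congr_add_const
    (c := -(α (k + 1) * answer (k + 1) (st (k + 1)).x (st k).z) - β k * D (st k).z
      + β k * fderiv ℝ D (st k).z (st k).z) (fun v => ?_) x).2 hmin
  simp only [bregman, map_sub, sub_apply, smul_apply, smul_eq_mul]
  ring

omit hP in
theorem IsStepSequence.tau_mem (k : ℕ) : 0 ≤ α k / B k ∧ α k / B k ≤ 1 := by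
  have hB : 0 < B k := (hs.alpha_pos k).trans_le (hs.alpha_le k)
  exact ⟨(div_pos (hs.alpha_pos k) hB).le, (div_le_one hB).2 (hs.alpha_le k)⟩

theorem sigm_mid_mem {k : ℕ} (hy : (st k).y ∈ S) {v : E} (hv : v ∈ S) :
    (α (k + 1) / B (k + 1)) • v + (1 - α (k + 1) / B (k + 1)) • (st k).y ∈ S := by
  obtain ⟨h0, h1⟩ := hs.tau_mem (k + 1)
  exact hP.convex hv hy h0 (sub_nonneg.2 h1) (by ring)

theorem sigm_y_mem (k : ℕ) : (st k).y ∈ S := by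
  induction k with
  | zero => rw [sigm_y_zero]; exact (sigm_z_spec answer hP hs 0).1
  | succ k ih =>
    have hA := hs.partialSum_pos (k + 1)
    have hB : 0 < B (k + 1) := (hs.alpha_pos _).trans_le (hs.alpha_le _)
    rw [sigm_y_succ]
    refine hP.convex ih (sigm_mid_mem answer hP hs ih (auxPoint_spec answer hP hs k).1)
      (div_nonneg (sub_nonneg.2 (hs.le_partialSum _)) hA.le) (by positivity) ?_
    rw [← add_div, sub_add_cancel, div_self hA.ne']

theorem sigm_x_mem (k : ℕ) : (st k).x ∈ S := by
  cases k with
  | zero => exact hP.mem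
  | succ k => exact sigm_mid_mem answer hP hs (sigm_y_mem answer hP hs k) (sigm_z_spec answer hP hs k).1

theorem prevZ_mem (k : ℕ) : prevZ S D h α β B x0 answer k ∈ S := by
  cases k with
  | zero => exact hP.mem
  | succ k => exact (sigm_z_spec answer hP hs k).1

omit hs in
theorem convexOn_sigm_lin (k : ℕ) : ConvexOn ℝ S (fun v => (st k).lin v) := by
  obtain ⟨c, hc⟩ := sigm_lin_eq S D h α β B x0 answer k
  simp only [hc]
  exact ((slope S D h α β B x0 answer k).toLinearMap.convexOn hP.convex).add_const c

/-- The value of the estimating function at its minimizer grows quadratically. -/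
theorem sigm_model_growth (k : ℕ) {v : E}
    (hv : v ∈ S) :
    β k * D (st k).z + (st k).lin (st k).z + partialSum α k * h (st k).z
        + β k * bregman D v (st k).z
      ≤ β k * D v + (st k).lin v + partialSum α k * h v := by
  obtain ⟨hz, hmin⟩ := sigm_z_spec answer hP hs k
  have hc : ConvexOn ℝ S (fun v => (st k).lin v + partialSum α k * h v) :=
    (convexOn_sigm_lin answer hP k).add (hP.convexOn.smul (hs.partialSum_pos k).le)
  have h1 := fderiv_add_nonneg_of_isMinOn (D := D) hc hz hv (hP.diff _ hz) (hs.beta_pos k) (by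
    simpa only [add_assoc] using hmin)
  simp only [bregman]
  linarith

variable {Q : Set E} {f : E → ℝ} {δ : ℝ} {fd : E → ℝ} {gd}

/-- The estimating function dominates the objective at `y_k` up to the accumulated error. -/
theorem partialSum_mul_le (hρ : 0 < ρ) (hδ : 0 ≤ δ) (hSQ : S ⊆ Q)
    (hf : ConvexOn ℝ Q f) (hor : IsInexactOracle Q f L δ fd gd) (k : ℕ) :
    partialSum α k * (f (st k).y + h (st k).y) ≤
      β k * D (st k).z + (st k).lin (st k).z + partialSum α k * h (st k).z
        + ∑ i ∈ Finset.range (k + 1), α i * fd (st i).x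
        + accumError S D h α β B x0 answer gd δ ρ κ k := by
  have hx := fun k => sigm_x_mem answer hP hs k
  have hy := fun k => sigm_y_mem answer hP hs k
  have hz := fun k => (sigm_z_spec answer hP hs k).1
  induction k with
  | zero =>
    have ho := (hor _ (hSQ (hx 0)) _ (hSQ (hy 0))).2
    rw [sigm_y_zero] at ho ⊢
    have hD := hP.le_prox _ (hz 0)
    have hx0 : (st 0).x = x0 := rfl
    have hlin : (st 0).lin (st 0).z = α 0 * answer 0 x0 ((st 0).z - x0) := rfl
    have hα := hs.alpha_pos 0
    have hκ := mul_pos (hs.kappa_pos 0) hρ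
    have hyoung := neg_sq_div_le (ζ 0) ((st 0).z - x0) hα hκ
    -- The first step incurs the bias with weight α 0 only; it is charged as B 0 for uniformity.
    have hB := mul_le_mul_of_nonneg_right (hs.alpha_le 0) hδ
    have hζ : ζ 0 ((st 0).z - x0) = answer 0 x0 ((st 0).z - x0) - gd x0 ((st 0).z - x0) := rfl
    have h0 : ζ 0 (zp 0 - x0) = 0 := by simp [prevZ]
    have hk := mul_le_mul_of_nonneg_right hs.kappa_zero (sq_nonneg ‖(st 0).z - x0‖)
    have hb := mul_le_mul_of_nonneg_left hD (hs.beta_pos 0).le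
    rw [partialSum_zero, hlin, accumError]
    simp only [zero_add, Finset.sum_range_one, hx0, h0]
    rw [hx0, norm_sub_rev] at ho
    have ho' := mul_le_mul_of_nonneg_left ho hα.le
    rw [hζ] at hyoung
    nlinarith
  | succ k ih =>
    set A := partialSum α (k + 1) with hA
    set Bk := B (k + 1) with hBk
    set a := α (k + 1) with ha
    set xh := auxPoint S D h α β B x0 answer k with hxh
    set x := (st (k + 1)).x with hxdef
    set y := (st k).y with hydef
    set z := (st k).z with hzdef
    set z' := (st (k + 1)).z with hz'def
    set G := answer (k + 1) x with hG
    set w := (a / Bk) • xh + (1 - a / Bk) • y with hw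
    have hapos : 0 < a := hs.alpha_pos _
    have hBpos : 0 < Bk := hapos.trans_le (hs.alpha_le _)
    have hApos : 0 < A := hs.partialSum_pos _
    have haB : a ≤ Bk := hs.alpha_le _
    have hBA : Bk ≤ A := hs.le_partialSum _
    obtain ⟨hτ0, hτ1⟩ := hs.tau_mem (k + 1)
    have hAk : partialSum α k = A - a := by rw [hA, partialSum_succ]; ring
    obtain ⟨hxhS, hxhmin⟩ := auxPoint_spec answer hP hs k
    have hwS : w ∈ S := sigm_mid_mem answer hP hs (hy k) hxhS
    -- growth of the previous model, at the new minimizer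
    have hgrow := sigm_model_growth answer hP hs k (hz (k + 1))
    have hD0 : 0 ≤ D z' := le_trans (by positivity) (hP.le_prox _ (hz (k + 1)))
    have hβ := mul_le_mul_of_nonneg_right (hs.beta_mono k) hD0
    -- The growth of the old model leaves exactly the objective of the second auxiliary problem, at
    -- z'. Its minimality at `xh` moves everything to `xh`, and the oracle is then needed only at w.
    have haux : β k * bregman D xh z + a * G (xh - z) + a * h xh
        ≤ β k * bregman D z' z + a * G (z' - z) + a * h z' := hxhmin (hz (k + 1))
    have hbreg := mul_le_mul_of_nonneg_left (hP.le_bregman _ hxhS _ (hz k)) (hs.beta_pos k).le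
    -- the oracle at the new point
    have hoy := (hor _ (hSQ (hx (k + 1))) _ (hSQ (hy k))).1
    have how := (hor _ (hSQ (hx (k + 1))) _ (hSQ hwS)).2
    have hτB : a / Bk * Bk = a := by field_simp
    -- Both points mix with y in the same proportion. Hence the oracle's quadratic term at w, times
    -- B, is L (a²/B)/2 ‖xh - z‖², which `kappa_succ` absorbs.
    have hwx : w - x = (a / Bk) • (xh - z) := by
      rw [hw, hxdef, sigm_x_succ]; module
    have hnw : ‖x - w‖ ^ 2 = (a / Bk) ^ 2 * ‖xh - z‖ ^ 2 := by
      rw [norm_sub_rev, hwx, norm_smul, Real.norm_of_nonneg hτ0]; ring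
    have hhw : h w ≤ a / Bk * h xh + (1 - a / Bk) * h y :=
      hP.convexOn.2 hxhS (hy k) hτ0 (sub_nonneg.2 hτ1) (by ring)
    have hgw : Bk * gd x (w - x) = a * gd x (xh - x) + (Bk - a) * gd x (y - x) := by
      have : w - x = (a / Bk) • (xh - x) + (1 - a / Bk) • (y - x) := by rw [hw]; module
      rw [this]
      simp only [map_add, map_smul, smul_eq_mul]
      field_simp
    -- convexity of the objective along the update of `y`
    have hynew : A * (f (st (k + 1)).y + h (st (k + 1)).y)
        ≤ (A - Bk) * (f y + h y) + Bk * (f w + h w) := by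
      have hyeq : (st (k + 1)).y = ((A - Bk) / A) • y + (Bk / A) • w := rfl
      have hc1 : 0 ≤ (A - Bk) / A := div_nonneg (sub_nonneg.2 hBA) hApos.le
      have hc2 : 0 ≤ Bk / A := by positivity
      have hc3 : (A - Bk) / A + Bk / A = 1 := by field_simp; ring
      have h1 := hf.2 (hSQ (hy k)) (hSQ hwS) hc1 hc2 hc3
      have h2 := hP.convexOn.2 (hy k) hwS hc1 hc2 hc3
      rw [← hyeq] at h1 h2
      simp only [smul_eq_mul] at h1 h2
      have h3 := mul_le_mul_of_nonneg_left (add_le_add h1 h2) hApos.le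
      refine h3.trans (le_of_eq ?_)
      field_simp
      ring
    -- Young's inequality for the noise
    have hκ := mul_pos (hs.kappa_pos (k + 1)) hρ
    have hyoung := neg_sq_div_le (ζ (k + 1)) (xh - z) hapos hκ
    have hk := mul_le_mul_of_nonneg_right (hs.kappa_succ k) (sq_nonneg ‖xh - z‖)
    have hζ : ∀ v, ζ (k + 1) v = G v - gd x v := fun v => rfl
    have hlin : (st (k + 1)).lin z' = (st k).lin z' + a * G (z' - x) := rfl
    have hzp : zp (k + 1) = z := rfl
    -- The share B - a of the linearization at w points towards y, where the lower oracle bound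
    -- gives f y; this is where α ≤ B enters.
    have hmul1 := mul_nonneg (sub_nonneg.2 haB) hoy
    have hmul2 := mul_le_mul_of_nonneg_left how hBpos.le
    have hmul3 := mul_le_mul_of_nonneg_left hhw hBpos.le
    have hmul3' : Bk * (a / Bk * h xh + (1 - a / Bk) * h y) = a * h xh + (Bk - a) * h y := by
      field_simp
    have hmul2' : Bk * (L / 2 * ‖x - w‖ ^ 2 + δ)
        = L * (a ^ 2 / Bk) / 2 * ‖xh - z‖ ^ 2 + Bk * δ := by
      rw [hnw]; field_simp
    rw [hmul3'] at hmul3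
    rw [hmul2'] at hmul2
    rw [hζ] at hyoung
    have hacc : accumError S D h α β B x0 answer gd δ ρ κ (k + 1)
        = accumError S D h α β B x0 answer gd δ ρ κ k
          + (Bk * δ + a ^ 2 * ‖ζ (k + 1)‖ ^ 2 / (2 * (κ (k + 1) * ρ)) - a * (G (z - x) - gd x (z - x))) := by
      rw [accumError, Finset.sum_range_succ]; rfl
    rw [hacc, Finset.sum_range_succ, hlin]
    rw [hAk] at ih hgrow
    simp only [map_sub] at hgrow haux hmul1 hmul2 hgw hyoung ⊢
    linarith

/-- The residual of the objective after `k` iterations. -/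
theorem partialSum_mul_residual_le (hρ : 0 < ρ) (hδ : 0 ≤ δ) (hSQ : S ⊆ Q)
    (hf : ConvexOn ℝ Q f) (hor : IsInexactOracle Q f L δ fd gd) (k : ℕ) {v : E} (hv : v ∈ S) :
    partialSum α k * ((f (st k).y + h (st k).y) - (f v + h v)) ≤
      β k * D v + δ * ∑ i ∈ Finset.range (k + 1), B i
        + ∑ i ∈ Finset.range (k + 1), α i ^ 2 * ‖ζ i‖ ^ 2 / (2 * (κ i * ρ))
        + ∑ i ∈ Finset.range (k + 1), α i * ζ i (v - zp i) := by
  have h1 := partialSum_mul_le answer hP hs hρ hδ hSQ hf hor k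
  have h2 := (sigm_z_spec answer hP hs k).2 hv
  simp only [Set.mem_ofPred_eq] at h2
  have h3 : (st k).lin v + ∑ i ∈ Finset.range (k + 1), α i * fd (st i).x ≤ partialSum α k * f v
      + ∑ i ∈ Finset.range (k + 1), α i * ζ i (v - (st i).x) := by
    rw [sigm_lin_eq_sum, partialSum, Finset.sum_mul, ← Finset.sum_add_distrib,
      ← Finset.sum_add_distrib]
    refine Finset.sum_le_sum fun i _ => ?_
    have := (hor _ (hSQ (sigm_x_mem answer hP hs i)) _ (hSQ hv)).1
    have hα := (hs.alpha_pos i).le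
    have hζ : ζ i (v - (st i).x) = answer i (st i).x (v - (st i).x) - gd (st i).x (v - (st i).x) := rfl
    rw [hζ]
    nlinarith
  -- The noise paired with z_{i-1} - x_i in the recursion and with v - x_i in the upper bound
  -- combine to v - z_{i-1}; x_i cancels.
  have h4 : accumError S D h α β B x0 answer gd δ ρ κ k
      + ∑ i ∈ Finset.range (k + 1), α i * ζ i (v - (st i).x)
      = δ * ∑ i ∈ Finset.range (k + 1), B i
        + ∑ i ∈ Finset.range (k + 1), α i ^ 2 * ‖ζ i‖ ^ 2 / (2 * (κ i * ρ))
        + ∑ i ∈ Finset.range (k + 1), α i * ζ i (v - zp i) := by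
    rw [accumError, Finset.mul_sum, ← Finset.sum_add_distrib, ← Finset.sum_add_distrib,
      ← Finset.sum_add_distrib]
    refine Finset.sum_congr rfl fun i _ => ?_
    simp only [map_sub]
    ring
  linarith

end Deterministic

/-! ### Estimates for the coefficients and the origin of the constants -/

section Coefficients

variable {p : ℝ}

theorem coefA_pos (p : ℝ) : 0 < coefA p := by unfold coefA; positivity

theorem one_le_coefA (hp : 1 ≤ p) : 1 ≤ coefA p :=
  Real.one_le_rpow (by norm_num) (by linarith)

theorem coefB_pos (hp : 1 ≤ p) : 0 < coefB p := by
  unfold coefB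
  have : 0 < p := by linarith
  positivity

/-- The ratio `(i + p) / p`. -/
def ratio (p : ℝ) (i : ℕ) : ℝ := (i + p) / p

theorem one_le_ratio (hp : 1 ≤ p) (i : ℕ) : 1 ≤ ratio p i := by
  unfold ratio
  rw [le_div_iff₀ (by linarith)]
  have : (0 : ℝ) ≤ i := i.cast_nonneg
  linarith

theorem ratio_mono (hp : 1 ≤ p) {i j : ℕ} (h : i ≤ j) : ratio p i ≤ ratio p j := by
  unfold ratio
  have : (i : ℝ) ≤ j := by exact_mod_cast h
  have : 0 < p := by linarith
  gcongr

theorem seqAlpha_eq (p : ℝ) (i : ℕ) : seqAlpha p i = 1 / coefA p * ratio p i ^ (p - 1) := rfl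

theorem seqAlpha_pos (hp : 1 ≤ p) (i : ℕ) : 0 < seqAlpha p i := by
  have := one_le_ratio hp i
  have := coefA_pos p
  rw [seqAlpha_eq]
  positivity

theorem seqAlpha_mono (hp : 1 ≤ p) {i j : ℕ} (h : i ≤ j) : seqAlpha p i ≤ seqAlpha p j := by
  have h1 := one_le_ratio hp i
  have := coefA_pos p
  rw [seqAlpha_eq, seqAlpha_eq]
  exact mul_le_mul_of_nonneg_left (Real.rpow_le_rpow (by linarith) (ratio_mono hp h) (by linarith))
    (by positivity)

theorem seqAlpha_le_seqB (hp : 1 ≤ p) (i : ℕ) : seqAlpha p i ≤ seqB p i := by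
  have h1 : 1 ≤ coefA p * seqAlpha p i := by
    rw [seqAlpha_eq, ← mul_assoc, mul_one_div_cancel (coefA_pos p).ne', one_mul]
    exact Real.one_le_rpow (one_le_ratio hp i) (by linarith)
  have := seqAlpha_pos hp i
  unfold seqB
  nlinarith

theorem sq_div_seqB (hp : 1 ≤ p) (i : ℕ) : seqAlpha p i ^ 2 / seqB p i = 1 / coefA p := by
  have := seqAlpha_pos hp i
  have := coefA_pos p
  unfold seqB
  field_simp

/-- Discrete form of integrating p x^{p-1}. Consecutive ratios differ by 1/p, and Bernoulli's
inequality gives (r - 1/p)^p ≥ r^p - r^{p-1}. -/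
theorem ratio_rpow_div_le_partialSum (hp : 1 ≤ p) (k : ℕ) :
    1 / coefA p * ratio p k ^ p ≤ partialSum (seqAlpha p) k := by
  have ha := coefA_pos p
  have hp0 : 0 < p := by linarith
  induction k with
  | zero =>
    have : ratio p 0 = 1 := by simp [ratio, hp0.ne']
    rw [partialSum_zero, seqAlpha_eq, this, Real.one_rpow, Real.one_rpow]
  | succ k ih =>
    set r := ratio p (k + 1) with hr
    have hr1 : 1 ≤ r := one_le_ratio hp _
    have hrk : ratio p k = r * (1 + -(1 / (p * r))) := by
      have h1 : ratio p k = r - 1 / p := by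
        rw [hr]; simp only [ratio]; push_cast; ring
      rw [h1]
      field_simp
      ring
    have hs : -1 ≤ -(1 / (p * r)) := by
      rw [neg_le_neg_iff, div_le_one (by positivity)]
      nlinarith
    have hb := one_add_mul_self_le_rpow_one_add hs hp
    have h2 : ratio p k ^ p = r ^ p * (1 + -(1 / (p * r))) ^ p := by
      rw [hrk, Real.mul_rpow (by linarith) (by linarith)]
    have h3 : r ^ p = r ^ (p - 1) * r := by
      rw [Real.rpow_sub_one (by linarith)]
      field_simp
    have h4 : r ^ p * (1 + p * -(1 / (p * r))) = r ^ p - r ^ (p - 1) := by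
      rw [h3]; field_simp; ring
    have h5 : r ^ p - r ^ (p - 1) ≤ ratio p k ^ p := by
      rw [h2, ← h4]
      exact mul_le_mul_of_nonneg_left hb (by positivity)
    rw [partialSum_succ, seqAlpha_eq]
    have h6 := mul_le_mul_of_nonneg_left h5 (one_div_pos.2 ha).le
    linarith

theorem seqB_eq (p : ℝ) (i : ℕ) : seqB p i = 1 / coefA p * (ratio p i ^ (p - 1)) ^ 2 := by
  have := coefA_pos p
  rw [seqB, seqAlpha_eq]
  field_simp

theorem ratio_mul_seqAlpha_le (hp : 1 ≤ p) (i : ℕ) :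
    ratio p i * seqAlpha p i ≤ partialSum (seqAlpha p) i := by
  refine le_trans (le_of_eq ?_) (ratio_rpow_div_le_partialSum hp i)
  have h1 := one_le_ratio hp i
  rw [seqAlpha_eq, Real.rpow_sub_one (by linarith)]
  field_simp

/-- After the previous bound this compares the exponents 2(p - 1) and p, which is the reason for p ≤
2. -/
theorem seqB_le_partialSum (hp : 1 ≤ p) (hp2 : p ≤ 2) (i : ℕ) :
    seqB p i ≤ partialSum (seqAlpha p) i := by
  refine le_trans ?_ (ratio_rpow_div_le_partialSum hp i)
  have h1 := one_le_ratio hp i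
  have := coefA_pos p
  rw [seqB_eq p, ← Real.rpow_natCast, ← Real.rpow_mul (by linarith)]
  refine mul_le_mul_of_nonneg_left (Real.rpow_le_rpow_of_exponent_le h1 ?_) (by positivity)
  push_cast
  linarith

/-- The part of `β_i` that is available to absorb the noise. -/
def seqKappa (p σ R : ℝ) (i : ℕ) : ℝ := coefB p * σ / R * (i + p) ^ ((2 * p - 1) / 2)

theorem seqKappa_pos {σ V : ℝ} (hp : 1 ≤ p) (hσ : 0 < σ) (hV : 0 < V) (i : ℕ) :
    0 < seqKappa p σ V i := by
  have := coefB_pos hp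
  have : (0 : ℝ) ≤ i := i.cast_nonneg
  unfold seqKappa
  positivity

/-- The part LR² of β, times ρ = 1/R², pays for L α²/B = L/a ≤ L. The noise part of β_i is shifted
by one index, so that it equals κ_{i+1} exactly. -/
theorem isStepSequence {L σ V R : ℝ} (hp : 1 ≤ p) (hp2 : p ≤ 2) (hL : 0 < L) (hσ : 0 < σ)
    (hV : 0 < V) (hR : 0 < R) :
    IsStepSequence (seqAlpha p) (seqBeta p (L * R ^ 2) σ V) (seqB p) (seqKappa p σ V) L
      (R ^ 2)⁻¹ := by
  have hb := coefB_pos hp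
  have ha := coefA_pos p
  have ha1 : 1 / coefA p ≤ 1 := (div_le_one ha).2 (one_le_coefA hp)
  have hc : 0 < coefB p * σ / V := by positivity
  have hLR : L * R ^ 2 * (R ^ 2)⁻¹ = L := by field_simp
  refine ⟨seqAlpha_pos hp, fun i => ?_, fun i => ?_, seqKappa_pos hp hσ hV, seqAlpha_le_seqB hp,
    seqB_le_partialSum hp hp2, ?_, fun i => ?_⟩
  · have : (0 : ℝ) ≤ i := i.cast_nonneg
    unfold seqBeta
    positivity
  · have : (0 : ℝ) ≤ i := i.cast_nonneg
    unfold seqBeta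
    push_cast
    gcongr
    all_goals linarith
  · have h0 : seqAlpha p 0 = 1 / coefA p := by
      simp [seqAlpha, show p ≠ 0 by linarith]
    have h1 : seqKappa p σ V 0 ≤ coefB p * σ / V * ((0 : ℕ) + p + 1) ^ ((2 * p - 1) / 2) := by
      unfold seqKappa
      refine mul_le_mul_of_nonneg_left (Real.rpow_le_rpow ?_ ?_ ?_) hc.le <;> push_cast <;> linarith
    have h2 := mul_le_mul_of_nonneg_right h1 (inv_pos.2 (pow_pos hR 2)).le
    rw [h0, seqBeta, add_mul, hLR]
    nlinarith
  · rw [sq_div_seqB hp, seqBeta, add_mul, hLR, seqKappa]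
    have : ((i + 1 : ℕ) : ℝ) + p = i + p + 1 := by push_cast; ring
    rw [this]
    nlinarith

variable {n : ℕ}

theorem add_one_le_two_mul_ratio (hp : 1 ≤ p) (hp2 : p ≤ 2) (n : ℕ) :
    (n : ℝ) + 1 ≤ 2 * ratio p n := by
  have hp0 : 0 < p := by linarith
  have : (0 : ℝ) ≤ n := n.cast_nonneg
  have h : 2 * ratio p n = 2 * (n + p) / p := by unfold ratio; ring
  rw [h, le_div_iff₀ hp0]
  nlinarith

/-- Origin of `C₁`: for p ≤ 2 one has a ≤ 2√2 and p^p ≤ 4, with product 8√2. -/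
theorem rpow_le_two_mul_partialSum (hp : 1 ≤ p) (hp2 : p ≤ 2) (n : ℕ) :
    (n : ℝ) ^ p ≤ 2 * C₁ * partialSum (seqAlpha p) n := by
  have hp0 : 0 < p := by linarith
  have hn : (0 : ℝ) ≤ n := n.cast_nonneg
  have ha := coefA_pos p
  have h1 : coefA p ≤ 2 * √2 := by
    have h : coefA p ≤ (2 : ℝ) ^ ((1 : ℝ) + 1 / 2) :=
      Real.rpow_le_rpow_of_exponent_le (by norm_num) (by linarith)
    rwa [Real.rpow_add (by norm_num), Real.rpow_one, ← Real.sqrt_eq_rpow] at h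
  have h2 : p ^ p ≤ 4 := by
    calc p ^ p ≤ (2 : ℝ) ^ p := Real.rpow_le_rpow hp0.le hp2 hp0.le
      _ ≤ (2 : ℝ) ^ (2 : ℝ) := Real.rpow_le_rpow_of_exponent_le (by norm_num) hp2
      _ = 4 := by norm_num
  have h3 : coefA p * p ^ p ≤ 2 * C₁ := by
    have := mul_le_mul h1 h2 (by positivity) (by positivity)
    unfold C₁
    linarith
  have h4 : (n : ℝ) ^ p ≤ coefA p * p ^ p * (1 / coefA p * ratio p n ^ p) := by
    rw [ratio, Real.div_rpow (by linarith) hp0.le]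
    have : coefA p * p ^ p * (1 / coefA p * ((n + p) ^ p / p ^ p)) = ((n : ℝ) + p) ^ p := by
      field_simp
    rw [this]
    exact Real.rpow_le_rpow hn (by linarith) hp0.le
  refine h4.trans (mul_le_mul h3 (ratio_rpow_div_le_partialSum hp n) ?_ ?_)
  · have := one_le_ratio hp n
    positivity
  · unfold C₁; positivity

theorem coefA_mul_coefB (hp : 1 ≤ p) :
    coefA p * coefB p * p ^ p = 2 ^ ((2 * p + 3) / 4) * p ^ ((1 : ℝ) / 2) := by
  have hp0 : 0 < p := by linarith
  unfold coefA coefB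
  rw [← mul_assoc, ← Real.rpow_add (by norm_num), mul_assoc, ← Real.rpow_add hp0]
  congr 2 <;> ring

theorem coefA_mul_coefB_le (hp : 1 ≤ p) (hp2 : p ≤ 2) : coefA p * coefB p * p ^ p ≤ 5 := by
  have hp0 : 0 < p := by linarith
  rw [coefA_mul_coefB hp]
  have h : (2 : ℝ) ^ ((2 * p + 3) / 4) * p ^ ((1 : ℝ) / 2) ≤ 2 ^ ((7 : ℝ) / 4) * 2 ^ ((1 : ℝ) / 2) :=
    mul_le_mul (Real.rpow_le_rpow_of_exponent_le (by norm_num) (by linarith))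
      (Real.rpow_le_rpow hp0.le hp2 (by norm_num)) (by positivity) (by positivity)
  refine h.trans ?_
  rw [← Real.rpow_add (by norm_num)]
  -- The bound is 2^{9/4}; fourth powers reduce it to 2^9 ≤ 5^4.
  refine le_of_pow_le_pow_left₀ (n := 4) (by norm_num) (by norm_num) ?_
  rw [← Real.rpow_natCast, ← Real.rpow_mul (by norm_num)]
  norm_num

theorem coefB_mul_rpow_mul_sqrt_le (hp : 1 ≤ p) (hp2 : p ≤ 2) (n : ℕ) (hn : 1 ≤ n) :
    coefB p * ((n : ℝ) + p + 1) ^ ((2 * p - 1) / 2) * √n ≤ 10 * partialSum (seqAlpha p) n := by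
  have hp0 : 0 < p := by linarith
  have hn1 : (1 : ℝ) ≤ n := by exact_mod_cast hn
  have ha := coefA_pos p
  have hb := coefB_pos hp
  have ht : 0 < (n : ℝ) + p := by linarith
  -- Since n + p ≥ 2, the shift costs a factor 3/2 in the base, and (3/2)^{3/2} ≤ 2.
  have h1 : ((n : ℝ) + p + 1) ^ ((2 * p - 1) / 2) ≤ 2 * ((n : ℝ) + p) ^ ((2 * p - 1) / 2) := by
    calc ((n : ℝ) + p + 1) ^ ((2 * p - 1) / 2) ≤ (3 / 2 * ((n : ℝ) + p)) ^ ((2 * p - 1) / 2) :=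
          Real.rpow_le_rpow (by linarith) (by linarith) (by linarith)
      _ = (3 / 2) ^ ((2 * p - 1) / 2) * ((n : ℝ) + p) ^ ((2 * p - 1) / 2) :=
          Real.mul_rpow (by norm_num) ht.le
      _ ≤ 2 * ((n : ℝ) + p) ^ ((2 * p - 1) / 2) := by
          refine mul_le_mul_of_nonneg_right ?_ (by positivity)
          calc ((3 : ℝ) / 2) ^ ((2 * p - 1) / 2) ≤ (3 / 2) ^ ((3 : ℝ) / 2) :=
                Real.rpow_le_rpow_of_exponent_le (by norm_num) (by linarith)
            _ ≤ 2 := by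
              refine le_of_pow_le_pow_left₀ (n := 2) (by norm_num) (by norm_num) ?_
              rw [← Real.rpow_natCast, ← Real.rpow_mul (by norm_num)]
              norm_num
  have h2 : √(n : ℝ) ≤ ((n : ℝ) + p) ^ ((1 : ℝ) / 2) := by
    rw [Real.sqrt_eq_rpow]
    exact Real.rpow_le_rpow (by linarith) (by linarith) (by norm_num)
  have h3 : ((n : ℝ) + p) ^ ((2 * p - 1) / 2) * ((n : ℝ) + p) ^ ((1 : ℝ) / 2) = ((n : ℝ) + p) ^ p := by
    rw [← Real.rpow_add ht]
    congr 1
    ring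
  have h4 : coefB p * ((n : ℝ) + p + 1) ^ ((2 * p - 1) / 2) * √n ≤ 2 * coefB p * ((n : ℝ) + p) ^ p := by
    calc coefB p * ((n : ℝ) + p + 1) ^ ((2 * p - 1) / 2) * √n
        ≤ coefB p * (2 * ((n : ℝ) + p) ^ ((2 * p - 1) / 2)) * ((n : ℝ) + p) ^ ((1 : ℝ) / 2) := by
          gcongr
      _ = 2 * coefB p * ((n : ℝ) + p) ^ p := by rw [← h3]; ring
  have h5 := ratio_rpow_div_le_partialSum hp n
  rw [ratio, Real.div_rpow ht.le hp0.le] at h5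
  have h6 : 2 * coefB p * ((n : ℝ) + p) ^ p
      = 2 * (coefA p * coefB p * p ^ p) * (1 / coefA p * (((n : ℝ) + p) ^ p / p ^ p)) := by
    field_simp
  rw [h6] at h4
  have h7 : 0 ≤ 1 / coefA p * (((n : ℝ) + p) ^ p / p ^ p) := by positivity
  have h8 := coefA_mul_coefB_le hp hp2
  nlinarith

theorem sum_inv_sqrt_le (n : ℕ) : ∑ i ∈ Finset.range (n + 1), 1 / √((i : ℝ) + 1) ≤ 2 * √((n : ℝ) + 1) := by
  induction n with
  | zero => simp
  | succ n ih =>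
    rw [Finset.sum_range_succ]
    push_cast
    have hn : (0 : ℝ) ≤ n := n.cast_nonneg
    set u := √((n : ℝ) + 1)
    set v := √((n : ℝ) + 1 + 1)
    have hv : 0 < v := Real.sqrt_pos.2 (by linarith)
    have hu2 : u ^ 2 = n + 1 := Real.sq_sqrt (by linarith)
    have hv2 : v ^ 2 = n + 1 + 1 := Real.sq_sqrt (by linarith)
    have : 1 / v ≤ 2 * v - 2 * u := by
      rw [div_le_iff₀ hv]
      nlinarith [sq_nonneg (v - u)]
    linarith

/-- Each summand is a constant times (i + p)^{p-1}/√(i + p). The first factor is at most its last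
value, and the inverse roots sum to O(√n); multiplying by √n leaves order n^p, the order of A_n. -/
theorem sum_sq_div_mul_sqrt_le (hp : 1 ≤ p) (hp2 : p ≤ 2) (n : ℕ) (hn : 1 ≤ n) :
    (∑ i ∈ Finset.range (n + 1),
      seqAlpha p i ^ 2 / (2 * (coefB p * ((i : ℝ) + p) ^ ((2 * p - 1) / 2)))) * √n
      ≤ 2 * partialSum (seqAlpha p) n := by
  have hp0 : 0 < p := by linarith
  have hn1 : (1 : ℝ) ≤ n := by exact_mod_cast hn
  have ha := coefA_pos p
  have hb := coefB_pos hp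
  set t : ℝ := n + p with htdef
  have ht : 0 < t := by linarith
  set K := 1 / (2 * coefA p ^ 2 * coefB p * (p ^ (p - 1)) ^ 2) with hK
  have hK0 : 0 < K := by positivity
  have hterm : ∀ i ∈ Finset.range (n + 1),
      seqAlpha p i ^ 2 / (2 * (coefB p * ((i : ℝ) + p) ^ ((2 * p - 1) / 2)))
        ≤ K * t ^ (p - 1) * (1 / √((i : ℝ) + 1)) := by
    intro i hi
    have hi0 : (0 : ℝ) ≤ i := i.cast_nonneg
    have hin : (i : ℝ) ≤ n := by exact_mod_cast Nat.lt_succ_iff.1 (Finset.mem_range.1 hi)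
    have hti : 0 < (i : ℝ) + p := by linarith
    have e1 : ((i : ℝ) + p) ^ ((2 * p - 1) / 2) = ((i : ℝ) + p) ^ (p - 1) * √((i : ℝ) + p) := by
      rw [Real.sqrt_eq_rpow, ← Real.rpow_add hti]
      congr 1
      ring
    have e2 : seqAlpha p i ^ 2 / (2 * (coefB p * ((i : ℝ) + p) ^ ((2 * p - 1) / 2)))
        = K * ((i : ℝ) + p) ^ (p - 1) * (1 / √((i : ℝ) + p)) := by
      rw [e1, seqAlpha, Real.div_rpow hti.le hp0.le, hK]
      have : 0 < √((i : ℝ) + p) := Real.sqrt_pos.2 hti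
      have : 0 < p ^ (p - 1) := by positivity
      have : 0 < ((i : ℝ) + p) ^ (p - 1) := by positivity
      field_simp
    rw [e2]
    have h1 : ((i : ℝ) + p) ^ (p - 1) ≤ t ^ (p - 1) :=
      Real.rpow_le_rpow hti.le (by linarith) (by linarith)
    have h2 : 1 / √((i : ℝ) + p) ≤ 1 / √((i : ℝ) + 1) :=
      one_div_le_one_div_of_le (Real.sqrt_pos.2 (by linarith)) (Real.sqrt_le_sqrt (by linarith))
    exact mul_le_mul (mul_le_mul_of_nonneg_left h1 hK0.le) h2 (by positivity) (by positivity)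
  have hsum := Finset.sum_le_sum hterm
  rw [← Finset.mul_sum] at hsum
  have hs2 := hsum.trans (mul_le_mul_of_nonneg_left (sum_inv_sqrt_le n) (by positivity))
  have h3 : √((n : ℝ) + 1) * √n ≤ t := by
    calc √((n : ℝ) + 1) * √n ≤ √t * √t := by
          gcongr <;> linarith
      _ = t := Real.mul_self_sqrt ht.le
  have h4 : t ^ (p - 1) * t = t ^ p := by
    rw [Real.rpow_sub_one ht.ne']; field_simp
  have h5 : p ^ (p - 1) * p = p ^ p := by
    rw [Real.rpow_sub_one hp0.ne']; field_simp
  -- Here p² ≤ 4, while a b p^p is at least 2.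
  have h6 : p ^ 2 ≤ 2 * (coefA p * coefB p * p ^ p) := by
    rw [coefA_mul_coefB hp]
    have q1 : (2 : ℝ) ≤ 2 ^ ((2 * p + 3) / 4) := by
      have : (2 : ℝ) ^ (1 : ℝ) ≤ 2 ^ ((2 * p + 3) / 4) :=
        Real.rpow_le_rpow_of_exponent_le (by norm_num) (by linarith)
      rwa [Real.rpow_one] at this
    have q2 : 1 ≤ p ^ ((1 : ℝ) / 2) := Real.one_le_rpow hp (by norm_num)
    nlinarith
  have h7 : K * t ^ p * 2 ≤ 2 * (1 / coefA p * ratio p n ^ p) := by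
    rw [ratio, Real.div_rpow ht.le hp0.le, hK]
    have e : 2 * (1 / coefA p * (t ^ p / p ^ p)) = t ^ p * (2 / (coefA p * p ^ p)) := by ring
    rw [e, mul_comm _ (t ^ p), mul_assoc]
    refine mul_le_mul_of_nonneg_left ?_ (by positivity)
    have e2 : 1 / (2 * coefA p ^ 2 * coefB p * (p ^ (p - 1)) ^ 2) * 2
        = p ^ 2 / (coefA p * (coefA p * coefB p * p ^ p) * p ^ p) := by
      rw [← h5]
      field_simp
    rw [e2, div_le_div_iff₀ (by positivity) (by positivity)]
    have hh : 0 < coefA p * p ^ p := by positivity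
    nlinarith [mul_le_mul_of_nonneg_right h6 hh.le]
  calc _ ≤ K * t ^ (p - 1) * (2 * √((n : ℝ) + 1)) * √n :=
        mul_le_mul_of_nonneg_right hs2 (Real.sqrt_nonneg _)
    _ = K * t ^ (p - 1) * 2 * (√((n : ℝ) + 1) * √n) := by ring
    _ ≤ K * t ^ (p - 1) * 2 * t := mul_le_mul_of_nonneg_left h3 (by positivity)
    _ = K * t ^ p * 2 := by rw [← h4]; ring
    _ ≤ _ := h7
    _ ≤ _ := mul_le_mul_of_nonneg_left (ratio_rpow_div_le_partialSum hp n) (by norm_num)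

/-- The terms increase, so n + 1 copies of the last one suffice. The argument yields the constant 4;
`C₃` leaves room. -/
theorem sum_seqB_le (hp : 1 ≤ p) (hp2 : p ≤ 2) (n : ℕ) (hn : 1 ≤ n) :
    ∑ i ∈ Finset.range (n + 1), seqB p i ≤ C₃ * (n : ℝ) ^ (p - 1) * partialSum (seqAlpha p) n := by
  have hp0 : 0 < p := by linarith
  have hn1 : (1 : ℝ) ≤ n := by exact_mod_cast hn
  have ha := coefA_pos p
  have hr1 := one_le_ratio hp n
  have hα := seqAlpha_pos hp n
  have h0 : ∑ i ∈ Finset.range (n + 1), seqB p i ≤ (n + 1) * seqB p n := by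
    have : ∀ i ∈ Finset.range (n + 1), seqB p i ≤ seqB p n := fun i hi => by
      have := seqAlpha_mono hp (Nat.lt_succ_iff.1 (Finset.mem_range.1 hi))
      have := (seqAlpha_pos hp i).le
      unfold seqB
      gcongr
    simpa using Finset.sum_le_card_nsmul _ _ _ this
  have h1 : ratio p n ^ (p - 1) ≤ 2 * (n : ℝ) ^ (p - 1) := by
    calc ratio p n ^ (p - 1) ≤ (2 * (n : ℝ)) ^ (p - 1) := by
          refine Real.rpow_le_rpow (by linarith) ?_ (by linarith)
          unfold ratio
          rw [div_le_iff₀ hp0]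
          nlinarith
      _ = 2 ^ (p - 1) * (n : ℝ) ^ (p - 1) := Real.mul_rpow (by norm_num) (by linarith)
      _ ≤ 2 * (n : ℝ) ^ (p - 1) := by
          refine mul_le_mul_of_nonneg_right ?_ (by positivity)
          calc (2 : ℝ) ^ (p - 1) ≤ 2 ^ (1 : ℝ) :=
                Real.rpow_le_rpow_of_exponent_le (by norm_num) (by linarith)
            _ = 2 := Real.rpow_one 2
  have h2 : seqB p n = ratio p n ^ (p - 1) * seqAlpha p n := by
    rw [seqB_eq p, seqAlpha_eq]; ring
  have h3 := add_one_le_two_mul_ratio hp hp2 n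
  have h4 := ratio_mul_seqAlpha_le hp n
  have hnp : 0 < (n : ℝ) ^ (p - 1) := by positivity
  calc _ ≤ ((n : ℝ) + 1) * seqB p n := h0
    _ = ratio p n ^ (p - 1) * (((n : ℝ) + 1) * seqAlpha p n) := by rw [h2]; ring
    _ ≤ 2 * (n : ℝ) ^ (p - 1) * (2 * ratio p n * seqAlpha p n) := by gcongr
    _ = 4 * (n : ℝ) ^ (p - 1) * (ratio p n * seqAlpha p n) := by ring
    _ ≤ 4 * (n : ℝ) ^ (p - 1) * partialSum (seqAlpha p) n := by gcongr
    _ ≤ _ := by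
      have : 0 < partialSum (seqAlpha p) n := lt_of_lt_of_le (by positivity) h4
      unfold C₃
      gcongr
      norm_num

/-- No single weight dominates: the largest is at most 2A_n/(n + 1). This gives the martingale its
factor 1/√n. -/
theorem mul_sum_sq_le (hp : 1 ≤ p) (hp2 : p ≤ 2) (n : ℕ) :
    n * ∑ i ∈ Finset.range (n + 1), seqAlpha p i ^ 2 ≤ 4 * partialSum (seqAlpha p) n ^ 2 := by
  have hα := seqAlpha_pos hp n
  have hn0 : (0 : ℝ) ≤ n := n.cast_nonneg
  have h0 : ∑ i ∈ Finset.range (n + 1), seqAlpha p i ^ 2 ≤ (n + 1) * seqAlpha p n ^ 2 := by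
    have : ∀ i ∈ Finset.range (n + 1), seqAlpha p i ^ 2 ≤ seqAlpha p n ^ 2 := fun i hi => by
      have := seqAlpha_mono hp (Nat.lt_succ_iff.1 (Finset.mem_range.1 hi))
      have := (seqAlpha_pos hp i).le
      gcongr
    simpa using Finset.sum_le_card_nsmul _ _ _ this
  have h3 := add_one_le_two_mul_ratio hp hp2 n
  have h4 := ratio_mul_seqAlpha_le hp n
  have h5 : ((n : ℝ) + 1) * seqAlpha p n ≤ 2 * partialSum (seqAlpha p) n := by nlinarith
  calc _ ≤ (n : ℝ) * ((n + 1) * seqAlpha p n ^ 2) := by gcongr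
    _ ≤ (((n : ℝ) + 1) * seqAlpha p n) ^ 2 := by
      have := sq_nonneg (seqAlpha p n)
      nlinarith
    _ ≤ (2 * partialSum (seqAlpha p) n) ^ 2 := by gcongr
    _ = _ := by ring

end Coefficients

/-! ### Resampling one entry in place of conditional expectation -/

section Resampling

variable {𝒳 : Type*} [MeasurableSpace 𝒳] (ρ : Measure 𝒳) [IsProbabilityMeasure ρ]

/-- The law of an i.i.d. sequence with marginal law `ρ`. -/
abbrev seqLaw : Measure (ℕ → 𝒳) := Measure.infinitePi fun _ : ℕ => ρ

/-- Replacing one entry of an i.i.d. sequence by an independent copy does not change its law. -/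
theorem map_update_seqLaw (n : ℕ) :
    ((seqLaw ρ).prod ρ).map (fun q : (ℕ → 𝒳) × 𝒳 => Function.update q.1 n q.2) = seqLaw ρ := by
  refine Measure.eq_infinitePi _ fun s t ht => ?_
  have hm : Measurable fun q : (ℕ → 𝒳) × 𝒳 => Function.update q.1 n q.2 := measurable_update'
  rw [Measure.map_apply hm (MeasurableSet.pi s.countable_toSet fun i _ => ht i)]
  by_cases hn : n ∈ s
  · have : (fun q : (ℕ → 𝒳) × 𝒳 => Function.update q.1 n q.2) ⁻¹' (Set.pi s t)
        = (Set.pi (s.erase n : Finset ℕ) t) ×ˢ (t n) := by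
      ext q
      simp only [Set.mem_preimage, Set.mem_pi, Finset.mem_coe, Set.mem_prod, Finset.mem_erase]
      constructor
      · intro h
        refine ⟨fun i hi => ?_, ?_⟩
        · simpa [Function.update_of_ne hi.1] using h i hi.2
        · simpa using h n hn
      · rintro ⟨h1, h2⟩ i hi
        by_cases hin : i = n
        · subst hin; simpa using h2
        · simpa [Function.update_of_ne hin] using h1 i ⟨hin, hi⟩
    rw [this, Measure.prod_prod, Measure.infinitePi_pi _ (fun i _ => ht i),
      Finset.prod_erase_mul s (fun i => ρ (t i)) hn]
  · have : (fun q : (ℕ → 𝒳) × 𝒳 => Function.update q.1 n q.2) ⁻¹' (Set.pi s t)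
        = (Set.pi s t) ×ˢ Set.univ := by
      ext q
      simp only [Set.mem_preimage, Set.mem_pi, Finset.mem_coe, Set.mem_prod, Set.mem_univ, and_true]
      refine forall₂_congr fun i hi => ?_
      have hin : i ≠ n := fun h => hn (by rwa [← h])
      rw [Function.update_of_ne hin]
    rw [this, Measure.prod_prod, Measure.infinitePi_pi _ (fun i _ => ht i), measure_univ, mul_one]

/-- Substitute for conditioning on all entries but one: those are frozen and entry n is integrated
alone. No filtration is needed. -/
theorem lintegral_seqLaw_eq (n : ℕ) {F : (ℕ → 𝒳) → ℝ≥0∞} (hF : Measurable F) :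
    ∫⁻ s, F s ∂(seqLaw ρ) = ∫⁻ s, ∫⁻ x, F (Function.update s n x) ∂ρ ∂(seqLaw ρ) := by
  have hm : Measurable fun q : (ℕ → 𝒳) × 𝒳 => Function.update q.1 n q.2 := measurable_update'
  conv_lhs => rw [← map_update_seqLaw ρ n]
  rw [lintegral_map hF hm, lintegral_prod (fun q : (ℕ → 𝒳) × 𝒳 => F (Function.update q.1 n q.2)) (hF.comp hm).aemeasurable]

theorem lintegral_seqLaw_le (n : ℕ) {F K : (ℕ → 𝒳) → ℝ≥0∞} (hF : Measurable F)
    (h : ∀ s, ∫⁻ x, F (Function.update s n x) ∂ρ ≤ K s) :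
    ∫⁻ s, F s ∂(seqLaw ρ) ≤ ∫⁻ s, K s ∂(seqLaw ρ) := by
  rw [lintegral_seqLaw_eq ρ n hF]
  exact lintegral_mono h

theorem seqLaw_le_of_update_le (n : ℕ) {A : Set (ℕ → 𝒳)} (hA : MeasurableSet A) {c : ℝ≥0∞}
    (h : ∀ s, ρ {x | Function.update s n x ∈ A} ≤ c) : seqLaw ρ A ≤ c := by
  rw [← lintegral_indicator_one hA]
  calc _ ≤ ∫⁻ _, c ∂(seqLaw ρ) := by
        refine lintegral_seqLaw_le ρ n (measurable_one.indicator hA) fun s => ?_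
        refine le_trans (le_of_eq ?_) (h s)
        have hm : Measurable fun x => Function.update s n x := measurable_update s
        exact lintegral_indicator_one (hm hA)
    _ = c := by simp

end Resampling

/-! ### Exponential moments of light-tailed vectors -/

section LightTails

variable {Ξ : Type*} [MeasurableSpace Ξ] {ν : Measure Ξ} [IsProbabilityMeasure ν]

omit [IsProbabilityMeasure ν] in
-- The mean-zero part g drops out of the expectation. Integrability of w follows from its bound, and
-- F need not be measurable.
theorem lintegral_ofReal_le_of_le_add {F g w : Ξ → ℝ} {c T : ℝ} (hg : Integrable g ν)
    (hg0 : ∫ x, g x ∂ν = 0) (hw : Measurable w) (hw0 : ∀ x, 0 ≤ w x) (hT : 0 ≤ T)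
    (hwT : ∫⁻ x, ENNReal.ofReal (w x) ∂ν ≤ ENNReal.ofReal T) (hc : 0 ≤ c)
    (hF0 : ∀ x, 0 ≤ F x) (hF : ∀ x, F x ≤ g x + c * w x) :
    ∫⁻ x, ENNReal.ofReal (F x) ∂ν ≤ ENNReal.ofReal (c * T) := by
  have hwi : Integrable w ν := by
    refine ⟨hw.aestronglyMeasurable, ?_⟩
    rw [hasFiniteIntegral_iff_ofReal (Filter.Eventually.of_forall hw0)]
    exact hwT.trans_lt ENNReal.ofReal_lt_top
  have hwI : ∫ x, w x ∂ν ≤ T := by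
    rw [integral_eq_lintegral_of_nonneg_ae (Filter.Eventually.of_forall hw0)
      hw.aestronglyMeasurable]
    exact ENNReal.toReal_le_of_le_ofReal hT hwT
  have hint : Integrable (fun x => g x + c * w x) ν := hg.add (hwi.const_mul c)
  calc ∫⁻ x, ENNReal.ofReal (F x) ∂ν ≤ ∫⁻ x, ENNReal.ofReal (g x + c * w x) ∂ν :=
        lintegral_mono fun x => ENNReal.ofReal_le_ofReal (hF x)
    _ = ENNReal.ofReal (∫ x, (g x + c * w x) ∂ν) :=
        (ofReal_integral_eq_lintegral_ofReal hint
          (Filter.Eventually.of_forall fun x => (hF0 x).trans (hF x))).symm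
    _ ≤ ENNReal.ofReal (c * T) := by
        refine ENNReal.ofReal_le_ofReal ?_
        rw [integral_add hg (hwi.const_mul c), hg0, integral_const_mul, zero_add]
        exact mul_le_mul_of_nonneg_left hwI hc

/-- Jensen's inequality for the power θ in pointwise form: the chord of exp between 0 and r - 1,
multiplied by e^θ. Centring at 1 makes the constant exact. -/
theorem lintegral_exp_mul_le {r : Ξ → ℝ} (hr : Measurable r)
    (h : ∫⁻ x, ENNReal.ofReal (Real.exp (r x)) ∂ν ≤ ENNReal.ofReal (Real.exp 1)) {θ : ℝ}
    (h0 : 0 ≤ θ) (h1 : θ ≤ 1) :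
    ∫⁻ x, ENNReal.ofReal (Real.exp (θ * r x)) ∂ν ≤ ENNReal.ofReal (Real.exp θ) := by
  have key : ∀ x, Real.exp (θ * r x)
      ≤ Real.exp θ * (1 - θ) + (Real.exp θ * θ * Real.exp (-1)) * Real.exp (r x) := fun x => by
    have hc := convexOn_exp.2 (Set.mem_univ (0 : ℝ)) (Set.mem_univ (r x - 1)) (sub_nonneg.2 h1) h0
      (by ring)
    simp only [smul_eq_mul, mul_zero, zero_add, Real.exp_zero, mul_one] at hc
    have e1 : Real.exp (θ * r x) = Real.exp θ * Real.exp (θ * (r x - 1)) := by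
      rw [← Real.exp_add]; ring_nf
    have e2 : Real.exp (r x - 1) = Real.exp (-1) * Real.exp (r x) := by
      rw [← Real.exp_add]; ring_nf
    rw [e1]
    rw [e2] at hc
    have := mul_le_mul_of_nonneg_left hc (Real.exp_pos θ).le
    linarith
  have hq : Real.exp θ * θ * Real.exp (-1) * Real.exp 1 = Real.exp θ * θ := by
    rw [mul_assoc, ← Real.exp_add]; simp
  calc ∫⁻ x, ENNReal.ofReal (Real.exp (θ * r x)) ∂ν
      ≤ ∫⁻ x, (ENNReal.ofReal (Real.exp θ * (1 - θ))
          + ENNReal.ofReal (Real.exp θ * θ * Real.exp (-1)) * ENNReal.ofReal (Real.exp (r x))) ∂ν := by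
        refine lintegral_mono fun x => ?_
        rw [← ENNReal.ofReal_mul (by positivity), ← ENNReal.ofReal_add
          (mul_nonneg (Real.exp_pos _).le (sub_nonneg.2 h1)) (by positivity)]
        exact ENNReal.ofReal_le_ofReal (key x)
    _ = ENNReal.ofReal (Real.exp θ * (1 - θ))
          + ENNReal.ofReal (Real.exp θ * θ * Real.exp (-1))
            * ∫⁻ x, ENNReal.ofReal (Real.exp (r x)) ∂ν := by
        rw [lintegral_add_left measurable_const, lintegral_const_mul _ (by fun_prop)]
        simp
    _ ≤ ENNReal.ofReal (Real.exp θ * (1 - θ))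
          + ENNReal.ofReal (Real.exp θ * θ * Real.exp (-1)) * ENNReal.ofReal (Real.exp 1) := by
        gcongr
    _ = ENNReal.ofReal (Real.exp θ) := by
        rw [← ENNReal.ofReal_mul (by positivity), hq, ← ENNReal.ofReal_add
          (mul_nonneg (Real.exp_pos _).le (sub_nonneg.2 h1)) (by positivity)]
        ring_nf

/-- The exponential moment without its linear part. -/
theorem lintegral_exp_sub_self_le {r : Ξ → ℝ} (hr : Measurable r) (hr0 : ∀ x, 0 ≤ r x) {σ : ℝ}
    (hσ : 0 < σ)
    (h : ∫⁻ x, ENNReal.ofReal (Real.exp (r x ^ 2 / σ ^ 2)) ∂ν ≤ ENNReal.ofReal (Real.exp 1))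
    {c : ℝ} (hc : 0 ≤ c) :
    ∫⁻ x, ENNReal.ofReal (Real.exp (c * r x) - c * r x) ∂ν
      ≤ ENNReal.ofReal (Real.exp (c ^ 2 * σ ^ 2)) := by
  have hq : Measurable fun x => r x ^ 2 / σ ^ 2 := by fun_prop
  -- For small c, e^x - x ≤ e^{x²} and the moment of order θ = c²σ² apply. For large c, cr ≤ c²σ²/2
  -- + r²/(2σ²) and θ = 1/2 give the exponent c²σ²/2 + 1/2 ≤ c²σ².
  rcases le_total (c ^ 2 * σ ^ 2) 1 with hle | hle
  · refine le_trans (lintegral_mono fun x => ENNReal.ofReal_le_ofReal ?_)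
      (lintegral_exp_mul_le hq h (by positivity) hle)
    have := exp_sub_self_le_exp_sq (mul_nonneg hc (hr0 x))
    refine this.trans (le_of_eq ?_)
    congr 1
    field_simp
  · have h2 := lintegral_exp_mul_le hq h (θ := 1 / 2) (by norm_num) (by norm_num)
    calc _ ≤ ∫⁻ x, ENNReal.ofReal (Real.exp (c ^ 2 * σ ^ 2 / 2))
          * ENNReal.ofReal (Real.exp (1 / 2 * (r x ^ 2 / σ ^ 2))) ∂ν := by
          refine lintegral_mono fun x => ?_
          rw [← ENNReal.ofReal_mul (by positivity), ← Real.exp_add]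
          refine ENNReal.ofReal_le_ofReal ?_
          have h3 : c * r x ≤ c ^ 2 * σ ^ 2 / 2 + 1 / 2 * (r x ^ 2 / σ ^ 2) := by
            have h4 := sq_nonneg (c * σ - r x / σ)
            have h5 : (c * σ) * (r x / σ) = c * r x := by field_simp
            have h6 : (r x / σ) ^ 2 = r x ^ 2 / σ ^ 2 := by rw [div_pow]
            nlinarith
          have h7 := Real.exp_le_exp.2 h3
          have h8 := mul_nonneg hc (hr0 x)
          linarith
      _ = ENNReal.ofReal (Real.exp (c ^ 2 * σ ^ 2 / 2))
          * ∫⁻ x, ENNReal.ofReal (Real.exp (1 / 2 * (r x ^ 2 / σ ^ 2))) ∂ν :=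
          lintegral_const_mul _ (by fun_prop)
      _ ≤ ENNReal.ofReal (Real.exp (c ^ 2 * σ ^ 2 / 2)) * ENNReal.ofReal (Real.exp (1 / 2)) := by
          gcongr
      _ ≤ _ := by
          rw [← ENNReal.ofReal_mul (by positivity), ← Real.exp_add]
          exact ENNReal.ofReal_le_ofReal (Real.exp_le_exp.2 (by linarith))

/-- A random vector with mean zero and light tails. -/
structure IsLightTailed {F : Type*} [NormedAddCommGroup F] [NormedSpace ℝ F] [MeasurableSpace F]
    (ν : Measure Ξ) (σ : ℝ) (Z : Ξ → F) : Prop where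
  measurable : Measurable Z
  integrable : Integrable Z ν
  mean : ∫ x, Z x ∂ν = 0
  tail : ∫⁻ x, ENNReal.ofReal (Real.exp (‖Z x‖ ^ 2 / σ ^ 2)) ∂ν ≤ ENNReal.ofReal (Real.exp 1)

variable {E : Type*} [NormedAddCommGroup E] [InnerProductSpace ℝ E] [FiniteDimensional ℝ E]
  {Z : Ξ → E →L[ℝ] ℝ} {σ : ℝ}

omit [FiniteDimensional ℝ E] in
theorem IsLightTailed.lintegral_exp_apply_le (hZ : IsLightTailed ν σ Z) (hσ : 0 < σ) (v : E) :
    ∫⁻ x, ENNReal.ofReal (Real.exp (Z x v)) ∂ν ≤ ENNReal.ofReal (Real.exp (‖v‖ ^ 2 * σ ^ 2)) := by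
  have hm := hZ.measurable
  have hn : Measurable fun x => ‖Z x‖ := hm.norm
  have h := lintegral_exp_sub_self_le hn (fun x => norm_nonneg _) hσ hZ.tail (norm_nonneg v)
  have hint : Integrable (fun x => Z x v) ν :=
    (ContinuousLinearMap.apply ℝ ℝ v).integrable_comp hZ.integrable
  have hmean : ∫ x, Z x v ∂ν = 0 := by
    have := (ContinuousLinearMap.apply ℝ ℝ v).integral_comp_comm hZ.integrable
    rw [hZ.mean] at this
    simpa using this
  have := lintegral_ofReal_le_of_le_add (F := fun x => Real.exp (Z x v)) (c := 1) hint hmean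
    (by fun_prop) (fun x => ?_) (Real.exp_pos _).le h zero_le_one (fun x => (Real.exp_pos _).le)
    (fun x => ?_)
  · simpa using this
  · have := Real.add_one_le_exp (‖v‖ * ‖Z x‖)
    linarith
  · rw [one_mul]
    refine exp_le_add_exp_sub ?_
    rw [mul_comm]
    exact (Z x).le_opNorm v

/-- Pinelis' step scaled by c: the linear part has mean zero, so adding one variable multiplies the
expected cosh by at most e^{c²σ²}. -/
theorem IsLightTailed.lintegral_cosh_le (hZ : IsLightTailed ν σ Z) (hσ : 0 < σ) {c : ℝ} (hc : 0 ≤ c)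
    (s : E →L[ℝ] ℝ) :
    ∫⁻ x, ENNReal.ofReal (Real.cosh (c * ‖s + Z x‖)) ∂ν
      ≤ ENNReal.ofReal (Real.exp (c ^ 2 * σ ^ 2)) * ENNReal.ofReal (Real.cosh (c * ‖s‖)) := by
  have := FiniteDimensional.complete ℝ E
  have hn : Measurable fun x => ‖Z x‖ := hZ.measurable.norm
  have h := lintegral_exp_sub_self_le hn (fun x => norm_nonneg _) hσ hZ.tail hc
  obtain ⟨T, hT⟩ := exists_cosh_norm_add_le_dual (c • s)
  have hint : Integrable (fun x => c * T (Z x)) ν := (T.integrable_comp hZ.integrable).const_mul c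
  have hmean : ∫ x, c * T (Z x) ∂ν = 0 := by
    rw [integral_const_mul, T.integral_comp_comm hZ.integrable, hZ.mean]
    simp
  have hcs : ∀ y : E →L[ℝ] ℝ, ‖c • y‖ = c * ‖y‖ := fun y => by
    rw [norm_smul, Real.norm_of_nonneg hc]
  have := lintegral_ofReal_le_of_le_add (F := fun x => Real.cosh (c * ‖s + Z x‖))
    (c := Real.cosh (c * ‖s‖)) hint hmean
    (by fun_prop) (fun x => ?_) (Real.exp_pos _).le h (Real.cosh_pos _).le
    (fun x => (Real.cosh_pos _).le) (fun x => ?_)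
  · rwa [mul_comm, ENNReal.ofReal_mul (Real.exp_pos _).le] at this
  · have := Real.add_one_le_exp (c * ‖Z x‖)
    linarith
  · have h1 := hT (c • Z x)
    rw [← smul_add, hcs, hcs, hcs, map_smul, smul_eq_mul] at h1
    exact h1

end LightTails

/-! ### Gaussian averaging -/

section Gaussian

/-- The integrand times the standard density is √2 times the density of variance 2, and √2 ≤ e. -/
theorem lintegral_exp_sq_gaussian :
    ∫⁻ g, ENNReal.ofReal (Real.exp (g ^ 2 / 4)) ∂(gaussianReal 0 1) ≤ ENNReal.ofReal (Real.exp 1) := by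
  rw [gaussianReal_of_var_ne_zero 0 one_ne_zero,
    lintegral_withDensity_eq_lintegral_mul _ (measurable_gaussianPDF 0 1) (by fun_prop)]
  have : ∀ g : ℝ, (gaussianPDF 0 1 * fun g => ENNReal.ofReal (Real.exp (g ^ 2 / 4))) g
      = ENNReal.ofReal √2 * ENNReal.ofReal (gaussianPDFReal 0 2 g) := fun g => by
    rw [Pi.mul_apply, gaussianPDF, ← ENNReal.ofReal_mul (gaussianPDFReal_nonneg _ _ _),
      ← ENNReal.ofReal_mul (by positivity)]
    congr 1
    simp only [gaussianPDFReal, sub_zero, NNReal.coe_one, NNReal.coe_ofNat, mul_one]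
    rw [mul_assoc, ← Real.exp_add, mul_comm (2 * Real.pi) 2, Real.sqrt_mul (by norm_num) (2 * Real.pi)]
    have h2 : √(2 : ℝ) ≠ 0 := by positivity
    field_simp
    congr 1
    ring
  simp_rw [this]
  rw [lintegral_const_mul _ (measurable_gaussianPDFReal 0 2).ennreal_ofReal,
    lintegral_gaussianPDFReal_eq_one 0 two_ne_zero, mul_one]
  refine ENNReal.ofReal_le_ofReal ?_
  have h1 : √(2 : ℝ) ≤ 2 := by
    rw [Real.sqrt_le_left (by norm_num)]; norm_num
  linarith [Real.add_one_le_exp (1 : ℝ)]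

/-- Read from right to left, it writes the exponential of a square as a mixture of cosh over scales.
-/
theorem lintegral_cosh_gaussian (y : ℝ) :
    ∫⁻ g, ENNReal.ofReal (Real.cosh (g * y)) ∂(gaussianReal 0 1) = ENNReal.ofReal (Real.exp (y ^ 2 / 2)) := by
  have hi : ∀ t : ℝ, Integrable (fun g => Real.exp (t * g)) (gaussianReal 0 1) :=
    fun t => integrable_exp_mul_gaussianReal t
  have hv : ∀ t : ℝ, ∫ g, Real.exp (t * g) ∂(gaussianReal 0 1) = Real.exp (t ^ 2 / 2) := fun t => by
    have := congrFun (mgf_id_gaussianReal (μ := 0) (v := 1)) t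
    simpa [mgf] using this
  have hc : ∀ g : ℝ, Real.cosh (g * y) = (Real.exp (y * g) + Real.exp (-y * g)) / 2 := fun g => by
    rw [Real.cosh_eq]; ring_nf
  rw [← ofReal_integral_eq_lintegral_ofReal]
  · simp_rw [hc]
    rw [integral_div, integral_add (hi y) (hi (-y)), hv, hv]
    congr 1
    ring_nf
  · simp_rw [hc]
    exact ((hi y).add (hi (-y))).div_const 2
  · exact Filter.Eventually.of_forall fun g => (Real.cosh_pos _).le

end Gaussian

/-! ### Sums of independent samples -/

section Batch

variable {Ξ : Type*} [MeasurableSpace Ξ] {ν : Measure Ξ} [IsProbabilityMeasure ν]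
variable {E : Type*} [NormedAddCommGroup E] [InnerProductSpace ℝ E] [FiniteDimensional ℝ E]
  {Z : Ξ → E →L[ℝ] ℝ} {σ : ℝ}

omit [MeasurableSpace Ξ] in
theorem sum_range_succ_update {F : Type*} [AddCommMonoid F] (Z : Ξ → F) (n : ℕ) (b : ℕ → Ξ) (x : Ξ) :
    ∑ j ∈ Finset.range (n + 1), Z (Function.update b n x j)
      = (∑ j ∈ Finset.range n, Z (b j)) + Z x := by
  rw [Finset.sum_range_succ, Function.update_self]
  congr 1
  refine Finset.sum_congr rfl fun j hj => ?_
  rw [Function.update_of_ne (Finset.mem_range.1 hj).ne]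

omit [IsProbabilityMeasure ν] in
theorem IsLightTailed.measurable_sum (hZ : IsLightTailed ν σ Z) (n : ℕ) :
    Measurable fun b : ℕ → Ξ => ∑ j ∈ Finset.range n, Z (b j) := by
  have := hZ.measurable
  have hpr : ProperSpace (E →L[ℝ] ℝ) := FiniteDimensional.proper ℝ _
  exact Finset.measurable_sum _ fun j _ => this.comp (measurable_pi_apply j)

theorem IsLightTailed.lintegral_exp_sum_apply_le (hZ : IsLightTailed ν σ Z) (hσ : 0 < σ) (v : E)
    (n : ℕ) :
    ∫⁻ b, ENNReal.ofReal (Real.exp ((∑ j ∈ Finset.range n, Z (b j)) v)) ∂(seqLaw ν)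
      ≤ ENNReal.ofReal (Real.exp (n * (‖v‖ ^ 2 * σ ^ 2))) := by
  have hmeas : ∀ n, Measurable fun b : ℕ → Ξ =>
      ENNReal.ofReal (Real.exp ((∑ j ∈ Finset.range n, Z (b j)) v)) := fun n =>
    (Real.measurable_exp.comp
      ((ContinuousLinearMap.measurable_apply v).comp (hZ.measurable_sum n))).ennreal_ofReal
  induction n with
  | zero => simp
  | succ n ih =>
    calc _ ≤ ∫⁻ b, ENNReal.ofReal (Real.exp (‖v‖ ^ 2 * σ ^ 2))
          * ENNReal.ofReal (Real.exp ((∑ j ∈ Finset.range n, Z (b j)) v)) ∂(seqLaw ν) := by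
          refine lintegral_seqLaw_le ν n (hmeas (n + 1)) fun b => ?_
          simp only [sum_range_succ_update, add_apply, Real.exp_add]
          simp only [ENNReal.ofReal_mul (Real.exp_pos _).le]
          rw [lintegral_const_mul' _ _ ENNReal.ofReal_ne_top, mul_comm]
          gcongr
          exact hZ.lintegral_exp_apply_le hσ v
      _ = ENNReal.ofReal (Real.exp (‖v‖ ^ 2 * σ ^ 2))
          * ∫⁻ b, ENNReal.ofReal (Real.exp ((∑ j ∈ Finset.range n, Z (b j)) v)) ∂(seqLaw ν) :=
          lintegral_const_mul _ (hmeas n)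
      _ ≤ ENNReal.ofReal (Real.exp (‖v‖ ^ 2 * σ ^ 2))
          * ENNReal.ofReal (Real.exp (n * (‖v‖ ^ 2 * σ ^ 2))) := by gcongr
      _ = _ := by
          rw [← ENNReal.ofReal_mul (Real.exp_pos _).le, ← Real.exp_add]
          congr 2
          push_cast
          ring

theorem IsLightTailed.lintegral_cosh_sum_le (hZ : IsLightTailed ν σ Z) (hσ : 0 < σ) {c : ℝ}
    (hc : 0 ≤ c) (n : ℕ) :
    ∫⁻ b, ENNReal.ofReal (Real.cosh (c * ‖∑ j ∈ Finset.range n, Z (b j)‖)) ∂(seqLaw ν)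
      ≤ ENNReal.ofReal (Real.exp (n * (c ^ 2 * σ ^ 2))) := by
  have hmeas : ∀ n, Measurable fun b : ℕ → Ξ =>
      ENNReal.ofReal (Real.cosh (c * ‖∑ j ∈ Finset.range n, Z (b j)‖)) := fun n =>
    (Real.measurable_cosh.comp ((hZ.measurable_sum n).norm.const_mul c)).ennreal_ofReal
  induction n with
  | zero => simp
  | succ n ih =>
    calc _ ≤ ∫⁻ b, ENNReal.ofReal (Real.exp (c ^ 2 * σ ^ 2))
          * ENNReal.ofReal (Real.cosh (c * ‖∑ j ∈ Finset.range n, Z (b j)‖)) ∂(seqLaw ν) := by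
          refine lintegral_seqLaw_le ν n (hmeas (n + 1)) fun b => ?_
          simp only [sum_range_succ_update]
          exact hZ.lintegral_cosh_le hσ hc _
      _ = ENNReal.ofReal (Real.exp (c ^ 2 * σ ^ 2))
          * ∫⁻ b, ENNReal.ofReal (Real.cosh (c * ‖∑ j ∈ Finset.range n, Z (b j)‖)) ∂(seqLaw ν) :=
          lintegral_const_mul _ (hmeas n)
      _ ≤ ENNReal.ofReal (Real.exp (c ^ 2 * σ ^ 2))
          * ENNReal.ofReal (Real.exp (n * (c ^ 2 * σ ^ 2))) := by gcongr
      _ = _ := by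
          rw [← ENNReal.ofReal_mul (Real.exp_pos _).le, ← Real.exp_add]
          congr 2
          push_cast
          ring

/-- The sum of `m` independent light-tailed variables has a light-tailed norm, whatever the
dimension is. -/
theorem IsLightTailed.lintegral_exp_sq_sum_le (hZ : IsLightTailed ν σ Z) (hσ : 0 < σ) {m : ℕ}
    (hm : 0 < m) :
    ∫⁻ b, ENNReal.ofReal (Real.exp (‖∑ j ∈ Finset.range m, Z (b j)‖ ^ 2 / (8 * m * σ ^ 2)))
      ∂(seqLaw ν) ≤ ENNReal.ofReal (Real.exp 1) := by
  have hm0 : (0 : ℝ) < m := by exact_mod_cast hm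
  -- With this scale c²‖S‖²/2 is the exponent of the claim, while the cosh bound at |g|c has
  -- exponent m g²c²σ² = g²/4, which is Gaussian integrable.
  set c : ℝ := (2 * σ * √m)⁻¹ with hc
  have hc0 : 0 < c := by positivity
  have hsm : √(m : ℝ) ^ 2 = m := Real.sq_sqrt hm0.le
  have hc2 : c ^ 2 = (4 * m * σ ^ 2)⁻¹ := by
    rw [hc, inv_pow, mul_pow, mul_pow, hsm]; ring
  have hS := (hZ.measurable_sum m).norm
  have hmeas : Measurable fun q : (ℕ → Ξ) × ℝ =>
      ENNReal.ofReal (Real.cosh (q.2 * (c * ‖∑ j ∈ Finset.range m, Z (q.1 j)‖))) :=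
    (Real.measurable_cosh.comp
      (measurable_snd.mul ((hS.comp measurable_fst).const_mul c))).ennreal_ofReal
  have h1 : ∀ b : ℕ → Ξ,
      ENNReal.ofReal (Real.exp (‖∑ j ∈ Finset.range m, Z (b j)‖ ^ 2 / (8 * m * σ ^ 2)))
      = ∫⁻ g, ENNReal.ofReal (Real.cosh (g * (c * ‖∑ j ∈ Finset.range m, Z (b j)‖)))
          ∂(gaussianReal 0 1) := fun b => by
    rw [lintegral_cosh_gaussian, mul_pow, hc2]
    congr 2
    field_simp
    ring
  simp_rw [h1]
  rw [lintegral_lintegral_swap hmeas.aemeasurable]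
  refine le_trans (lintegral_mono fun g => ?_) lintegral_exp_sq_gaussian
  have h2 := hZ.lintegral_cosh_sum_le hσ (c := |g| * c) (by positivity) m
  refine le_trans (le_of_eq ?_) (h2.trans (le_of_eq ?_))
  · refine lintegral_congr fun b => ?_
    rw [← Real.cosh_abs, abs_mul, abs_of_nonneg (a := c * _) (by positivity), mul_assoc]
  · congr 2
    rw [mul_pow, sq_abs, hc2]
    field_simp

end Batch

theorem measure_le_exp_of_lintegral_exp_le {𝒳 : Type*} [MeasurableSpace 𝒳] {P : Measure 𝒳}
    {Y : 𝒳 → ℝ} (hY : Measurable Y) {c : ℝ}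
    (h : ∫⁻ x, ENNReal.ofReal (Real.exp (Y x)) ∂P ≤ ENNReal.ofReal (Real.exp c)) (t : ℝ) :
    P {x | t < Y x} ≤ ENNReal.ofReal (Real.exp (c - t)) := by
  have h1 : P {x | t < Y x} ≤ P {x | ENNReal.ofReal (Real.exp t) ≤ ENNReal.ofReal (Real.exp (Y x))} :=
    measure_mono fun x hx => ENNReal.ofReal_le_ofReal (Real.exp_le_exp.2 (le_of_lt hx))
  have h2 := meas_ge_le_lintegral_div (μ := P) (f := fun x => ENNReal.ofReal (Real.exp (Y x)))
    (by fun_prop) (ε := ENNReal.ofReal (Real.exp t)) (by simp [Real.exp_pos]) ENNReal.ofReal_ne_top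
  refine h1.trans (h2.trans ?_)
  rw [Real.exp_sub, ENNReal.ofReal_div_of_pos (Real.exp_pos t)]
  gcongr

/-! ### Large deviations along one run -/

section Predictable

/-- `X i` does not depend on the entries with index at least `i`. -/
def IsPredictable {𝒳 F : Type*} (X : ℕ → (ℕ → 𝒳) → F) : Prop :=
  ∀ i j, i ≤ j → ∀ s b, X i (Function.update s j b) = X i s

variable {Ξ : Type*} [MeasurableSpace Ξ] {ν : Measure Ξ} [IsProbabilityMeasure ν]
variable {E : Type*} [NormedAddCommGroup E] [InnerProductSpace ℝ E] [FiniteDimensional ℝ E]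
  [MeasurableSpace E] [BorelSpace E] {Z : E → Ξ → E →L[ℝ] ℝ} {σ : ℝ} {m : ℕ}

omit [MeasurableSpace E] [BorelSpace E] in
theorem lintegral_exp_batchMean_apply_le {x : E} (hZ : IsLightTailed ν σ (Z x)) (hσ : 0 < σ) (hm : 0 < m) (v : E) :
    ∫⁻ b, ENNReal.ofReal (Real.exp (batchMean Z m b x v)) ∂(seqLaw ν)
      ≤ ENNReal.ofReal (Real.exp (‖v‖ ^ 2 * σ ^ 2 / m)) := by
  have hm0 : (0 : ℝ) < m := by exact_mod_cast hm
  have h := hZ.lintegral_exp_sum_apply_le hσ ((m : ℝ)⁻¹ • v) m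
  refine le_trans (le_of_eq ?_) (h.trans (le_of_eq ?_))
  · refine lintegral_congr fun b => ?_
    simp [batchMean]
  · congr 2
    rw [norm_smul, Real.norm_of_nonneg (by positivity)]
    field_simp

omit [MeasurableSpace E] [BorelSpace E] in
theorem lintegral_exp_sq_batchMean_le {x : E} (hZ : IsLightTailed ν σ (Z x)) (hσ : 0 < σ)
    (hm : 0 < m) :
    ∫⁻ b, ENNReal.ofReal (Real.exp (m / (8 * σ ^ 2) * ‖batchMean Z m b x‖ ^ 2)) ∂(seqLaw ν)
      ≤ ENNReal.ofReal (Real.exp 1) := by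
  have hm0 : (0 : ℝ) < m := by exact_mod_cast hm
  refine le_trans (le_of_eq ?_) (hZ.lintegral_exp_sq_sum_le hσ hm)
  refine lintegral_congr fun b => ?_
  congr 2
  rw [batchMean, norm_smul, Real.norm_of_nonneg (by positivity)]
  field_simp

omit [BorelSpace E] in
theorem measurable_batchMean (hZm : Measurable (Function.uncurry Z)) (m : ℕ) {𝒳 : Type*}
    [MeasurableSpace 𝒳] {b : 𝒳 → ℕ → Ξ} (hb : Measurable b) {X : 𝒳 → E} (hX : Measurable X) :
    Measurable fun s => batchMean Z m (b s) (X s) := by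
  have hpr : ProperSpace (E →L[ℝ] ℝ) := FiniteDimensional.proper ℝ _
  have h : Measurable fun s => ∑ j ∈ Finset.range m, Z (X s) (b s j) :=
    Finset.measurable_sum _ fun j _ => hZm.comp (hX.prodMk ((measurable_pi_apply j).comp hb))
  exact h.const_smul (m : ℝ)⁻¹

variable {X p : ℕ → (ℕ → ℕ → Ξ) → E}

/-- Batch n enters the sum up to n only through its last term, and there it meets a frozen point and
direction. Integrating it first peels off one factor. -/
theorem lintegral_exp_martingale_le (hZm : Measurable (Function.uncurry Z))
    (hZ : ∀ x, IsLightTailed ν σ (Z x)) (hσ : 0 < σ) (hm : 0 < m)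
    (hX : ∀ i, Measurable (X i)) (hXp : IsPredictable X)
    (hp : ∀ i, Measurable (p i)) (hpp : IsPredictable p) {v : E} {D : ℝ}
    (hD : ∀ i s, ‖v - p i s‖ ≤ D) (a : ℕ → ℝ) (n : ℕ) :
    ∫⁻ s, ENNReal.ofReal (Real.exp
        (∑ i ∈ Finset.range n, a i * batchMean Z m (s i) (X i s) (v - p i s))) ∂(seqLaw (seqLaw ν))
      ≤ ENNReal.ofReal (Real.exp (∑ i ∈ Finset.range n, a i ^ 2 * (D ^ 2 * σ ^ 2 / m))) := by
  have hm0 : (0 : ℝ) < m := by exact_mod_cast hm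
  have hmeas : ∀ n, Measurable fun s : ℕ → ℕ → Ξ => ENNReal.ofReal (Real.exp
      (∑ i ∈ Finset.range n, a i * batchMean Z m (s i) (X i s) (v - p i s))) := fun n => by
    refine (Real.measurable_exp.comp (Finset.measurable_sum _ fun i _ => ?_)).ennreal_ofReal
    refine Measurable.const_mul ?_ _
    have h1 := measurable_batchMean hZm m (measurable_pi_apply i) (hX i)
    have h2 : Measurable fun s => v - p i s := (hp i).const_sub v
    have h3 : Continuous fun q : (E →L[ℝ] ℝ) × E => q.1 q.2 := by fun_prop
    have hpr : ProperSpace (E →L[ℝ] ℝ) := FiniteDimensional.proper ℝ _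
    have hpr' : ProperSpace E := FiniteDimensional.proper ℝ _
    exact h3.measurable.comp (h1.prodMk h2)
  induction n with
  | zero => simp
  | succ n ih =>
    set c := ENNReal.ofReal (Real.exp (a n ^ 2 * (D ^ 2 * σ ^ 2 / m)))
    calc _ ≤ ∫⁻ s, c * ENNReal.ofReal (Real.exp
          (∑ i ∈ Finset.range n, a i * batchMean Z m (s i) (X i s) (v - p i s)))
            ∂(seqLaw (seqLaw ν)) := by
          refine lintegral_seqLaw_le (seqLaw ν) n (hmeas (n + 1)) fun s => ?_
          have hsplit : ∀ b, ∑ i ∈ Finset.range (n + 1),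
              a i * batchMean Z m (Function.update s n b i) (X i (Function.update s n b))
                (v - p i (Function.update s n b))
              = (∑ i ∈ Finset.range n, a i * batchMean Z m (s i) (X i s) (v - p i s))
                + batchMean Z m b (X n s) (a n • (v - p n s)) := fun b => by
            rw [Finset.sum_range_succ, Function.update_self, hXp n n le_rfl, hpp n n le_rfl, map_smul,
              smul_eq_mul]
            congr 1
            refine Finset.sum_congr rfl fun j hj => ?_
            have hj' := Finset.mem_range.1 hj
            rw [Function.update_of_ne hj'.ne, hXp j n hj'.le, hpp j n hj'.le]
          simp only [hsplit, Real.exp_add]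
          simp only [ENNReal.ofReal_mul (Real.exp_pos _).le]
          rw [lintegral_const_mul' _ _ ENNReal.ofReal_ne_top, mul_comm]
          gcongr
          refine (lintegral_exp_batchMean_apply_le (hZ _) hσ hm _).trans ?_
          refine ENNReal.ofReal_le_ofReal (Real.exp_le_exp.2 ?_)
          rw [norm_smul, mul_pow, Real.norm_eq_abs, sq_abs, mul_assoc, mul_div_assoc]
          have := hD n s
          gcongr
      _ = c * ∫⁻ s, ENNReal.ofReal (Real.exp
          (∑ i ∈ Finset.range n, a i * batchMean Z m (s i) (X i s) (v - p i s)))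
            ∂(seqLaw (seqLaw ν)) := lintegral_const_mul _ (hmeas n)
      _ ≤ c * ENNReal.ofReal (Real.exp (∑ i ∈ Finset.range n, a i ^ 2 * (D ^ 2 * σ ^ 2 / m))) := by
          gcongr
      _ = _ := by
          rw [← ENNReal.ofReal_mul (Real.exp_pos _).le, ← Real.exp_add, Finset.sum_range_succ,
            add_comm]

omit [BorelSpace E] in
-- Convexity of exp reduces the weighted sum to single steps, each of moment at most e, so
-- dependence between steps is harmless.
theorem lintegral_exp_weighted_sq_le (hZm : Measurable (Function.uncurry Z))
    (hZ : ∀ x, IsLightTailed ν σ (Z x)) (hσ : 0 < σ) (hm : 0 < m)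
    (hX : ∀ i, Measurable (X i)) (hXp : IsPredictable X) {w : ℕ → ℝ} (hw : ∀ i, 0 ≤ w i) {n : ℕ}
    (hw1 : ∑ i ∈ Finset.range n, w i = 1) :
    ∫⁻ s, ENNReal.ofReal (Real.exp
        (∑ i ∈ Finset.range n, w i * (m / (8 * σ ^ 2) * ‖batchMean Z m (s i) (X i s)‖ ^ 2)))
          ∂(seqLaw (seqLaw ν))
      ≤ ENNReal.ofReal (Real.exp 1) := by
  have hmeas : ∀ i, Measurable fun s : ℕ → ℕ → Ξ => ENNReal.ofReal (Real.exp
      (m / (8 * σ ^ 2) * ‖batchMean Z m (s i) (X i s)‖ ^ 2)) := fun i => by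
    have h1 := measurable_batchMean hZm m (measurable_pi_apply i) (hX i)
    exact (Real.measurable_exp.comp ((h1.norm.pow_const 2).const_mul _)).ennreal_ofReal
  have hone : ∀ i, ∫⁻ s, ENNReal.ofReal (Real.exp
      (m / (8 * σ ^ 2) * ‖batchMean Z m (s i) (X i s)‖ ^ 2)) ∂(seqLaw (seqLaw ν))
      ≤ ENNReal.ofReal (Real.exp 1) := fun i => by
    have := lintegral_seqLaw_le (seqLaw ν) i (hmeas i)
      (K := fun _ => ENNReal.ofReal (Real.exp 1)) fun s => by
        simp only [Function.update_self, hXp i i le_rfl]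
        exact lintegral_exp_sq_batchMean_le (hZ _) hσ hm
    simpa using this
  calc _ ≤ ∫⁻ s, ∑ i ∈ Finset.range n, ENNReal.ofReal (w i) * ENNReal.ofReal (Real.exp
          (m / (8 * σ ^ 2) * ‖batchMean Z m (s i) (X i s)‖ ^ 2)) ∂(seqLaw (seqLaw ν)) := by
        refine lintegral_mono fun s => ?_
        have hj := convexOn_exp.map_sum_le (t := Finset.range n) (w := w)
          (p := fun i => m / (8 * σ ^ 2) * ‖batchMean Z m (s i) (X i s)‖ ^ 2)
          (fun i _ => hw i) hw1 (fun i _ => Set.mem_univ _)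
        simp only [smul_eq_mul] at hj
        refine (ENNReal.ofReal_le_ofReal hj).trans (le_of_eq ?_)
        rw [ENNReal.ofReal_sum_of_nonneg fun i _ => mul_nonneg (hw i) (Real.exp_pos _).le]
        exact Finset.sum_congr rfl fun i _ => ENNReal.ofReal_mul (hw i)
    _ = ∑ i ∈ Finset.range n, ENNReal.ofReal (w i) * ∫⁻ s, ENNReal.ofReal (Real.exp
          (m / (8 * σ ^ 2) * ‖batchMean Z m (s i) (X i s)‖ ^ 2)) ∂(seqLaw (seqLaw ν)) := by
        rw [lintegral_finsetSum _ fun i _ => (hmeas i).const_mul _]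
        exact Finset.sum_congr rfl fun i _ => lintegral_const_mul _ (hmeas i)
    _ ≤ ∑ i ∈ Finset.range n, ENNReal.ofReal (w i) * ENNReal.ofReal (Real.exp 1) := by
        gcongr with i _
        exact hone i
    _ = _ := by
        rw [← Finset.sum_mul, ← ENNReal.ofReal_sum_of_nonneg fun i _ => hw i, hw1,
          ENNReal.ofReal_one, one_mul]

/-- Large deviations of the two noise terms of one run of the method. -/
theorem seqLaw_noise_le (hZm : Measurable (Function.uncurry Z))
    (hZ : ∀ x, IsLightTailed ν σ (Z x)) (hσ : 0 < σ) (hm : 0 < m)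
    (hX : ∀ i, Measurable (X i)) (hXp : IsPredictable X)
    (hp : ∀ i, Measurable (p i)) (hpp : IsPredictable p) {v : E} {D : ℝ} (hD0 : 0 < D)
    (hD : ∀ i s, ‖v - p i s‖ ≤ D) {a w : ℕ → ℝ} (ha : ∀ i, 0 < a i) (hw : ∀ i, 0 < w i) (n : ℕ)
    {t : ℝ} (ht : 0 < t) :
    seqLaw (seqLaw ν) {s |
      8 * σ ^ 2 / m * (1 + t) * (∑ i ∈ Finset.range (n + 1), w i)
          < ∑ i ∈ Finset.range (n + 1), w i * ‖batchMean Z m (s i) (X i s)‖ ^ 2 ∨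
      2 * √t * (D * σ / √m * √(∑ i ∈ Finset.range (n + 1), a i ^ 2))
          < ∑ i ∈ Finset.range (n + 1), a i * batchMean Z m (s i) (X i s) (v - p i s)}
      ≤ 2 * ENNReal.ofReal (Real.exp (-t)) := by
  have hm0 : (0 : ℝ) < m := by exact_mod_cast hm
  rw [Set.ofPred_or, two_mul (ENNReal.ofReal _)]
  refine (measure_union_le _ _).trans (add_le_add ?_ ?_)
  · set W := ∑ i ∈ Finset.range (n + 1), w i with hW
    have hW0 : 0 < W := Finset.sum_pos (fun i _ => hw i) ⟨0, by simp⟩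
    have h := lintegral_exp_weighted_sq_le hZm hZ hσ hm hX hXp (w := fun i => w i / W) (n := n + 1)
      (fun i => (div_pos (hw i) hW0).le) (by rw [← Finset.sum_div, div_self hW0.ne'])
    have hmeas : Measurable fun s : ℕ → ℕ → Ξ =>
        ∑ i ∈ Finset.range (n + 1), w i / W * (m / (8 * σ ^ 2) * ‖batchMean Z m (s i) (X i s)‖ ^ 2) := by
      refine Finset.measurable_sum _ fun i _ => ?_
      have h1 := measurable_batchMean hZm m (measurable_pi_apply i) (hX i)
      exact ((h1.norm.pow_const 2).const_mul _).const_mul _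
    refine le_trans (measure_mono fun s hs => ?_)
      ((measure_le_exp_of_lintegral_exp_le hmeas h (1 + t)).trans (le_of_eq (by ring_nf)))
    simp only [Set.mem_ofPred_eq] at hs ⊢
    have e : ∑ i ∈ Finset.range (n + 1), w i / W * (m / (8 * σ ^ 2) * ‖batchMean Z m (s i) (X i s)‖ ^ 2)
        = (∑ i ∈ Finset.range (n + 1), w i * ‖batchMean Z m (s i) (X i s)‖ ^ 2) * (m / (8 * σ ^ 2 * W)) := by
      rw [Finset.sum_mul]
      refine Finset.sum_congr rfl fun i _ => ?_
      field_simp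
    rw [e]
    have h2 := mul_lt_mul_of_pos_right hs (show 0 < m / (8 * σ ^ 2 * W) by positivity)
    refine lt_of_eq_of_lt ?_ h2
    field_simp
  · set S := ∑ i ∈ Finset.range (n + 1), a i ^ 2 with hS
    have hS0 : 0 < S := Finset.sum_pos (fun i _ => pow_pos (ha i) 2) ⟨0, by simp⟩
    set c := D * σ / √m * √S with hc
    have hc0 : 0 < c := by positivity
    have hc2 : c ^ 2 = D ^ 2 * σ ^ 2 / m * S := by
      rw [hc, mul_pow, div_pow, mul_pow, Real.sq_sqrt hm0.le, Real.sq_sqrt hS0.le]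
    -- Optimal Chernoff parameter: the log-moment l²c² equals t and the scaled threshold equals 2t,
    -- which leaves e^{-t}.
    set l := √t / c with hl
    have hl0 : 0 < l := div_pos (Real.sqrt_pos.2 ht) hc0
    have hlc : l ^ 2 * c ^ 2 = t := by
      rw [hl, div_pow, Real.sq_sqrt ht.le]; field_simp
    have h := lintegral_exp_martingale_le hZm hZ hσ hm hX hXp hp hpp hD (fun i => l * a i) (n + 1)
    have e1 : ∑ i ∈ Finset.range (n + 1), (l * a i) ^ 2 * (D ^ 2 * σ ^ 2 / m) = t := by
      rw [← hlc, hc2, hS, Finset.mul_sum, Finset.mul_sum]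
      refine Finset.sum_congr rfl fun i _ => ?_
      ring
    rw [e1] at h
    have hmeas : Measurable fun s : ℕ → ℕ → Ξ =>
        ∑ i ∈ Finset.range (n + 1), l * a i * batchMean Z m (s i) (X i s) (v - p i s) := by
      refine Finset.measurable_sum _ fun i _ => ?_
      refine Measurable.const_mul ?_ _
      have h1 := measurable_batchMean hZm m (measurable_pi_apply i) (hX i)
      have h2 : Measurable fun s => v - p i s := (hp i).const_sub v
      have h3 : Continuous fun q : (E →L[ℝ] ℝ) × E => q.1 q.2 := by fun_prop
      have hpr : ProperSpace (E →L[ℝ] ℝ) := FiniteDimensional.proper ℝ _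
      have hpr' : ProperSpace E := FiniteDimensional.proper ℝ _
      exact h3.measurable.comp (h1.prodMk h2)
    refine le_trans (measure_mono fun s hs => ?_)
      ((measure_le_exp_of_lintegral_exp_le hmeas h (2 * t)).trans (le_of_eq (by ring_nf)))
    simp only [Set.mem_ofPred_eq] at hs ⊢
    have e : ∑ i ∈ Finset.range (n + 1), l * a i * batchMean Z m (s i) (X i s) (v - p i s)
        = l * ∑ i ∈ Finset.range (n + 1), a i * batchMean Z m (s i) (X i s) (v - p i s) := by
      rw [Finset.mul_sum]
      exact Finset.sum_congr rfl fun i _ => by ring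
    rw [e]
    refine lt_of_eq_of_lt ?_ (mul_lt_mul_of_pos_left hs hl0)
    have := Real.mul_self_sqrt ht.le
    rw [hl]
    field_simp
    linarith

end Predictable

/-! ### The localized, rescaled prox setup of a stage -/

section Localized

variable {E : Type*} [NormedAddCommGroup E] [InnerProductSpace ℝ E]

/-- The feasible set of a stage with centre `u` and radius `R`. -/
def localSet (Q : Set E) (R : ℝ) (u : E) : Set E := {x ∈ Q | ‖x - u‖ ^ 2 ≤ R ^ 2}

/-- The prox-function of a stage with centre `u` and radius `R`. -/
def localProx (d : E → ℝ) (R : ℝ) (u x : E) : ℝ := d (R⁻¹ • (x - u))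

variable {Q : Set E} {R : ℝ} {u : E} {d h : E → ℝ}

omit [InnerProductSpace ℝ E] in
theorem mem_localSet (hR : 0 < R) {x : E} : x ∈ localSet Q R u ↔ x ∈ Q ∧ ‖x - u‖ ≤ R := by
  simp only [localSet, Set.mem_sep_iff]
  rw [pow_le_pow_iff_left₀ (norm_nonneg _) hR.le two_ne_zero]

theorem inv_smul_sub_mem_ball (hR : 0 < R) {x : E} (hx : x ∈ localSet Q R u) :
    R⁻¹ • (x - u) ∈ Metric.closedBall (0 : E) 1 := by
  rw [mem_closedBall_zero_iff, norm_smul, Real.norm_of_nonneg (by positivity), inv_mul_eq_div,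
    div_le_one hR]
  exact ((mem_localSet hR).1 hx).2

theorem convex_localSet (hR : 0 < R) (hQ : Convex ℝ Q) : Convex ℝ (localSet Q R u) := by
  have : localSet Q R u = Q ∩ Metric.closedBall u R := by
    ext x
    rw [mem_localSet hR, Set.mem_inter_iff, mem_closedBall_iff_norm]
  rw [this]
  exact hQ.inter (convex_closedBall u R)

theorem hasFDerivAt_localProx (hR : 0 < R) (hd : IsProxFunction d) {x : E}
    (hx : x ∈ localSet Q R u) :
    HasFDerivAt (localProx d R u) (R⁻¹ • fderiv ℝ d (R⁻¹ • (x - u))) x := by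
  have h1 := (hd.differentiableAt _ (inv_smul_sub_mem_ball hR hx)).hasFDerivAt
  have h2 : HasFDerivAt (fun x : E => R⁻¹ • (x - u)) (R⁻¹ • ContinuousLinearMap.id ℝ E) x :=
    ((hasFDerivAt_id x).sub_const u).const_smul R⁻¹
  have h3 := h1.comp x h2
  rwa [ContinuousLinearMap.comp_smul, ContinuousLinearMap.comp_id] at h3

theorem strongConvexOn_localProx (hR : 0 < R) (hQ : Convex ℝ Q) (hd : IsProxFunction d) :
    StrongConvexOn (localSet Q R u) (R ^ 2)⁻¹ (localProx d R u) := by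
  refine ⟨convex_localSet hR hQ, fun x hx y hy a b ha hb hab => ?_⟩
  have h := hd.strongConvexOn.2 (inv_smul_sub_mem_ball hR hx) (inv_smul_sub_mem_ball hR hy) ha hb hab
  have e : a • R⁻¹ • (x - u) + b • R⁻¹ • (y - u) = R⁻¹ • (a • x + b • y - u) := by
    have : u = (a + b) • u := by rw [hab, one_smul]
    conv_rhs => rw [this]
    module
  have e2 : R⁻¹ • (x - u) - R⁻¹ • (y - u) = R⁻¹ • (x - y) := by module
  rw [e] at h
  simp only [e2, norm_smul, Real.norm_of_nonneg (inv_pos.2 hR).le] at h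
  refine h.trans (le_of_eq ?_)
  simp only [localProx]
  congr 2
  ring

variable [FiniteDimensional ℝ E]

theorem isCompact_localSet (hR : 0 < R) (hQ : IsClosed Q) : IsCompact (localSet Q R u) := by
  have : localSet Q R u = Metric.closedBall u R ∩ Q := by
    ext x
    rw [mem_localSet hR, Set.mem_inter_iff, mem_closedBall_iff_norm, and_comm]
  have hp : ProperSpace E := FiniteDimensional.proper ℝ E
  rw [this]
  exact (isCompact_closedBall u R).inter_right hQ

/-- The localization makes the feasible set compact, so lower semicontinuity of h suffices for
solvability. Rescaling by R turns the constant 1 into 1/R². -/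
theorem isProxSetup_local (hR : 0 < R) (hQ : IsClosed Q) (hh : ConvexOn ℝ Q h)
    (hlsc : LowerSemicontinuousOn h Q) (hd : IsProxFunction d) (hu : u ∈ Q) :
    IsProxSetup (localSet Q R u) (localProx d R u) h u (R ^ 2)⁻¹ := by
  have hmem : u ∈ localSet Q R u := (mem_localSet hR).2 ⟨hu, by simpa using hR.le⟩
  have hsub : localSet Q R u ⊆ Q := fun x hx => hx.1
  have hdiff : ∀ x ∈ localSet Q R u, DifferentiableAt ℝ (localProx d R u) x :=
    fun x hx => (hasFDerivAt_localProx hR hd hx).differentiableAt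
  refine ⟨convex_localSet hR hh.1, hmem, hh.subset hsub (convex_localSet hR hh.1), hdiff,
    fun x hx z hz => le_bregman_of_strongConvexOn (strongConvexOn_localProx hR hh.1 hd) hx hz
      (hdiff z hz), fun x hx => ?_, fun β A hβ hA ℓ => ?_⟩
  · have h1 := hd.strongConvexOn.le_sub_of_isMinOn (z := 0) (by simp) hd.isMinOn_zero
      (inv_smul_sub_mem_ball hR hx)
    rw [hd.map_zero, sub_zero, sub_zero, norm_smul, Real.norm_of_nonneg (inv_pos.2 hR).le] at h1
    refine le_trans (le_of_eq ?_) h1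
    ring
  · refine LowerSemicontinuousOn.exists_isMinOn ⟨u, hmem⟩ (isCompact_localSet hR hQ) ?_
    have hc : ContinuousOn (fun v => β * localProx d R u v + ℓ v) (localSet Q R u) :=
      (ContinuousOn.mul continuousOn_const
        fun x hx => (hdiff x hx).continuousAt.continuousWithinAt).add ℓ.continuous.continuousOn
    have hA' : LowerSemicontinuousOn (fun v => A * h v) (localSet Q R u) := by
      have hm : Monotone fun r : ℝ => A * r := fun a b hab => mul_le_mul_of_nonneg_left hab hA.le
      exact Continuous.comp_lowerSemicontinuousOn (g := fun r : ℝ => A * r) (by fun_prop)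
        (fun x hx => (hlsc x (hsub hx)).mono hsub) hm
    exact hc.lowerSemicontinuousOn.add hA'

end Localized

/-! ### Quadratic growth of the auxiliary problems -/

section Growth

variable {E : Type*} [NormedAddCommGroup E] [InnerProductSpace ℝ E] {S : Set E} {D h : E → ℝ}
  {x0 : E} {ρ : ℝ}

theorem IsProxSetup.growth (hP : IsProxSetup S D h x0 ρ) {β A : ℝ} (hβ : 0 < β) (hA : 0 < A)
    (ℓ : E →L[ℝ] ℝ) {z v : E} (hz : z ∈ S)
    (hmin : IsMinOn (fun v => β * D v + ℓ v + A * h v) S z) (hv : v ∈ S) :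
    β * D z + ℓ z + A * h z + β * (ρ / 2 * ‖v - z‖ ^ 2) ≤ β * D v + ℓ v + A * h v := by
  have hc : ConvexOn ℝ S (fun v => ℓ v + A * h v) :=
    (ℓ.toLinearMap.convexOn hP.convex).add (hP.convexOn.smul hA.le)
  have h1 := fderiv_add_nonneg_of_isMinOn (D := D) hc hz hv (hP.diff _ hz) hβ (by
    simpa only [add_assoc] using hmin)
  have h2 := mul_le_mul_of_nonneg_left (hP.le_bregman v hv z hz) hβ.le
  simp only [bregman] at h2
  linarith

end Growth

/-! ### Measurability of the solution of an auxiliary problem -/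

section MeasurableArgmin

variable {E : Type*} [NormedAddCommGroup E] [InnerProductSpace ℝ E] [FiniteDimensional ℝ E]
  [MeasurableSpace E] [BorelSpace E] {Q : Set E} {R : ℝ} {d h : E → ℝ}

omit [MeasurableSpace E] [BorelSpace E] in
-- Witnesses stay within R of a convergent sequence of centres, so a subsequence converges, and its
-- limit is a witness.
theorem isClosed_sublevel (hR : 0 < R) (hQ : IsClosed Q) (hlsc : LowerSemicontinuousOn h Q)
    (hd : IsProxFunction d) {β A : ℝ} (hA : 0 < A) {C : Set E} (hC : IsClosed C) (c : ℝ) :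
    IsClosed {θ : Q × (E →L[ℝ] ℝ) | ∃ x ∈ C, x ∈ localSet Q R (θ.1 : E) ∧
      β * localProx d R (θ.1 : E) x + θ.2 x + A * h x ≤ c} := by
  have hp : ProperSpace E := FiniteDimensional.proper ℝ E
  refine IsSeqClosed.isClosed fun θ θ' hθ hlim => ?_
  choose x hxC hxS hxc using hθ
  have hball : ∀ n, x n - ((θ n).1 : E) ∈ Metric.closedBall (0 : E) R := fun n => by
    rw [mem_closedBall_zero_iff]
    exact ((mem_localSet hR).1 (hxS n)).2
  obtain ⟨v, hv, φ, hφ, hvlim⟩ := (isCompact_closedBall (0 : E) R).tendsto_subseq hball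
  have hθφ := hlim.comp hφ.tendsto_atTop
  have hu : Tendsto (fun n => ((θ (φ n)).1 : E)) atTop (𝓝 (θ'.1 : E)) :=
    (continuous_subtype_val.tendsto _).comp ((continuous_fst.tendsto _).comp hθφ)
  have hℓ : Tendsto (fun n => (θ (φ n)).2) atTop (𝓝 θ'.2) := (continuous_snd.tendsto _).comp hθφ
  have hx : Tendsto (fun n => x (φ n)) atTop (𝓝 (v + (θ'.1 : E))) := by
    have := hvlim.add hu
    simpa using this
  set y := v + (θ'.1 : E) with hy
  have hyQ : y ∈ Q := hQ.mem_of_tendsto hx (Eventually.of_forall fun n => (hxS _).1)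
  have hyC : y ∈ C := hC.mem_of_tendsto hx (Eventually.of_forall fun n => hxC _)
  have hyS : y ∈ localSet Q R (θ'.1 : E) := by
    refine (mem_localSet hR).2 ⟨hyQ, ?_⟩
    rw [hy, add_sub_cancel_right]
    exact mem_closedBall_zero_iff.1 hv
  refine ⟨y, hyC, hyS, ?_⟩
  have hdlim : Tendsto (fun n => localProx d R ((θ (φ n)).1 : E) (x (φ n))) atTop
      (𝓝 (localProx d R (θ'.1 : E) y)) := by
    have hcont := (hd.differentiableAt _ (inv_smul_sub_mem_ball hR hyS)).continuousAt
    exact hcont.tendsto.comp ((hx.sub hu).const_smul R⁻¹)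
  have hℓx : Tendsto (fun n => (θ (φ n)).2 (x (φ n))) atTop (𝓝 (θ'.2 y)) := by
    have hc : Continuous fun q : (E →L[ℝ] ℝ) × E => q.1 q.2 := by fun_prop
    exact (hc.tendsto (θ'.2, y)).comp (hℓ.prodMk_nhds hx)
  have hlim2 : Tendsto (fun n => (c - β * localProx d R ((θ (φ n)).1 : E) (x (φ n))
      - (θ (φ n)).2 (x (φ n))) / A) atTop
      (𝓝 ((c - β * localProx d R (θ'.1 : E) y - θ'.2 y) / A)) :=
    ((tendsto_const_nhds.sub (hdlim.const_mul β)).sub hℓx).div_const A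
  -- All terms but h converge; since h is only lower semicontinuous, the inequality is solved for h
  -- before the limit.
  have hle : h y ≤ (c - β * localProx d R (θ'.1 : E) y - θ'.2 y) / A := by
    by_contra! hlt
    obtain ⟨r, hr1, hr2⟩ := exists_between hlt
    have hxw : Tendsto (fun n => x (φ n)) atTop (𝓝[Q] y) :=
      tendsto_nhdsWithin_iff.2 ⟨hx, Eventually.of_forall fun n => (hxS _).1⟩
    have hev := hxw.eventually (hlsc y hyQ r hr2)
    have : r ≤ (c - β * localProx d R (θ'.1 : E) y - θ'.2 y) / A := by
      refine ge_of_tendsto hlim2 ?_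
      filter_upwards [hev] with n hn
      refine hn.le.trans ?_
      rw [le_div_iff₀ hA]
      linarith [hxc (φ n)]
    linarith
  rw [le_div_iff₀ hA] at hle
  linarith

/-- The solution of the auxiliary problem depends measurably on the centre and on the slope. -/
theorem measurable_argminOn (hR : 0 < R) (hQ : IsClosed Q) (hh : ConvexOn ℝ Q h)
    (hlsc : LowerSemicontinuousOn h Q) (hd : IsProxFunction d) {β A : ℝ} (hβ : 0 < β) (hA : 0 < A) :
    Measurable fun θ : Q × (E →L[ℝ] ℝ) => argminOn (localSet Q R (θ.1 : E))
      fun v => β * localProx d R (θ.1 : E) v + θ.2 v + A * h v := by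
  have hpr : ProperSpace (E →L[ℝ] ℝ) := FiniteDimensional.proper ℝ _
  have hpr' : ProperSpace E := FiniteDimensional.proper ℝ _
  refine measurable_of_isClosed fun C hC => ?_
  -- The minimizer lies in C iff every nonempty rational sublevel set meets C. If z is outside C,
  -- quadratic growth lifts the values on C by a fixed κ above the minimum, and a rational level in
  -- this gap gives a contradiction.
  have hset : (fun θ : Q × (E →L[ℝ] ℝ) => argminOn (localSet Q R (θ.1 : E))
      fun v => β * localProx d R (θ.1 : E) v + θ.2 v + A * h v) ⁻¹' C
      = ⋂ r : ℚ, ({θ : Q × (E →L[ℝ] ℝ) | ∃ x ∈ Set.univ, x ∈ localSet Q R (θ.1 : E) ∧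
          β * localProx d R (θ.1 : E) x + θ.2 x + A * h x ≤ r}ᶜ
        ∪ {θ : Q × (E →L[ℝ] ℝ) | ∃ x ∈ C, x ∈ localSet Q R (θ.1 : E) ∧
          β * localProx d R (θ.1 : E) x + θ.2 x + A * h x ≤ r}) := by
    ext θ
    have hP := isProxSetup_local hR hQ hh hlsc hd θ.1.2
    obtain ⟨hzS, hzmin⟩ := argminOn_spec (hP.solvable β A hβ hA θ.2)
    set z := argminOn (localSet Q R (θ.1 : E))
      fun v => β * localProx d R (θ.1 : E) v + θ.2 v + A * h v with hz
    have hgr := fun v (hv : v ∈ localSet Q R (θ.1 : E)) => hP.growth hβ hA θ.2 hzS hzmin hv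
    simp only [Set.mem_preimage, Set.mem_iInter, Set.mem_union, Set.mem_compl_iff, Set.mem_ofPred_eq,
      Set.mem_univ, true_and]
    rw [← hz]
    constructor
    · intro hzC r
      by_cases hr : ∃ x, x ∈ localSet Q R (θ.1 : E) ∧
          β * localProx d R (θ.1 : E) x + θ.2 x + A * h x ≤ r
      · right
        obtain ⟨x, hxS, hx⟩ := hr
        exact ⟨z, hzC, hzS, le_trans (hzmin hxS) hx⟩
      · exact Or.inl hr
    · intro H
      by_contra hzC
      obtain ⟨ε, hε, hball⟩ := Metric.isOpen_iff.1 hC.isOpen_compl z hzC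
      set κ := β * ((R ^ 2)⁻¹ / 2 * ε ^ 2) with hκ
      have hκ0 : 0 < κ := by positivity
      obtain ⟨r, hr1, hr2⟩ := exists_rat_btwn (lt_add_of_pos_right
        (β * localProx d R (θ.1 : E) z + θ.2 z + A * h z) hκ0)
      rcases H r with hr | ⟨x, hxC, hxS, hx⟩
      · exact hr ⟨z, hzS, hr1.le⟩
      · have hdist : ε ≤ ‖x - z‖ := by
          by_contra! hlt
          exact hball (mem_ball_iff_norm.2 hlt) hxC
        have h1 := hgr x hxS
        have h2 : κ ≤ β * ((R ^ 2)⁻¹ / 2 * ‖x - z‖ ^ 2) := by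
          rw [hκ]; gcongr
        linarith
  rw [hset]
  refine MeasurableSet.iInter fun r => ?_
  exact (isClosed_sublevel hR hQ hlsc hd hA isClosed_univ r).measurableSet.compl.union
    (isClosed_sublevel hR hQ hlsc hd hA hC r).measurableSet

end MeasurableArgmin

/-! ### Measurability of the iterates -/

section MeasurableMethod

variable {E : Type*} [NormedAddCommGroup E] [InnerProductSpace ℝ E]

/-- The state depends on the oracle only through its answers at the visited points. This underlies
both predictability and changing the oracle outside Q. -/
theorem sigm_congr {S : Set E} {D h : E → ℝ} {α β B : ℕ → ℝ} {x0 : E}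
    {answer answer' : ℕ → E → (E →L[ℝ] ℝ)} (n : ℕ)
    (H : ∀ i ≤ n, answer i (sigm S D h α β B x0 answer i).x
      = answer' i (sigm S D h α β B x0 answer i).x) :
    sigm S D h α β B x0 answer n = sigm S D h α β B x0 answer' n := by
  induction n with
  | zero =>
    have h0 : answer 0 x0 = answer' 0 x0 := H 0 le_rfl
    simp only [sigm, h0]
  | succ n ih =>
    have h1 := ih fun i hi => H i (hi.trans n.le_succ)
    have h2 := H (n + 1) le_rfl
    rw [sigm_x_succ, h1] at h2
    simp only [sigm, h1, h2]

variable [FiniteDimensional ℝ E] [MeasurableSpace E] [BorelSpace E]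
  {Q : Set E} {R : ℝ} {d h : E → ℝ} {α β B κ : ℕ → ℝ} {L : ℝ}
  {𝒴 : Type*} [MeasurableSpace 𝒴] {u : 𝒴 → Q} {answer : 𝒴 → ℕ → E → (E →L[ℝ] ℝ)}

/-- The slope is carried through the induction because z_k depends on past answers only through it.
The centre varies with the parameter too, since later stages start at random points. -/
theorem measurable_sigm (hR : 0 < R) (hQ : IsClosed Q) (hh : ConvexOn ℝ Q h)
    (hlsc : LowerSemicontinuousOn h Q) (hd : IsProxFunction d)
    (hs : IsStepSequence α β B κ L (R ^ 2)⁻¹) (hu : Measurable u)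
    (ha : ∀ i, Measurable fun q : 𝒴 × E => answer q.1 i q.2) (n : ℕ) :
    (Measurable fun y => (sigm (localSet Q R (u y)) (localProx d R (u y)) h α β B (u y)
      (answer y) n).x) ∧
    (Measurable fun y => (sigm (localSet Q R (u y)) (localProx d R (u y)) h α β B (u y)
      (answer y) n).z) ∧
    (Measurable fun y => (sigm (localSet Q R (u y)) (localProx d R (u y)) h α β B (u y)
      (answer y) n).y) ∧
    (Measurable fun y => slope (localSet Q R (u y)) (localProx d R (u y)) h α β B (u y)
      (answer y) n) := by
  have hpr : ProperSpace (E →L[ℝ] ℝ) := FiniteDimensional.proper ℝ _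
  have hpr' : ProperSpace E := FiniteDimensional.proper ℝ _
  have huE : Measurable fun y => (u y : E) := measurable_subtype_coe.comp hu
  have hzm : ∀ n, (Measurable fun y => slope (localSet Q R (u y)) (localProx d R (u y)) h α β B (u y)
      (answer y) n) → Measurable fun y => (sigm (localSet Q R (u y)) (localProx d R (u y)) h α β B
      (u y) (answer y) n).z := fun n hsl => by
    have h1 := (measurable_argminOn hR hQ hh hlsc hd (hs.beta_pos n) (hs.partialSum_pos n)).comp
      (hu.prodMk hsl)
    simp only [sigm_z_eq]
    exact h1
  induction n with
  | zero =>
    have h0 : Measurable fun y => slope (localSet Q R (u y)) (localProx d R (u y)) h α β B (u y)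
        (answer y) 0 := by
      have : ∀ y, slope (localSet Q R (u y)) (localProx d R (u y)) h α β B (u y) (answer y) 0
          = α 0 • answer y 0 (u y) := fun y => by simp [slope, sigm]
      simp only [this]
      exact ((ha 0).comp (measurable_id.prodMk huE)).const_smul (α 0)
    refine ⟨huE, hzm 0 h0, ?_, h0⟩
    simp only [sigm_y_zero]
    exact hzm 0 h0
  | succ n ih =>
    obtain ⟨-, hz, hy, hsl⟩ := ih
    have hx : Measurable fun y => (sigm (localSet Q R (u y)) (localProx d R (u y)) h α β B (u y)
        (answer y) (n + 1)).x := by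
      simp only [sigm_x_succ]
      exact (hz.const_smul _).add (hy.const_smul _)
    have hans : Measurable fun y => answer y (n + 1) (sigm (localSet Q R (u y)) (localProx d R (u y)) h
        α β B (u y) (answer y) (n + 1)).x := (ha (n + 1)).comp (measurable_id.prodMk hx)
    have hsl' : Measurable fun y => slope (localSet Q R (u y)) (localProx d R (u y)) h α β B (u y)
        (answer y) (n + 1) := by
      have : ∀ y, slope (localSet Q R (u y)) (localProx d R (u y)) h α β B (u y) (answer y) (n + 1)
          = slope (localSet Q R (u y)) (localProx d R (u y)) h α β B (u y) (answer y) n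
            + α (n + 1) • answer y (n + 1) (sigm (localSet Q R (u y)) (localProx d R (u y)) h
              α β B (u y) (answer y) (n + 1)).x := fun y => Finset.sum_range_succ _ _
      simp only [this]
      exact hsl.add (hans.const_smul (α (n + 1)))
    refine ⟨hx, hzm _ hsl', ?_, hsl'⟩
    have haux : Measurable fun y => auxPoint (localSet Q R (u y)) (localProx d R (u y)) h α β B (u y)
        (answer y) n := by
      have hfd : ∀ y, fderiv ℝ (localProx d R (u y)) (sigm (localSet Q R (u y)) (localProx d R (u y)) h
          α β B (u y) (answer y) n).z = R⁻¹ • fderiv ℝ d (R⁻¹ • ((sigm (localSet Q R (u y))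
            (localProx d R (u y)) h α β B (u y) (answer y) n).z - u y)) := fun y =>
        (hasFDerivAt_localProx hR hd (sigm_z_spec (answer y)
          (isProxSetup_local hR hQ hh hlsc hd (u y).2) hs n).1).fderiv
      have hfm : Measurable fun y => R⁻¹ • fderiv ℝ d (R⁻¹ • ((sigm (localSet Q R (u y))
            (localProx d R (u y)) h α β B (u y) (answer y) n).z - u y)) :=
        ((measurable_fderiv ℝ d).comp ((hz.sub huE).const_smul R⁻¹)).const_smul R⁻¹
      have h1 := (measurable_argminOn hR hQ hh hlsc hd (hs.beta_pos n) (hs.alpha_pos (n + 1))).comp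
        (hu.prodMk ((hans.const_smul (α (n + 1))).sub (hfm.const_smul (β n))))
      simp only [auxPoint_eq, hfd]
      exact h1
    simp only [sigm_y_succ]
    exact (hy.const_smul _).add (((haux.const_smul _).add (hy.const_smul _)).const_smul _)

end MeasurableMethod

/-! ### One stage: residual bound outside a small event -/

section Stage

variable {E : Type*} [NormedAddCommGroup E] [InnerProductSpace ℝ E]

theorem batchMean_sub {Ξ : Type*} (G : E → Ξ → (E →L[ℝ] ℝ)) (gd : E → (E →L[ℝ] ℝ)) {m : ℕ}
    (hm : 0 < m) (b : ℕ → Ξ) (x : E) :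
    batchMean (fun x s => G x s - gd x) m b x = batchMean G m b x - gd x := by
  have hm0 : (m : ℝ) ≠ 0 := by exact_mod_cast hm.ne'
  simp only [batchMean, Finset.sum_sub_distrib, Finset.sum_const, Finset.card_range, smul_sub]
  rw [← Nat.cast_smul_eq_nsmul ℝ, smul_smul, inv_mul_cancel₀ hm0, one_smul]

theorem sigm_update {Ξ : Type*} (S : Set E) (D h : E → ℝ) (α β B : ℕ → ℝ) (x0 : E)
    (G : E → Ξ → (E →L[ℝ] ℝ)) (m : ℕ) (s : ℕ → ℕ → Ξ) {i j : ℕ} (hij : i < j) (b : ℕ → Ξ) :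
    sigm S D h α β B x0 (fun i x => batchMean G m (Function.update s j b i) x) i
      = sigm S D h α β B x0 (fun i x => batchMean G m (s i) x) i := by
  symm
  refine sigm_congr i fun l hl => ?_
  simp only [Function.update_of_ne (hl.trans_lt hij).ne]

/-- The query point of iteration i is computed before batch i is used, so it depends on earlier
batches only. -/
theorem isPredictable_sigm_x {Ξ : Type*} (S : Set E) (D h : E → ℝ) (α β B : ℕ → ℝ) (x0 : E)
    (G : E → Ξ → (E →L[ℝ] ℝ)) (m : ℕ) :
    IsPredictable fun i (s : ℕ → ℕ → Ξ) =>
      (sigm S D h α β B x0 (fun i x => batchMean G m (s i) x) i).x := by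
  intro i j hij s b
  cases i with
  | zero => rfl
  | succ i => simp only [sigm_x_succ, sigm_update S D h α β B x0 G m s hij b]

theorem isPredictable_prevZ {Ξ : Type*} (S : Set E) (D h : E → ℝ) (α β B : ℕ → ℝ) (x0 : E)
    (G : E → Ξ → (E →L[ℝ] ℝ)) (m : ℕ) :
    IsPredictable fun i (s : ℕ → ℕ → Ξ) =>
      prevZ S D h α β B x0 (fun i x => batchMean G m (s i) x) i := by
  intro i j hij s b
  cases i with
  | zero => rfl
  | succ i => simp only [prevZ, sigm_update S D h α β B x0 G m s hij b]

/-- The bound for the residual after a run of `n` iterations, with noise level `σ` and confidence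
parameter `t`. -/
def stageBound (p L δ σ V R t : ℝ) (n : ℕ) : ℝ :=
  C₁ * (L * R ^ 2 * V ^ 2) / (n : ℝ) ^ p + C₂ * (1 + t) * (σ * V) / √n
    + 2 * C₄ * √t * σ / √n + C₃ * (n : ℝ) ^ (p - 1) * δ

/-- The 5 comes from the noise part of β, the 16 from the squared noise and the 8 from the
martingale. `C₂` ≥ 21 covers the first two, and 2`C₄` ≥ 8 the third. -/
theorem noise_constants_le {x t : ℝ} {y : ℝ} (hx : 0 ≤ x) (hy : 0 ≤ y) (ht : 0 ≤ t) :
    5 * x + 16 * (1 + t) * x + 8 * √t * y ≤ C₂ * (1 + t) * x + 2 * C₄ * √t * y := by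
  have h2 : (21 : ℝ) ≤ C₂ := by
    have : (21 / 16 : ℝ) ≤ √2 := Real.le_sqrt_of_sq_le (by norm_num)
    unfold C₂; linarith
  have h4 : (4 : ℝ) ≤ C₄ := by
    have : (1 : ℝ) ≤ √3 := Real.le_sqrt_of_sq_le (by norm_num)
    unfold C₄; linarith
  have h5 : 0 ≤ √t * y := by positivity
  have h6 : 0 ≤ t * x := by positivity
  nlinarith [mul_le_mul_of_nonneg_right h2 (show 0 ≤ (1 + t) * x by positivity),
    mul_le_mul_of_nonneg_right h4 h5]

/-- The residual bound in the good event. The noise level of the method is `σ / √m`, for the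
scaled norm `σ R / √m`. -/
theorem residual_le_stageBound {p L δ σ V R t m wsum W M r : ℝ} {n : ℕ} (hp : 1 ≤ p) (hp2 : p ≤ 2)
    (hL : 0 < L) (hδ : 0 ≤ δ) (hσ : 0 < σ) (hV : 0 < V) (hR : 0 < R) (ht : 0 < t) (hm : 0 < m)
    (hn : 1 ≤ n)
    (hw : wsum = ∑ i ∈ Finset.range (n + 1),
      seqAlpha p i ^ 2 / (2 * (seqKappa p (σ * R / √m) V i * (R ^ 2)⁻¹)))
    (hW : W ≤ 8 * σ ^ 2 / m * (1 + t) * wsum)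
    (hM : M ≤ 2 * √t * (2 * R * σ / √m * √(∑ i ∈ Finset.range (n + 1), seqAlpha p i ^ 2)))
    (hr : partialSum (seqAlpha p) n * r ≤ seqBeta p (L * R ^ 2) (σ * R / √m) V n * (V ^ 2 / 2)
      + δ * ∑ i ∈ Finset.range (n + 1), seqB p i + W + M) :
    r ≤ stageBound p L δ (σ * R / √m) V R t n := by
  have hn0 : (0 : ℝ) < n := by exact_mod_cast hn
  have hsm : 0 < √m := Real.sqrt_pos.2 hm
  have hsm2 : √m ^ 2 = m := Real.sq_sqrt hm.le
  have hsn : 0 < √(n : ℝ) := Real.sqrt_pos.2 hn0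
  set s := σ * R / √m with hs
  have hs0 : 0 < s := by positivity
  set A := partialSum (seqAlpha p) n with hA
  have hA0 : 0 < A := by
    have := ratio_mul_seqAlpha_le hp n
    have := seqAlpha_pos hp n
    have := one_le_ratio hp n
    exact lt_of_lt_of_le (by positivity) (ratio_mul_seqAlpha_le hp n)
  have hb := coefB_pos hp
  -- the oracle constant
  have h1 : L * R ^ 2 * V ^ 2 / 2 ≤ A * (C₁ * (L * R ^ 2 * V ^ 2) / (n : ℝ) ^ p) := by
    have := rpow_le_two_mul_partialSum hp hp2 n
    have hnp : 0 < (n : ℝ) ^ p := by positivity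
    rw [← mul_div_assoc A, le_div_iff₀ hnp]
    have h0 : 0 ≤ L * R ^ 2 * V ^ 2 / 2 := by positivity
    nlinarith [mul_le_mul_of_nonneg_left this h0]
  -- the noise part of `β`
  have h2 : coefB p * s / V * (n + p + 1) ^ ((2 * p - 1) / 2) * (V ^ 2 / 2)
      ≤ A * (5 * (s * V) / √n) := by
    have := coefB_mul_rpow_mul_sqrt_le hp hp2 n hn
    rw [← mul_div_assoc A, le_div_iff₀ hsn]
    have h0 : 0 ≤ s * V / 2 := by positivity
    have h3 := mul_le_mul_of_nonneg_left this h0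
    have e : coefB p * s / V * (n + p + 1) ^ ((2 * p - 1) / 2) * (V ^ 2 / 2) * √n
        = s * V / 2 * (coefB p * (n + p + 1) ^ ((2 * p - 1) / 2) * √n) := by field_simp
    rw [e]
    linarith
  -- the quadratic noise term
  have h3 : W ≤ A * (16 * (1 + t) * (s * V) / √n) := by
    refine hW.trans ?_
    have h := sum_sq_div_mul_sqrt_le hp hp2 n hn
    have e : wsum = V * R ^ 2 / s * ∑ i ∈ Finset.range (n + 1),
        seqAlpha p i ^ 2 / (2 * (coefB p * ((i : ℝ) + p) ^ ((2 * p - 1) / 2))) := by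
      rw [hw, Finset.mul_sum]
      refine Finset.sum_congr rfl fun i _ => ?_
      have : 0 < ((i : ℝ) + p) ^ ((2 * p - 1) / 2) := by
        have : (0 : ℝ) ≤ i := i.cast_nonneg
        positivity
      unfold seqKappa
      field_simp
    rw [e, ← mul_div_assoc A, le_div_iff₀ hsn]
    -- The batch size disappears into s, because s² = σ²R²/m.
    have e2 : 8 * σ ^ 2 / m * (V * R ^ 2 / s) = 8 * s * V := by
      have : σ ^ 2 * R ^ 2 = s ^ 2 * m := by
        rw [hs, div_pow, hsm2]; field_simp
      field_simp
      linarith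
    have h0 : 0 ≤ 8 * s * V * (1 + t) := by positivity
    have h4 := mul_le_mul_of_nonneg_left h h0
    rw [← e2] at h4
    rw [show A * (16 * (1 + t) * (s * V)) = 8 * s * V * (1 + t) * (2 * A) by ring, ← e2]
    refine le_trans (le_of_eq ?_) h4
    ring
  -- the martingale
  have h4 : M ≤ A * (8 * √t * s / √n) := by
    refine hM.trans ?_
    have h := mul_sum_sq_le hp hp2 n
    set S := ∑ i ∈ Finset.range (n + 1), seqAlpha p i ^ 2 with hS
    have h5 : √S * √n ≤ 2 * A := by
      have hS0 : 0 ≤ S := Finset.sum_nonneg fun i _ => sq_nonneg _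
      rw [← Real.sqrt_mul hS0]
      refine Real.sqrt_le_iff.2 ⟨by positivity, ?_⟩
      rw [hA]
      nlinarith
    rw [← mul_div_assoc A, le_div_iff₀ hsn]
    have h0 : 0 ≤ 4 * √t * s := by positivity
    have h6 := mul_le_mul_of_nonneg_left h5 h0
    refine le_trans (le_of_eq ?_) (h6.trans (le_of_eq (by ring)))
    rw [hs]; ring
  -- the bias
  have h5 : δ * ∑ i ∈ Finset.range (n + 1), seqB p i ≤ A * (C₃ * (n : ℝ) ^ (p - 1) * δ) := by
    have := mul_le_mul_of_nonneg_left (sum_seqB_le hp hp2 n hn) hδ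
    refine this.trans (le_of_eq (by ring))
  have hβ : seqBeta p (L * R ^ 2) s V n * (V ^ 2 / 2) = L * R ^ 2 * V ^ 2 / 2
      + coefB p * s / V * (n + p + 1) ^ ((2 * p - 1) / 2) * (V ^ 2 / 2) := by
    unfold seqBeta; ring
  rw [hβ] at hr
  have h6 : A * r ≤ A * (C₁ * (L * R ^ 2 * V ^ 2) / (n : ℝ) ^ p + 5 * (s * V) / √n
      + 16 * (1 + t) * (s * V) / √n + 8 * √t * s / √n + C₃ * (n : ℝ) ^ (p - 1) * δ) := by
    linarith
  refine (le_of_mul_le_mul_left h6 hA0).trans ?_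
  have h7 := noise_constants_le (x := s * V / √n) (y := s / √n) (t := t) (by positivity)
    (by positivity) ht.le
  unfold stageBound
  have e3 : ∀ a : ℝ, a * (s * V) / √n = a * (s * V / √n) := fun a => mul_div_assoc _ _ _
  have e4 : ∀ a : ℝ, a * s / √n = a * (s / √n) := fun a => mul_div_assoc _ _ _
  rw [e3, e3, e3, e4, e4]
  linarith

variable [FiniteDimensional ℝ E] [MeasurableSpace E] [BorelSpace E]
  {Ξ : Type*} [MeasurableSpace Ξ] {ν : Measure Ξ} [IsProbabilityMeasure ν]

/-- A run of the method from a point at distance at most `R` to the solution fails only in a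
measurable event whose probability is small uniformly in the starting point. -/
theorem exists_stage_bad {Q : Set E} {f h d : E → ℝ} {fd : E → ℝ} {gd : E → (E →L[ℝ] ℝ)}
    {G : E → Ξ → (E →L[ℝ] ℝ)} {p L δ σ V R t : ℝ} {m n : ℕ}
    (hp : 1 ≤ p) (hp2 : p ≤ 2) (hL : 0 < L) (hδ : 0 ≤ δ) (hσ : 0 < σ) (hV : 0 < V) (hR : 0 < R)
    (ht : 0 < t) (hm : 0 < m) (hn : 1 ≤ n)
    (hQ : IsClosed Q) (hf : ConvexOn ℝ Q f) (hh : ConvexOn ℝ Q h)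
    (hlsc : LowerSemicontinuousOn h Q) (hor : IsInexactOracle Q f L δ fd gd)
    (hG : Measurable (Function.uncurry G)) (hgd : Measurable gd)
    (hZ : ∀ x, IsLightTailed ν σ fun s => G x s - gd x)
    (hd : IsProxFunction d) (hdV : ∀ x, d x ≤ V ^ 2 / 2 * ‖x‖ ^ 2) {v : E} (hv : v ∈ Q) :
    ∃ Bad : Set (Q × (ℕ → ℕ → Ξ)), MeasurableSet Bad ∧
      (∀ u : Q, seqLaw (seqLaw ν) {s | (u, s) ∈ Bad} ≤ 2 * ENNReal.ofReal (Real.exp (-t))) ∧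
      ∀ (u : Q) (s : ℕ → ℕ → Ξ), ‖(u : E) - v‖ ≤ R → (u, s) ∉ Bad →
        ∀ y, y = (sigm (localSet Q R (u : E)) (localProx d R (u : E)) h (seqAlpha p)
          (seqBeta p (L * R ^ 2) (σ * R / √(m : ℝ)) V) (seqB p) (u : E)
          (fun i x => batchMean G m (s i) x) n).y →
        (f y + h y) - (f v + h v) ≤ stageBound p L δ (σ * R / √(m : ℝ)) V R t n := by
  have hpr : ProperSpace (E →L[ℝ] ℝ) := FiniteDimensional.proper ℝ _
  have hpr' : ProperSpace E := FiniteDimensional.proper ℝ _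
  have hm0 : (0 : ℝ) < m := by exact_mod_cast hm
  have hsm : 0 < √(m : ℝ) := Real.sqrt_pos.2 hm0
  set σ' := σ * R / √(m : ℝ) with hσ'
  have hσ'0 : 0 < σ' := by positivity
  have hs := isStepSequence (L := L) hp hp2 hL hσ'0 hV hR
  set Z : E → Ξ → (E →L[ℝ] ℝ) := fun x s => G x s - gd x with hZdef
  have hZm : Measurable (Function.uncurry Z) := hG.sub (hgd.comp measurable_fst)
  set X : Q → ℕ → (ℕ → ℕ → Ξ) → E := fun u i s => (sigm (localSet Q R (u : E))
    (localProx d R (u : E)) h (seqAlpha p) (seqBeta p (L * R ^ 2) σ' V) (seqB p) (u : E)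
      (fun i x => batchMean G m (s i) x) i).x with hX
  set pz : Q → ℕ → (ℕ → ℕ → Ξ) → E := fun u i s => prevZ (localSet Q R (u : E))
    (localProx d R (u : E)) h (seqAlpha p) (seqBeta p (L * R ^ 2) σ' V) (seqB p) (u : E)
      (fun i x => batchMean G m (s i) x) i with hpz
  have hans : ∀ i, Measurable fun q : (Q × (ℕ → ℕ → Ξ)) × E =>
      batchMean G m (q.1.2 i) q.2 := fun i =>
    measurable_batchMean hG m ((measurable_pi_apply i).comp (measurable_snd.comp measurable_fst))
      measurable_snd
  have hmeas := fun i => measurable_sigm (answer := fun (q : Q × (ℕ → ℕ → Ξ)) i x =>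
    batchMean G m (q.2 i) x) hR hQ hh hlsc hd hs measurable_fst hans i
  have hXm : ∀ i, Measurable fun q : Q × (ℕ → ℕ → Ξ) => X q.1 i q.2 := fun i => (hmeas i).1
  have hpm : ∀ i, Measurable fun q : Q × (ℕ → ℕ → Ξ) => pz q.1 i q.2 := fun i => by
    cases i with
    | zero => exact measurable_subtype_coe.comp measurable_fst
    | succ i => exact (hmeas i).2.1
  have hζm : ∀ i, Measurable fun q : Q × (ℕ → ℕ → Ξ) => batchMean Z m (q.2 i) (X q.1 i q.2) :=
    fun i => measurable_batchMean hZm m ((measurable_pi_apply i).comp measurable_snd) (hXm i)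
  set w : ℕ → ℝ := fun i => seqAlpha p i ^ 2 / (2 * (seqKappa p σ' V i * (R ^ 2)⁻¹)) with hw
  have hw0 : ∀ i, 0 < w i := fun i => by
    have := seqAlpha_pos hp i
    have := seqKappa_pos hp hσ'0 hV i
    simp only [hw]
    positivity
  set W : Q × (ℕ → ℕ → Ξ) → ℝ := fun q =>
    ∑ i ∈ Finset.range (n + 1), w i * ‖batchMean Z m (q.2 i) (X q.1 i q.2)‖ ^ 2 with hW
  set M : Q × (ℕ → ℕ → Ξ) → ℝ := fun q =>
    ∑ i ∈ Finset.range (n + 1), seqAlpha p i * batchMean Z m (q.2 i) (X q.1 i q.2) (v - pz q.1 i q.2)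
    with hM
  have hWm : Measurable W :=
    Finset.measurable_sum _ fun i _ => ((hζm i).norm.pow_const 2).const_mul _
  have hMm : Measurable M := by
    refine Finset.measurable_sum _ fun i _ => Measurable.const_mul ?_ _
    have h3 : Continuous fun q : (E →L[ℝ] ℝ) × E => q.1 q.2 := by fun_prop
    exact h3.measurable.comp ((hζm i).prodMk ((hpm i).const_sub v))
  set T1 := 8 * σ ^ 2 / m * (1 + t) * (∑ i ∈ Finset.range (n + 1), w i) with hT1
  set T2 := 2 * √t * (2 * R * σ / √(m : ℝ) * √(∑ i ∈ Finset.range (n + 1), seqAlpha p i ^ 2)) with hT2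
  -- The distance condition is built into the event: for starting points too far from v the slice is
  -- empty, so the probability bound is uniform in u.
  refine ⟨{q | ‖(q.1 : E) - v‖ ≤ R ∧ (T1 < W q ∨ T2 < M q)}, ?_, fun u => ?_, fun u s hu hbad y hy => ?_⟩
  · have h1 : Measurable fun q : Q × (ℕ → ℕ → Ξ) => ‖(q.1 : E) - v‖ :=
      ((measurable_subtype_coe.comp measurable_fst).sub_const v).norm
    exact (measurableSet_le h1 measurable_const).inter
      ((measurableSet_lt measurable_const hWm).union (measurableSet_lt measurable_const hMm))
  · by_cases hu : ‖(u : E) - v‖ ≤ R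
    · have hP := isProxSetup_local hR hQ hh hlsc hd u.2
      have hvS : v ∈ localSet Q R (u : E) := (mem_localSet hR).2 ⟨hv, by rwa [norm_sub_rev]⟩
      refine le_trans (measure_mono fun s hs' => ?_) (seqLaw_noise_le hZm hZ hσ hm
        (X := X u) (p := pz u) (v := v) (D := 2 * R) (a := seqAlpha p) (w := w)
        (fun i => (hXm i).comp measurable_prodMk_left) (isPredictable_sigm_x _ _ _ _ _ _ _ _ _)
        (fun i => (hpm i).comp measurable_prodMk_left) (isPredictable_prevZ _ _ _ _ _ _ _ _ _)
        (by positivity) (fun i s => ?_) (seqAlpha_pos hp) hw0 n ht)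
      · exact hs'.2
      -- Both v and z_{i-1} lie in the ball of radius R about u, hence the bound 2R on the
      -- martingale directions.
      · have hz := ((mem_localSet hR).1 (prevZ_mem (fun i x => batchMean G m (s i) x) hP hs i)).2
        have hv' := ((mem_localSet hR).1 hvS).2
        calc ‖v - pz u i s‖ = ‖(v - u) - (pz u i s - u)‖ := by congr 1; abel
          _ ≤ ‖v - u‖ + ‖pz u i s - u‖ := norm_sub_le _ _
          _ ≤ 2 * R := by linarith
    · have : {s : ℕ → ℕ → Ξ | (u, s) ∈ {q : Q × (ℕ → ℕ → Ξ) | ‖(q.1 : E) - v‖ ≤ R ∧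
          (T1 < W q ∨ T2 < M q)}} = ∅ := by
        ext s
        simp only [Set.mem_ofPred_eq, Set.mem_empty_iff_false, iff_false]
        exact fun hc => hu hc.1
      rw [this, measure_empty]
      exact zero_le
  · have hP := isProxSetup_local hR hQ hh hlsc hd u.2
    have hvS : v ∈ localSet Q R (u : E) := (mem_localSet hR).2 ⟨hv, by rwa [norm_sub_rev]⟩
    simp only [Set.mem_ofPred_eq, not_and, not_or, not_lt] at hbad
    obtain ⟨hb1, hb2⟩ := hbad hu
    have hres := partialSum_mul_residual_le (fun i x => batchMean G m (s i) x) hP hs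
      (inv_pos.2 (pow_pos hR 2)) hδ (fun x hx => hx.1) hf hor n hvS
    have hζ : ∀ i, stepNoise (localSet Q R (u : E)) (localProx d R (u : E)) h (seqAlpha p)
        (seqBeta p (L * R ^ 2) σ' V) (seqB p) (u : E) (fun i x => batchMean G m (s i) x) gd i
        = batchMean Z m (s i) (X u i s) := fun i => (batchMean_sub G gd hm _ _).symm
    simp only [hζ] at hres
    rw [← hy] at hres
    have hDv : localProx d R (u : E) v ≤ V ^ 2 / 2 := by
      refine (hdV _).trans ?_
      have h1 := mem_closedBall_zero_iff.1 (inv_smul_sub_mem_ball hR hvS)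
      have h2 : ‖R⁻¹ • (v - (u : E))‖ ^ 2 ≤ 1 := pow_le_one₀ (norm_nonneg _) h1
      exact mul_le_of_le_one_right (by positivity) h2
    have hβD := mul_le_mul_of_nonneg_left hDv (hs.beta_pos n).le
    have hWeq : ∑ i ∈ Finset.range (n + 1), seqAlpha p i ^ 2 * ‖batchMean Z m (s i) (X u i s)‖ ^ 2
        / (2 * (seqKappa p σ' V i * (R ^ 2)⁻¹)) = W (u, s) := by
      refine Finset.sum_congr rfl fun i _ => ?_
      simp only [hw]
      ring
    rw [hWeq] at hres
    refine residual_le_stageBound (W := W (u, s)) (M := M (u, s)) hp hp2 hL hδ hσ hV hR ht hm0 hn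
      rfl hb1 hb2 ?_
    refine hres.trans ?_
    simp only [hM, hpz]
    linarith

end Stage

/-! ### Radii, batch sizes and complexity -/

section Parameters

/-- The ranges of the parameters. -/
structure Params.IsAdmissible (q : Params) : Prop where
  L_pos : 0 < q.L
  delta_nonneg : 0 ≤ q.δ
  sigma_pos : 0 < q.σ
  mu_pos : 0 < q.μ
  V_pos : 0 < q.V
  R0_pos : 0 < q.R0
  one_le_p : 1 ≤ q.p
  p_le_two : q.p ≤ 2
  conf_pos : 0 < q.Λ
  conf_le_one : q.Λ ≤ 1
  bias : q.p = 1 ∨ q.δ = 0 ∨ 1 ≤ q.X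

variable {q : Params}

theorem C₁_pos : 0 < C₁ := by unfold C₁; positivity
theorem C₂_pos : 0 < C₂ := by unfold C₂; positivity
theorem C₃_pos : 0 < C₃ := by unfold C₃; positivity
theorem C₄_pos : 0 < C₄ := by unfold C₄; positivity

theorem exp_one_sub_one_pos : 0 < Real.exp 1 - 1 := by
  have := Real.add_one_le_exp (1 : ℝ)
  linarith

namespace Params.IsAdmissible

theorem X_pos (hq : q.IsAdmissible) : 0 < q.X := by
  have := C₁_pos
  have := hq.L_pos
  have := hq.V_pos
  have := hq.mu_pos
  unfold Params.X
  positivity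

/-- The contribution of the bias to the radii in the limit. -/
def _root_.Sigma2.Params.biasRadius (q : Params) : ℝ :=
  2 ^ q.p * Real.exp 1 * C₃ * q.δ / (q.μ * (Real.exp 1 - 1)) * q.X ^ ((q.p - 1) / q.p)

theorem biasRadius_nonneg (hq : q.IsAdmissible) : 0 ≤ q.biasRadius := by
  have := C₃_pos
  have := hq.X_pos
  have := hq.mu_pos
  have := hq.delta_nonneg
  have := exp_one_sub_one_pos
  unfold Params.biasRadius
  positivity

theorem exp_neg_le_one (k : ℕ) : Real.exp (-(k : ℝ)) ≤ 1 :=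
  Real.exp_le_one_iff.2 (neg_nonpos.2 k.cast_nonneg)

theorem radius_sq (hq : q.IsAdmissible) (k : ℕ) :
    q.radius k ^ 2 = q.R0 ^ 2 * Real.exp (-k) + q.biasRadius * (1 - Real.exp (-k)) := by
  have h1 := mul_nonneg hq.biasRadius_nonneg (sub_nonneg.2 (exp_neg_le_one k))
  have h2 : 0 ≤ q.R0 ^ 2 * Real.exp (-k) := by positivity
  exact Real.sq_sqrt (add_nonneg h2 h1)

theorem le_radius_sq (hq : q.IsAdmissible) (k : ℕ) :
    q.R0 ^ 2 * Real.exp (-k) ≤ q.radius k ^ 2 := by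
  rw [hq.radius_sq]
  linarith [mul_nonneg hq.biasRadius_nonneg (sub_nonneg.2 (exp_neg_le_one k))]

theorem radius_pos (hq : q.IsAdmissible) (k : ℕ) : 0 < q.radius k := by
  have h := hq.R0_pos
  have h1 := lt_of_lt_of_le (show 0 < q.R0 ^ 2 * Real.exp (-k) by positivity) (hq.le_radius_sq k)
  exact lt_of_le_of_ne (Real.sqrt_nonneg _) fun h0 => by rw [← h0] at h1; norm_num at h1

theorem radius_zero (hq : q.IsAdmissible) : q.radius 0 = q.R0 := by
  have h := hq.radius_sq 0
  simp only [Nat.cast_zero, neg_zero, Real.exp_zero, mul_one, sub_self, mul_zero, add_zero] at h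
  exact (pow_left_inj₀ (hq.radius_pos 0).le hq.R0_pos.le two_ne_zero).1 h

theorem mu_mul_biasRadius (hq : q.IsAdmissible) :
    q.μ / 2 * q.biasRadius * (Real.exp 1 - 1)
      = 2 ^ (q.p - 1) * C₃ * q.X ^ ((q.p - 1) / q.p) * q.δ * Real.exp 1 := by
  have h1 := exp_one_sub_one_pos
  have h2 := hq.mu_pos
  have h3 : (2 : ℝ) ^ q.p = 2 ^ (q.p - 1) * 2 := by
    rw [Real.rpow_sub_one (by norm_num)]; norm_num
  unfold Params.biasRadius
  rw [h3]
  field_simp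

/-- The closed form of R_k² solves an affine recursion with factor 1/e and fixed point `biasRadius`.
The right side is what the residual bound of a stage has to meet. -/
theorem radius_succ (hq : q.IsAdmissible) (k : ℕ) :
    q.μ / 2 * q.radius (k + 1) ^ 2 = q.μ * q.radius k ^ 2 / (2 * Real.exp 1)
      + C₃ * (2 ^ (q.p - 1) * q.X ^ ((q.p - 1) / q.p)) * q.δ := by
  have he := Real.exp_pos 1
  have h := hq.mu_mul_biasRadius
  have e : Real.exp (-((k + 1 : ℕ) : ℝ)) = Real.exp (-(k : ℝ)) / Real.exp 1 := by
    rw [← Real.exp_sub]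
    congr 1
    push_cast
    ring
  have h2 : C₃ * (2 ^ (q.p - 1) * q.X ^ ((q.p - 1) / q.p)) * q.δ
      = q.μ / 2 * q.biasRadius * (Real.exp 1 - 1) / Real.exp 1 := by
    rw [h]; field_simp
  rw [h2, hq.radius_sq, hq.radius_sq, e]
  field_simp
  ring

theorem mu_mul_radius_sq_le_errorBound (hq : q.IsAdmissible) (N : ℕ) :
    q.μ / 2 * q.radius N ^ 2 ≤ q.errorBound N := by
  have h1 := exp_one_sub_one_pos
  have h2 : 2 ^ (q.p - 1) * Real.exp 1 * C₃ / (Real.exp 1 - 1) * q.X ^ ((q.p - 1) / q.p) * q.δ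
      = q.μ / 2 * q.biasRadius := by
    have h := hq.mu_mul_biasRadius
    rw [← eq_div_iff h1.ne'] at h
    rw [h]
    ring
  rw [Params.errorBound, h2, hq.radius_sq]
  have h3 := mul_nonneg (mul_nonneg (half_pos hq.mu_pos).le hq.biasRadius_nonneg)
    (Real.exp_pos (-(N : ℝ))).le
  linarith

theorem inner_pos (hq : q.IsAdmissible) : 1 ≤ q.inner :=
  Nat.one_le_ceil_iff.2 (Real.rpow_pos_of_pos hq.X_pos _)

theorem X_le_inner_rpow (hq : q.IsAdmissible) : q.X ≤ (q.inner : ℝ) ^ q.p := by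
  have hp : 0 < q.p := by linarith [hq.one_le_p]
  calc q.X = (q.X ^ (1 / q.p)) ^ q.p := by
        rw [← Real.rpow_mul hq.X_pos.le, one_div_mul_cancel hp.ne', Real.rpow_one]
    _ ≤ _ := Real.rpow_le_rpow (Real.rpow_nonneg hq.X_pos.le _) (Nat.le_ceil _) hp.le

/-- Rounding X^{1/p} up at most doubles it once X ≥ 1. For p = 1 or δ = 0 rounding does not matter.
-/
theorem inner_rpow_mul_le (hq : q.IsAdmissible) :
    (q.inner : ℝ) ^ (q.p - 1) * q.δ ≤ 2 ^ (q.p - 1) * q.X ^ ((q.p - 1) / q.p) * q.δ := by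
  rcases hq.bias with h | h | h
  · simp [h]
  · simp [h]
  · have hp : 0 < q.p := by linarith [hq.one_le_p]
    refine mul_le_mul_of_nonneg_right ?_ hq.delta_nonneg
    have h1 : 1 ≤ q.X ^ (1 / q.p) := Real.one_le_rpow h (by positivity)
    have h2 : (q.inner : ℝ) ≤ 2 * q.X ^ (1 / q.p) := by
      have : (q.inner : ℝ) < q.X ^ (1 / q.p) + 1 := Nat.ceil_lt_add_one (by linarith)
      linarith
    calc (q.inner : ℝ) ^ (q.p - 1) ≤ (2 * q.X ^ (1 / q.p)) ^ (q.p - 1) :=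
          Real.rpow_le_rpow (Nat.cast_nonneg _) h2 (by linarith [hq.one_le_p])
      _ = 2 ^ (q.p - 1) * q.X ^ ((q.p - 1) / q.p) := by
          rw [Real.mul_rpow (by norm_num) (by linarith), ← Real.rpow_mul hq.X_pos.le]
          congr 2
          ring

theorem batch_pos (q : Params) (N k : ℕ) : 0 < q.batch N k :=
  lt_of_lt_of_le one_pos (le_max_left _ _)

/-- Square-root form of a lower bound for the batch size. The factor e^{k+2} compensates R_0²e^{-k}
≤ R_k² and leaves e². -/
theorem exp_mul_le_sqrt_mul (hq : q.IsAdmissible) {c m n : ℝ} (hm : 0 < m) (hn : 0 < n)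
    (k : ℕ) (h : Real.exp (k + 2) * c ^ 2 / (q.μ ^ 2 * q.R0 ^ 2 * n) ≤ m) :
    c * Real.exp 1 ≤ √m * √n * (q.μ * q.radius k) := by
  have hμ := hq.mu_pos
  have hR := hq.radius_pos k
  have hR0 := hq.R0_pos
  rw [div_le_iff₀ (by positivity)] at h
  rw [← Real.sqrt_mul hm.le]
  refine abs_le_of_sq_le_sq' ?_ (by positivity) |>.2
  rw [mul_pow, mul_pow, Real.sq_sqrt (by positivity), mul_pow]
  have e1 : Real.exp (k + 2) * Real.exp (-(k : ℝ)) = Real.exp 1 ^ 2 := by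
    rw [← Real.exp_add, ← Real.exp_nat_mul]
    congr 1
    push_cast
    ring
  have h1 := mul_le_mul_of_nonneg_right h (Real.exp_pos (-(k : ℝ))).le
  have h2 := mul_le_mul_of_nonneg_left (hq.le_radius_sq k) (show 0 ≤ m * n * q.μ ^ 2 by positivity)
  calc c ^ 2 * Real.exp 1 ^ 2 = Real.exp (k + 2) * c ^ 2 * Real.exp (-(k : ℝ)) := by rw [← e1]; ring
    _ ≤ m * n * q.μ ^ 2 * (q.R0 ^ 2 * Real.exp (-(k : ℝ))) := by linarith
    _ ≤ _ := by linarith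

/-- The confidence parameter of a stage, when `N` stages are planned. -/
def _root_.Sigma2.Params.conf (q : Params) (N : ℕ) : ℝ := Real.log (3 * N / q.Λ)

theorem confidence_pos (hq : q.IsAdmissible) {N : ℕ} (hN : 1 ≤ N) : 0 < q.conf N := by
  refine Real.log_pos ?_
  rw [lt_div_iff₀ hq.conf_pos]
  have : (1 : ℝ) ≤ N := by exact_mod_cast hN
  linarith [hq.conf_le_one]

/-- The choice of the numbers of iterations and of the batch sizes makes the residual contract. -/
theorem stageBound_le (hq : q.IsAdmissible) {N : ℕ} (hN : 1 ≤ N) (k : ℕ) :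
    stageBound q.p q.L q.δ (q.σ * q.radius k / √(q.batch N k : ℝ)) q.V (q.radius k) (q.conf N) q.inner
      ≤ q.μ / 2 * q.radius (k + 1) ^ 2 := by
  have hμ := hq.mu_pos
  have hR := hq.radius_pos k
  have hL := hq.L_pos
  have hσ := hq.sigma_pos
  have hV := hq.V_pos
  have he := Real.exp_pos 1
  have hc1 := C₁_pos
  have hc2 := C₂_pos
  have hc3 := C₃_pos
  have hc4 := C₄_pos
  have ht := hq.confidence_pos hN
  have hm : (0 : ℝ) < q.batch N k := by exact_mod_cast batch_pos q N k
  have hn : (0 : ℝ) < q.inner := by exact_mod_cast hq.inner_pos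
  set R := q.radius k with hRdef
  set t := q.conf N with htdef
  have hsm := Real.sqrt_pos.2 hm
  have hsn := Real.sqrt_pos.2 hn
  have hb1 : 36 * Real.exp (k + 2) * C₂ ^ 2 * q.σ ^ 2 * q.V ^ 2 * (1 + t) ^ 2
      / (q.μ ^ 2 * q.R0 ^ 2 * q.inner) ≤ q.batch N k := by
    refine (Nat.le_ceil _).trans ?_
    exact Nat.cast_le.2 ((le_max_left _ _).trans (le_max_right 1 _))
  have hb2 : 144 * Real.exp (k + 2) * C₄ ^ 2 * q.σ ^ 2 * t
      / (q.μ ^ 2 * q.R0 ^ 2 * q.inner) ≤ q.batch N k := by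
    refine (Nat.le_ceil _).trans ?_
    exact Nat.cast_le.2 ((le_max_right _ _).trans (le_max_right 1 _))
  have h1 : C₁ * (q.L * R ^ 2 * q.V ^ 2) / (q.inner : ℝ) ^ q.p ≤ q.μ * R ^ 2 / (6 * Real.exp 1) := by
    have hX := hq.X_le_inner_rpow
    have hX0 := hq.X_pos
    rw [div_le_div_iff₀ (hX0.trans_le hX) (by positivity)]
    have : q.X * q.μ = 6 * Real.exp 1 * C₁ * q.L * q.V ^ 2 := by
      unfold Params.X; field_simp
    calc C₁ * (q.L * R ^ 2 * q.V ^ 2) * (6 * Real.exp 1) = q.μ * R ^ 2 * q.X := by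
          linear_combination (-R ^ 2) * this
      _ ≤ _ := by gcongr
  have h2 : C₂ * (1 + t) * (q.σ * R / √(q.batch N k : ℝ) * q.V) / √(q.inner : ℝ)
      ≤ q.μ * R ^ 2 / (6 * Real.exp 1) := by
    -- The 6 is the denominator of the share μR²/(6e), and 36 in the batch size is its square. The
    -- factor 2 before `C₄` makes this 12 and 144 in the next term.
    have h := hq.exp_mul_le_sqrt_mul (c := 6 * (C₂ * (1 + t) * q.σ * q.V)) hm hn k
      (le_trans (le_of_eq (by ring)) hb1)
    have e : C₂ * (1 + t) * (q.σ * R / √(q.batch N k : ℝ) * q.V) / √(q.inner : ℝ)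
        = C₂ * (1 + t) * q.σ * q.V * R / (√(q.batch N k : ℝ) * √(q.inner : ℝ)) := by field_simp
    rw [e, div_le_div_iff₀ (by positivity) (by positivity)]
    have := mul_le_mul_of_nonneg_right h hR.le
    linarith
  have h3 : 2 * C₄ * √t * (q.σ * R / √(q.batch N k : ℝ)) / √(q.inner : ℝ)
      ≤ q.μ * R ^ 2 / (6 * Real.exp 1) := by
    have h := hq.exp_mul_le_sqrt_mul (c := 12 * (C₄ * √t * q.σ)) hm hn k
      (le_trans (le_of_eq (by
        rw [mul_pow, mul_pow, mul_pow, Real.sq_sqrt ht.le]; ring)) hb2)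
    have e : 2 * C₄ * √t * (q.σ * R / √(q.batch N k : ℝ)) / √(q.inner : ℝ)
        = 2 * (C₄ * √t * q.σ * R) / (√(q.batch N k : ℝ) * √(q.inner : ℝ)) := by field_simp
    rw [e, div_le_div_iff₀ (by positivity) (by positivity)]
    have := mul_le_mul_of_nonneg_right h hR.le
    linarith
  have h4 : C₃ * (q.inner : ℝ) ^ (q.p - 1) * q.δ
      ≤ C₃ * (2 ^ (q.p - 1) * q.X ^ ((q.p - 1) / q.p)) * q.δ := by
    have := mul_le_mul_of_nonneg_left hq.inner_rpow_mul_le hc3.le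
    linarith
  rw [hq.radius_succ, stageBound]
  have e : q.μ * R ^ 2 / (2 * Real.exp 1) = q.μ * R ^ 2 / (6 * Real.exp 1)
      + q.μ * R ^ 2 / (6 * Real.exp 1) + q.μ * R ^ 2 / (6 * Real.exp 1) := by field_simp; ring
  rw [e]
  linarith

theorem errorBound_le (hq : q.IsAdmissible) {ε : ℝ} (hε : 0 < ε)
    (hδε : q.δ ≤ ε * (Real.exp 1 - 1) / (2 ^ q.p * C₃ * Real.exp 1) * q.X ^ ((1 - q.p) / q.p)) {N : ℕ}
    (hN : Real.log (q.μ * q.R0 ^ 2 / ε) ≤ N) : q.errorBound N ≤ ε := by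
  have hμ := hq.mu_pos
  have hR0 := hq.R0_pos
  have hX := hq.X_pos
  have hc3 := C₃_pos
  have he1 := exp_one_sub_one_pos
  have h1 : q.μ * q.R0 ^ 2 / 2 * Real.exp (-N) ≤ ε / 2 := by
    have hpos : 0 < q.μ * q.R0 ^ 2 / ε := by positivity
    have h2 := Real.exp_le_exp.2 hN
    rw [Real.exp_log hpos, div_le_iff₀ hε] at h2
    rw [Real.exp_neg, ← div_eq_mul_inv, div_le_iff₀ (Real.exp_pos _)]
    linarith
  have h2 : 2 ^ (q.p - 1) * Real.exp 1 * C₃ / (Real.exp 1 - 1) * q.X ^ ((q.p - 1) / q.p) * q.δ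
      ≤ ε / 2 := by
    refine (mul_le_mul_of_nonneg_left hδε (by positivity)).trans (le_of_eq ?_)
    have e1 : q.X ^ ((q.p - 1) / q.p) * q.X ^ ((1 - q.p) / q.p) = 1 := by
      rw [← Real.rpow_add hX, ← add_div]
      simp
    have e2 : (2 : ℝ) ^ q.p = 2 ^ (q.p - 1) * 2 := by
      rw [Real.rpow_sub_one (by norm_num)]; norm_num
    rw [e2]
    calc _ = (q.X ^ ((q.p - 1) / q.p) * q.X ^ ((1 - q.p) / q.p)) * (ε / 2) := by field_simp
      _ = ε / 2 := by rw [e1, one_mul]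
  unfold Params.errorBound
  linarith

/-- The factor of the noise terms of all stages. -/
def _root_.Sigma2.Params.noiseFactor (q : Params) (N : ℕ) : ℝ :=
  (36 * C₂ ^ 2 * q.σ ^ 2 * q.V ^ 2 * (1 + q.conf N) ^ 2 + 144 * C₄ ^ 2 * q.σ ^ 2 * q.conf N)
    / (q.μ ^ 2 * q.R0 ^ 2)

theorem noiseFactor_nonneg (hq : q.IsAdmissible) {N : ℕ} (hN : 1 ≤ N) : 0 ≤ q.noiseFactor N := by
  have := hq.confidence_pos hN
  unfold Params.noiseFactor
  positivity

/-- The maximum of two rounded-up numbers exceeds the larger one by at most 1, so rounding costs one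
call, not two. -/
theorem batch_le (hq : q.IsAdmissible) {N : ℕ} (hN : 1 ≤ N) (k : ℕ) :
    (q.batch N k : ℝ) ≤ 1 + q.noiseFactor N * Real.exp (k + 2) / q.inner := by
  have ht := hq.confidence_pos hN
  have hμ := hq.mu_pos
  have hR0 := hq.R0_pos
  have hn : (0 : ℝ) < q.inner := by exact_mod_cast hq.inner_pos
  set a := 36 * Real.exp (k + 2) * C₂ ^ 2 * q.σ ^ 2 * q.V ^ 2 * (1 + q.conf N) ^ 2
      / (q.μ ^ 2 * q.R0 ^ 2 * q.inner) with ha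
  set b := 144 * Real.exp (k + 2) * C₄ ^ 2 * q.σ ^ 2 * q.conf N
      / (q.μ ^ 2 * q.R0 ^ 2 * q.inner) with hb
  have ha0 : 0 ≤ a := by positivity
  have hb0 : 0 ≤ b := by positivity
  have e : q.noiseFactor N * Real.exp (k + 2) / q.inner = a + b := by
    rw [ha, hb, Params.noiseFactor]; field_simp
  have hba : q.batch N k = max 1 (max ⌈a⌉₊ ⌈b⌉₊) := rfl
  rw [e, hba]
  push_cast
  refine max_le (by linarith) (max_le ?_ ?_)
  · linarith [Nat.ceil_lt_add_one ha0]
  · linarith [Nat.ceil_lt_add_one hb0]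

theorem sum_exp_le (N : ℕ) :
    ∑ k ∈ Finset.range N, Real.exp (k + 2) ≤ Real.exp (N + 2) / (Real.exp 1 - 1) := by
  have he1 := exp_one_sub_one_pos
  rw [le_div_iff₀ he1]
  have h : ∀ N : ℕ, (∑ k ∈ Finset.range N, Real.exp (k + 2)) * (Real.exp 1 - 1)
      = Real.exp (N + 2) - Real.exp 2 := fun N => by
    induction N with
    | zero => simp
    | succ N ih =>
      rw [Finset.sum_range_succ, add_mul, ih]
      have : Real.exp (((N + 1 : ℕ) : ℝ) + 2) = Real.exp (N + 2) * Real.exp 1 := by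
        rw [← Real.exp_add]; congr 1; push_cast; ring
      rw [this]; ring
  rw [h]
  linarith [Real.exp_pos 2]

/-- The upper bound for N turns e^{N+2} into at most e³μR_0²/ε, and one power of μ and R_0² cancel.
-/
theorem noiseFactor_mul_le (hq : q.IsAdmissible) {ε : ℝ} (hε : 0 < ε) {N : ℕ} (hN1 : 1 ≤ N)
    (hN : (N : ℝ) ≤ 1 + Real.log (q.μ * q.R0 ^ 2 / ε)) :
    q.noiseFactor N * (Real.exp (N + 2) / (Real.exp 1 - 1)) ≤ q.noiseTerm ε := by
  have hμ := hq.mu_pos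
  have hR0 := hq.R0_pos
  have he1 := exp_one_sub_one_pos
  have ht := hq.confidence_pos hN1
  have hΛ := hq.conf_pos
  have hN0 : (0 : ℝ) < N := by exact_mod_cast hN1
  set l := 1 + Real.log (q.μ * q.R0 ^ 2 / ε) with hl
  have hpos : 0 < q.μ * q.R0 ^ 2 / ε := by positivity
  have h1 : Real.exp (N + 2) ≤ Real.exp 3 * (q.μ * q.R0 ^ 2 / ε) := by
    rw [← Real.exp_log hpos, ← Real.exp_add]
    exact Real.exp_le_exp.2 (by linarith)
  have h2 : q.conf N ≤ Real.log (3 / q.Λ * l) := by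
    refine Real.log_le_log (by positivity) ?_
    rw [mul_div_right_comm]
    gcongr
  set c := Real.log (3 / q.Λ * l) with hc
  have h3 : q.noiseFactor N ≤ (36 * C₂ ^ 2 * q.σ ^ 2 * q.V ^ 2 * (1 + c) ^ 2
      + 144 * C₄ ^ 2 * q.σ ^ 2 * c) / (q.μ ^ 2 * q.R0 ^ 2) := by
    unfold Params.noiseFactor
    gcongr
  have h4 : Real.exp (N + 2) / (Real.exp 1 - 1)
      ≤ Real.exp 3 * (q.μ * q.R0 ^ 2 / ε) / (Real.exp 1 - 1) := by gcongr
  refine (mul_le_mul h3 h4 (by positivity) ?_).trans (le_of_eq ?_)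
  · exact (hq.noiseFactor_nonneg hN1).trans h3
  · unfold Params.noiseTerm
    rw [← hl, ← hc]
    field_simp

theorem sum_batch_le (hq : q.IsAdmissible) {ε : ℝ} (hε : 0 < ε) {N : ℕ} (hN1 : 1 ≤ N)
    (hN : (N : ℝ) ≤ 1 + Real.log (q.μ * q.R0 ^ 2 / ε)) :
    ∑ k ∈ Finset.range N, (q.batch N k : ℝ) ≤ N + q.noiseTerm ε / q.inner := by
  have hn : (0 : ℝ) < q.inner := by exact_mod_cast hq.inner_pos
  have h1 := Finset.sum_le_sum fun k (_ : k ∈ Finset.range N) => hq.batch_le hN1 k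
  refine h1.trans ?_
  rw [Finset.sum_add_distrib, ← Finset.sum_div, ← Finset.mul_sum]
  simp only [Finset.sum_const, Finset.card_range, nsmul_eq_mul, mul_one]
  have h2 := (mul_le_mul_of_nonneg_left (sum_exp_le N) (hq.noiseFactor_nonneg hN1)).trans
    (hq.noiseFactor_mul_le hε hN1 hN)
  gcongr

theorem innerCalls_le (hq : q.IsAdmissible) {ε : ℝ} (hε : 0 < ε) {N : ℕ} (hN1 : 1 ≤ N)
    (hN : (N : ℝ) ≤ 1 + Real.log (q.μ * q.R0 ^ 2 / ε)) :
    (q.innerCalls N : ℝ) ≤ q.iterTerm ε + q.noiseTerm ε := by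
  have hn : (0 : ℝ) < q.inner := by exact_mod_cast hq.inner_pos
  have hN0 : (0 : ℝ) < N := by exact_mod_cast hN1
  have hX := Real.rpow_nonneg hq.X_pos.le (1 / q.p)
  have hin : (q.inner : ℝ) ≤ 1 + q.X ^ (1 / q.p) := by
    have : (q.inner : ℝ) < q.X ^ (1 / q.p) + 1 := Nat.ceil_lt_add_one hX
    linarith
  rw [Params.innerCalls]
  push_cast
  rw [← Finset.mul_sum]
  calc _ ≤ (q.inner : ℝ) * (N + q.noiseTerm ε / q.inner) := by
        gcongr
        exact hq.sum_batch_le hε hN1 hN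
    _ = q.inner * N + q.noiseTerm ε := by field_simp
    _ ≤ _ := by
      unfold Params.iterTerm
      gcongr

theorem totalCalls_le (hq : q.IsAdmissible) {ε : ℝ} (hε : 0 < ε) {N : ℕ} (hN1 : 1 ≤ N)
    (hN : (N : ℝ) ≤ 1 + Real.log (q.μ * q.R0 ^ 2 / ε)) :
    (q.totalCalls N : ℝ) ≤
      q.iterTerm ε + (1 + Real.log (q.μ * q.R0 ^ 2 / ε)) + 2 * q.noiseTerm ε := by
  have hn : (1 : ℝ) ≤ q.inner := by exact_mod_cast hq.inner_pos
  have hnoise : 0 ≤ q.noiseTerm ε := le_trans (by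
    have := hq.noiseFactor_nonneg hN1
    have := exp_one_sub_one_pos
    positivity) (hq.noiseFactor_mul_le hε hN1 hN)
  have h1 := hq.innerCalls_le hε hN1 hN
  have h2 := hq.sum_batch_le hε hN1 hN
  -- The starting calls carry the noise term divided by N_k ≥ 1; estimating this by 1 is the source
  -- of the factor 2.
  have h3 : q.noiseTerm ε / q.inner ≤ q.noiseTerm ε := div_le_self hnoise hn
  have h4 : (q.totalCalls N : ℝ) = q.innerCalls N + ∑ k ∈ Finset.range N, (q.batch N k : ℝ) := by
    rw [Params.totalCalls, Params.innerCalls]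
    push_cast
    rw [← Finset.sum_add_distrib]
    exact Finset.sum_congr rfl fun k _ => by ring
  rw [h4]
  linarith

end Params.IsAdmissible

end Parameters

/-! ### The joint law of all samples -/

section SampleLaw

variable {Ξ : Type*} [MeasurableSpace Ξ] (ν : Measure Ξ) [IsProbabilityMeasure ν]
  {Ω : Type*} [MeasurableSpace Ω] (P : Measure Ω)

/-- The law of a triply indexed family of independent samples. -/
theorem map_samples_eq {ξ : ℕ × ℕ × ℕ → Ω → Ξ} (hm : ∀ i, Measurable (ξ i)) (hind : iIndepFun ξ P)
    (hlaw : ∀ i, P.map (ξ i) = ν) :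
    P.map (fun ω k i j => ξ (k, i, j) ω) = seqLaw (seqLaw (seqLaw ν)) := by
  have h1 : P.map (fun ω i => ξ i ω) = Measure.infinitePi fun _ : ℕ × ℕ × ℕ => ν := by
    rw [hind.map_fun_eq_infinitePi_map hm]
    simp_rw [hlaw]
  have h2 := Measure.infinitePi_map_curry (ι := ℕ) (κ := ℕ × ℕ) (fun _ _ => ν)
  have h3 := Measure.infinitePi_map_curry (ι := ℕ) (κ := ℕ) (fun _ _ => ν)
  have h4 := Measure.infinitePi_map_pi
    (μ := fun _ : ℕ => Measure.infinitePi fun _ : ℕ × ℕ => ν)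
    (f := fun _ : ℕ => MeasurableEquiv.curry ℕ ℕ Ξ) (fun _ => (MeasurableEquiv.curry ℕ ℕ Ξ).measurable)
  have hall : Measurable fun ω (i : ℕ × ℕ × ℕ) => ξ i ω := measurable_pi_lambda _ hm
  have h5 : (fun ω k i j => ξ (k, i, j) ω)
      = (fun (x : ℕ → ℕ × ℕ → Ξ) k => MeasurableEquiv.curry ℕ ℕ Ξ (x k))
        ∘ (MeasurableEquiv.curry ℕ (ℕ × ℕ) Ξ) ∘ (fun ω (i : ℕ × ℕ × ℕ) => ξ i ω) := rfl
  have hc : Measurable fun (x : ℕ → ℕ × ℕ → Ξ) k => MeasurableEquiv.curry ℕ ℕ Ξ (x k) :=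
    measurable_pi_lambda _ fun k => (MeasurableEquiv.curry ℕ ℕ Ξ).measurable.comp (measurable_pi_apply k)
  rw [h5, ← Measure.map_map hc ((MeasurableEquiv.curry ℕ (ℕ × ℕ) Ξ).measurable.comp hall),
    ← Measure.map_map (MeasurableEquiv.curry ℕ (ℕ × ℕ) Ξ).measurable hall, h1, h2, h4]
  simp_rw [h3]

end SampleLaw

/-! ### Extension of the oracle by zero outside Q -/

section GlobalOracle

variable {E : Type*} [NormedAddCommGroup E] [InnerProductSpace ℝ E] [FiniteDimensional ℝ E]
  [MeasurableSpace E] [BorelSpace E] {Ξ : Type*} [MeasurableSpace Ξ] {ν : Measure Ξ}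
  [IsProbabilityMeasure ν] {Q : Set E} {f : E → ℝ} {L δ σ : ℝ} {fd : E → ℝ}
  {gd : E → (E →L[ℝ] ℝ)} {F : E → Ξ → ℝ} {G : E → Ξ → (E →L[ℝ] ℝ)}

omit [FiniteDimensional ℝ E] [IsProbabilityMeasure ν] in
-- The oracle is only specified on Q. Extending it by zero makes measurability and light tails
-- available at every point of E.
theorem IsStochasticInexactOracle.measurable_indicator
    (ho : IsStochasticInexactOracle ν Q f L δ σ fd gd F G) (hQ : IsClosed Q) :
    Measurable (Function.uncurry (Q.indicator G)) := by
  have hS : MeasurableSet (Q ×ˢ (Set.univ : Set Ξ)) := hQ.measurableSet.prod MeasurableSet.univ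
  refine measurable_of_restrict_of_restrict_compl hS ?_ ?_
  · have h1 : Measurable fun q : ↥(Q ×ˢ (Set.univ : Set Ξ)) => ((⟨q.1.1, q.2.1⟩ : Q), q.1.2) :=
      ((measurable_fst.comp measurable_subtype_coe).subtype_mk).prodMk
        (measurable_snd.comp measurable_subtype_coe)
    have h2 := ho.measurable_G.comp h1
    convert h2 using 1
    ext1 q
    exact congrFun (Set.indicator_of_mem q.2.1 G) q.1.2
  · convert (measurable_const : Measurable fun _ : ↥(Q ×ˢ (Set.univ : Set Ξ))ᶜ => (0 : E →L[ℝ] ℝ))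
      using 1
    ext1 q
    have hq : q.1.1 ∉ Q := fun h => q.2 ⟨h, trivial⟩
    exact congrFun (Set.indicator_of_notMem hq G) q.1.2

theorem IsStochasticInexactOracle.measurable_mean
    (ho : IsStochasticInexactOracle ν Q f L δ σ fd gd F G) (hQ : IsClosed Q) :
    Measurable (Q.indicator gd) := by
  have hpr : ProperSpace (E →L[ℝ] ℝ) := FiniteDimensional.proper ℝ _
  have h1 := (ho.measurable_indicator hQ).stronglyMeasurable.integral_prod_right' (ν := ν)
  have h2 : Q.indicator gd = fun x => ∫ s, Function.uncurry (Q.indicator G) (x, s) ∂ν := by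
    ext1 x
    simp only [Function.uncurry_apply_pair]
    by_cases hx : x ∈ Q
    · rw [Set.indicator_of_mem hx, Set.indicator_of_mem hx, ho.mean_G x hx]
    · rw [Set.indicator_of_notMem hx, Set.indicator_of_notMem hx]
      simp
  rw [h2]
  exact h1.measurable

omit [BorelSpace E] in
theorem IsStochasticInexactOracle.isLightTailed
    (ho : IsStochasticInexactOracle ν Q f L δ σ fd gd F G) (htail : LightTail ν Q σ gd G) (x : E) :
    IsLightTailed ν σ fun s => Q.indicator G x s - Q.indicator gd x := by
  have hpr : ProperSpace (E →L[ℝ] ℝ) := FiniteDimensional.proper ℝ _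
  by_cases hx : x ∈ Q
  · simp only [Set.indicator_of_mem hx]
    have hm : Measurable (G x) :=
      ho.measurable_G.comp (measurable_prodMk_left (x := (⟨x, hx⟩ : Q)))
    refine ⟨hm.sub_const _, (ho.integrable_G x hx).sub (integrable_const _), ?_, htail x hx⟩
    rw [integral_sub (ho.integrable_G x hx) (integrable_const _), ho.mean_G x hx]
    simp
  · simp only [Set.indicator_of_notMem hx, Pi.zero_apply, sub_zero]
    exact ⟨measurable_const, integrable_zero _ _ _, by simp, by simp⟩

omit [FiniteDimensional ℝ E] [MeasurableSpace E] [BorelSpace E] in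
theorem IsInexactOracle.indicator (ho : IsInexactOracle Q f L δ fd gd) :
    IsInexactOracle Q f L δ fd (Q.indicator gd) := by
  intro x hx y hy
  rw [Set.indicator_of_mem hx]
  exact ho x hx y hy

end GlobalOracle

/-! ### Induction over the stages -/

section Restart

variable {E : Type*} [NormedAddCommGroup E] [InnerProductSpace ℝ E] [FiniteDimensional ℝ E]
  {Ξ : Type*} {q : Params} {Q : Set E} {d h : E → ℝ} {G G' : E → Ξ → (E →L[ℝ] ℝ)} {u0 : E} {N : ℕ}

omit [FiniteDimensional ℝ E] in
theorem restart_succ (s : ℕ → ℕ → ℕ → Ξ) (k : ℕ) :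
    restart q Q d h G u0 N s (k + 1) =
      (sigm (localSet Q (q.radius k) (restart q Q d h G u0 N s k))
        (localProx d (q.radius k) (restart q Q d h G u0 N s k)) h (seqAlpha q.p)
        (seqBeta q.p (q.L * q.radius k ^ 2) (q.σ * q.radius k / √(q.batch N k : ℝ)) q.V) (seqB q.p)
        (restart q Q d h G u0 N s k) (fun i x => batchMean G (q.batch N k) (s k i) x) q.inner).y := rfl

theorem Params.IsAdmissible.isStepSequence (hq : q.IsAdmissible) (N k : ℕ) :
    IsStepSequence (seqAlpha q.p)
      (seqBeta q.p (q.L * q.radius k ^ 2) (q.σ * q.radius k / √(q.batch N k : ℝ)) q.V) (seqB q.p)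
      (seqKappa q.p (q.σ * q.radius k / √(q.batch N k : ℝ)) q.V) q.L (q.radius k ^ 2)⁻¹ := by
  have hm : (0 : ℝ) < q.batch N k := by exact_mod_cast Params.IsAdmissible.batch_pos q N k
  have := hq.sigma_pos
  have := hq.radius_pos k
  exact Sigma2.isStepSequence hq.one_le_p hq.p_le_two hq.L_pos (by positivity) hq.V_pos
    (hq.radius_pos k)

theorem restart_mem (hq : q.IsAdmissible) (hQ : IsClosed Q) (hh : ConvexOn ℝ Q h)
    (hlsc : LowerSemicontinuousOn h Q) (hd : IsProxFunction d) (hu0 : u0 ∈ Q)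
    (s : ℕ → ℕ → ℕ → Ξ) (k : ℕ) : restart q Q d h G u0 N s k ∈ Q := by
  induction k with
  | zero => exact hu0
  | succ k ih =>
    rw [restart_succ]
    exact (sigm_y_mem _ (isProxSetup_local (hq.radius_pos k) hQ hh hlsc hd ih)
      (hq.isStepSequence N k) q.inner).1

/-- Every query point lies in Q, so the extension by zero leaves the iterates unchanged. -/
theorem restart_congr (hq : q.IsAdmissible) (hQ : IsClosed Q) (hh : ConvexOn ℝ Q h)
    (hlsc : LowerSemicontinuousOn h Q) (hd : IsProxFunction d) (hu0 : u0 ∈ Q)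
    (hG : ∀ x ∈ Q, G x = G' x) (s : ℕ → ℕ → ℕ → Ξ) (k : ℕ) :
    restart q Q d h G u0 N s k = restart q Q d h G' u0 N s k := by
  induction k with
  | zero => rfl
  | succ k ih =>
    rw [restart_succ, restart_succ, ← ih]
    have hmem := restart_mem (G := G) (N := N) hq hQ hh hlsc hd hu0 s k
    rw [sigm_congr q.inner fun i _ => ?_]
    have hx := (sigm_x_mem (fun i x => batchMean G (q.batch N k) (s k i) x)
      (isProxSetup_local (hq.radius_pos k) hQ hh hlsc hd hmem) (hq.isStepSequence N k) i).1
    have hbatch : ∀ x ∈ Q, batchMean G (q.batch N k) (s k i) x = batchMean G' (q.batch N k) (s k i) x :=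
      fun x hx => by simp only [batchMean, hG x hx]
    exact hbatch _ hx

omit [FiniteDimensional ℝ E] in
theorem restart_update (s : ℕ → ℕ → ℕ → Ξ) {k j : ℕ} (hkj : k ≤ j) (b : ℕ → ℕ → Ξ) :
    restart q Q d h G u0 N (Function.update s j b) k = restart q Q d h G u0 N s k := by
  induction k with
  | zero => rfl
  | succ k ih =>
    rw [restart_succ, restart_succ, ih (by omega), Function.update_of_ne (by omega)]

variable [MeasurableSpace E] [BorelSpace E] [MeasurableSpace Ξ]

theorem measurable_restart (hq : q.IsAdmissible) (hQ : IsClosed Q) (hh : ConvexOn ℝ Q h)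
    (hlsc : LowerSemicontinuousOn h Q) (hd : IsProxFunction d) (hu0 : u0 ∈ Q)
    (hG : Measurable (Function.uncurry G)) (k : ℕ) :
    Measurable fun s : ℕ → ℕ → ℕ → Ξ => restart q Q d h G u0 N s k := by
  induction k with
  | zero => exact measurable_const
  | succ k ih =>
    have hans : ∀ i, Measurable fun y : (ℕ → ℕ → ℕ → Ξ) × E =>
        batchMean G (q.batch N k) (y.1 k i) y.2 := fun i =>
      measurable_batchMean hG _ ((measurable_pi_apply i).comp
        ((measurable_pi_apply k).comp measurable_fst)) measurable_snd
    have hu : Measurable fun s : ℕ → ℕ → ℕ → Ξ => (⟨restart q Q d h G u0 N s k,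
        restart_mem hq hQ hh hlsc hd hu0 s k⟩ : Q) := ih.subtype_mk
    exact (measurable_sigm (answer := fun (s : ℕ → ℕ → ℕ → Ξ) i x =>
      batchMean G (q.batch N k) (s k i) x) (hq.radius_pos k) hQ hh hlsc hd (hq.isStepSequence N k)
      hu hans q.inner).2.2.1

variable {ν : Measure Ξ} [IsProbabilityMeasure ν]

/-- The restarted method fails only in a measurable event of small probability. -/
theorem exists_restart_bad {f : E → ℝ} {fd : E → ℝ} {gd : E → (E →L[ℝ] ℝ)}
    (hq : q.IsAdmissible) (hQ : IsClosed Q) (hf : ConvexOn ℝ Q f) (hh : ConvexOn ℝ Q h)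
    (hlsc : LowerSemicontinuousOn h Q) (hφ : StrongConvexOn Q q.μ fun x => f x + h x)
    {v : E} (hv : v ∈ Q) (hmin : IsMinOn (fun x => f x + h x) Q v)
    (hor : IsInexactOracle Q f q.L q.δ fd gd)
    (hG : Measurable (Function.uncurry G)) (hgd : Measurable gd)
    (hZ : ∀ x, IsLightTailed ν q.σ fun s => G x s - gd x)
    (hd : IsProxFunction d) (hdV : ∀ x, d x ≤ q.V ^ 2 / 2 * ‖x‖ ^ 2)
    (hu0 : u0 ∈ Q) (hu0R : ‖u0 - v‖ ≤ q.R0) (hN : 1 ≤ N) :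
    ∃ Bad : Set (ℕ → ℕ → ℕ → Ξ), MeasurableSet Bad ∧
      seqLaw (seqLaw (seqLaw ν)) Bad ≤ ENNReal.ofReal q.Λ ∧
      ∀ s ∉ Bad, (f (restart q Q d h G u0 N s N) + h (restart q Q d h G u0 N s N)) - (f v + h v)
        ≤ q.errorBound N := by
  have ht := hq.confidence_pos hN
  choose B hBm hBP hBr using fun k => exists_stage_bad (ν := ν) (t := q.conf N) (v := v)
    hq.one_le_p hq.p_le_two
    hq.L_pos hq.delta_nonneg hq.sigma_pos hq.V_pos (hq.radius_pos k) ht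
    (Params.IsAdmissible.batch_pos q N k) hq.inner_pos hQ hf hh hlsc hor hG hgd hZ hd hdV hv
  have hmem := fun s k => restart_mem (G := G) (N := N) hq hQ hh hlsc hd hu0 s k
  have hBkm : ∀ k, MeasurableSet {s : ℕ → ℕ → ℕ → Ξ |
      ((⟨restart q Q d h G u0 N s k, hmem s k⟩ : Q), s k) ∈ B k} := fun k => by
    have h1 : Measurable fun s : ℕ → ℕ → ℕ → Ξ =>
        ((⟨restart q Q d h G u0 N s k, hmem s k⟩ : Q), s k) :=
      ((measurable_restart hq hQ hh hlsc hd hu0 hG k).subtype_mk).prodMk (measurable_pi_apply k)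
    exact h1 (hBm k)
  refine ⟨⋃ k ∈ Finset.range N, {s | ((⟨restart q Q d h G u0 N s k, hmem s k⟩ : Q), s k) ∈ B k},
    Finset.measurableSet_biUnion _ fun k _ => hBkm k, ?_, fun s hs => ?_⟩
  · have hone : ∀ k, seqLaw (seqLaw (seqLaw ν)) {s : ℕ → ℕ → ℕ → Ξ |
        ((⟨restart q Q d h G u0 N s k, hmem s k⟩ : Q), s k) ∈ B k}
        ≤ 2 * ENNReal.ofReal (Real.exp (-q.conf N)) := fun k => by
      -- Resampling the data of stage k leaves u_k fixed, so the bound uniform in the starting point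
      -- applies.
      refine seqLaw_le_of_update_le _ k (hBkm k) fun s => ?_
      simp only [Set.mem_ofPred_eq, Function.update_self, restart_update s le_rfl]
      exact hBP k ⟨restart q Q d h G u0 N s k, hmem s k⟩
    refine (measure_biUnion_finset_le _ _).trans ((Finset.sum_le_sum fun k _ => hone k).trans ?_)
    have hN0 : (0 : ℝ) < N := by exact_mod_cast hN
    have hΛ := hq.conf_pos
    have he : Real.exp (-q.conf N) = q.Λ / (3 * N) := by
      rw [Real.exp_neg, Params.conf, Real.exp_log (by positivity), inv_div]
    rw [Finset.sum_const, Finset.card_range, nsmul_eq_mul, he,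
      ← ENNReal.ofReal_natCast, ← ENNReal.ofReal_ofNat, ← ENNReal.ofReal_mul (by norm_num),
      ← ENNReal.ofReal_mul hN0.le]
    refine ENNReal.ofReal_le_ofReal ?_
    have e : (N : ℝ) * (2 * (q.Λ / (3 * N))) = 2 / 3 * q.Λ := by field_simp
    have e' : (N : ℝ) * (OfNat.ofNat 2 * (q.Λ / (3 * N))) = 2 / 3 * q.Λ := e
    rw [e']
    linarith
  · have hgood : ∀ k, k < N →
        ((⟨restart q Q d h G u0 N s k, hmem s k⟩ : Q), s k) ∉ B k := fun k hk hc =>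
      hs (Set.mem_biUnion (by simpa using hk) hc)
    have hstep : ∀ k, k < N → ‖restart q Q d h G u0 N s k - v‖ ≤ q.radius k →
        (f (restart q Q d h G u0 N s (k + 1)) + h (restart q Q d h G u0 N s (k + 1))) - (f v + h v)
          ≤ q.μ / 2 * q.radius (k + 1) ^ 2 := fun k hk hdist =>
      (hBr k ⟨restart q Q d h G u0 N s k, hmem s k⟩ (s k) hdist (hgood k hk) _
        (restart_succ s k)).trans (hq.stageBound_le hN k)
    -- Quadratic growth at the solution converts the residual bound into the distance bound required
    -- by the next stage.
    have hdist : ∀ k, k ≤ N → ‖restart q Q d h G u0 N s k - v‖ ≤ q.radius k := fun k => by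
      induction k with
      | zero => intro _; rw [hq.radius_zero]; exact hu0R
      | succ k ih =>
        intro hk
        have h1 := hstep k hk (ih (by omega))
        have h2 := hφ.le_sub_of_isMinOn hv hmin (hmem s (k + 1))
        have h3 : ‖restart q Q d h G u0 N s (k + 1) - v‖ ^ 2 ≤ q.radius (k + 1) ^ 2 :=
          le_of_mul_le_mul_left (h2.trans h1) (half_pos hq.mu_pos)
        exact (pow_le_pow_iff_left₀ (norm_nonneg _) (hq.radius_pos _).le two_ne_zero).1 h3
    obtain ⟨M, rfl⟩ : ∃ M, N = M + 1 := ⟨N - 1, by omega⟩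
    exact (hstep M (by omega) (hdist M (by omega))).trans (hq.mu_mul_radius_sq_le_errorBound _)

end Restart

end Sigma2

end

/-! ### Transfer to the given samples and complexity -/

theorem theorem7
    {E : Type*} [NormedAddCommGroup E] [InnerProductSpace ℝ E] [FiniteDimensional ℝ E]
    [MeasurableSpace E] [BorelSpace E]
    {Ξ : Type*} [MeasurableSpace Ξ] (ν : Measure Ξ) [IsProbabilityMeasure ν]
    {Ω : Type*} [MeasurableSpace Ω] (P : Measure Ω) [IsProbabilityMeasure P]
    (q : Sigma2.Params)
    (hL : 0 < q.L) (hδ : 0 ≤ q.δ) (hσ : 0 < q.σ) (hμ : 0 < q.μ) (hV : 0 < q.V) (hR0 : 0 < q.R0)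
    (hp : 1 ≤ q.p ∧ q.p ≤ 2) (hΛ : 0 < q.Λ ∧ q.Λ ≤ 1)
    -- the condition number is not tiny; only needed if the bias can accumulate
    (hX : q.p = 1 ∨ q.δ = 0 ∨ q.μ ≤ 6 * Real.exp 1 * Sigma2.C₁ * q.L * q.V ^ 2)
    -- the problem: minimize `f + h` over `Q`, with solution `xstar`
    (Q : Set E) (hQ : IsClosed Q) (f h : E → ℝ)
    (hf : ConvexOn ℝ Q f) (hh : ConvexOn ℝ Q h) (hh_lsc : LowerSemicontinuousOn h Q)
    (hφ : StrongConvexOn Q q.μ (fun x => f x + h x))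
    (xstar : E) (hxstar : xstar ∈ Q) (hmin : IsMinOn (fun x => f x + h x) Q xstar)
    -- the oracle
    (fd : E → ℝ) (gd : E → (E →L[ℝ] ℝ)) (F : E → Ξ → ℝ) (G : E → Ξ → (E →L[ℝ] ℝ))
    (horacle : Sigma2.IsStochasticInexactOracle ν Q f q.L q.δ q.σ fd gd F G)
    (htail : Sigma2.LightTail ν Q q.σ gd G)
    -- the prox-function
    (d : E → ℝ) (hd : Sigma2.IsProxFunction d) (hdV : ∀ x, d x ≤ q.V ^ 2 / 2 * ‖x‖ ^ 2)
    -- the starting point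
    (u0 : E) (hu0 : u0 ∈ Q) (hu0R : ‖u0 - xstar‖ ≤ q.R0)
    -- the independent samples with law `ν`
    (ξ : ℕ × ℕ × ℕ → Ω → Ξ) (hξ_meas : ∀ i, Measurable (ξ i))
    (hξ_indep : iIndepFun ξ P) (hξ_law : ∀ i, P.map (ξ i) = ν) :
    let φ : E → ℝ := fun x => f x + h x
    -- the result of `N` stages of the method
    let u : ℕ → Ω → E := fun N ω =>
      Sigma2.restart q Q d h G u0 N (fun k i j => ξ (k, i, j) ω) N
    (∀ N : ℕ, 1 ≤ N →
      P {ω | φ (u N ω) - φ xstar > q.errorBound N} ≤ ENNReal.ofReal q.Λ) ∧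
    (∀ ε : ℝ, 0 < ε → ε < q.μ * q.R0 ^ 2 →
      q.δ ≤ ε * (Real.exp 1 - 1) / (2 ^ q.p * Sigma2.C₃ * Real.exp 1)
        * q.X ^ ((1 - q.p) / q.p) →
      ∀ N : ℕ, N = ⌈Real.log (q.μ * q.R0 ^ 2 / ε)⌉₊ →
        P {ω | φ (u N ω) - φ xstar > ε} ≤ ENNReal.ofReal q.Λ ∧
        (q.innerCalls N : ℝ) ≤ q.iterTerm ε + q.noiseTerm ε ∧
        (q.totalCalls N : ℝ) ≤
          q.iterTerm ε + (1 + Real.log (q.μ * q.R0 ^ 2 / ε)) + 2 * q.noiseTerm ε) := by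
  intro φ u
  have hq : q.IsAdmissible := by
    refine ⟨hL, hδ, hσ, hμ, hV, hR0, hp.1, hp.2, hΛ.1, hΛ.2, hX.imp_right fun h => h.imp_right ?_⟩
    intro h
    unfold Sigma2.Params.X
    rwa [le_div_iff₀ hμ, one_mul]
  have hprob : ∀ N : ℕ, 1 ≤ N →
      P {ω | φ (u N ω) - φ xstar > q.errorBound N} ≤ ENNReal.ofReal q.Λ := by
    intro N hN
    obtain ⟨Bad, hBm, hBP, hB⟩ := Sigma2.exists_restart_bad (ν := ν) (G := Q.indicator G) (N := N)
      hq hQ hf hh hh_lsc hφ hxstar hmin horacle.inexact.indicator (horacle.measurable_indicator hQ)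
      (horacle.measurable_mean hQ) (horacle.isLightTailed htail) hd hdV hu0 hu0R hN
    have hS : Measurable fun ω k i j => ξ (k, i, j) ω :=
      measurable_pi_lambda _ fun k => measurable_pi_lambda _ fun i => measurable_pi_lambda _ fun j =>
        hξ_meas (k, i, j)
    have hsub : {ω | φ (u N ω) - φ xstar > q.errorBound N}
        ⊆ (fun ω k i j => ξ (k, i, j) ω) ⁻¹' Bad := by
      intro ω hω
      by_contra hc
      have h1 := hB _ hc
      -- The estimate was obtained for the extended oracle; it is returned here to the given one.
      rw [← Sigma2.restart_congr (G := G) hq hQ hh hh_lsc hd hu0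
        (fun x hx => (Set.indicator_of_mem hx G).symm)] at h1
      exact absurd hω (not_lt.2 h1)
    refine (measure_mono hsub).trans ?_
    rw [← Measure.map_apply hS hBm, Sigma2.map_samples_eq ν P hξ_meas hξ_indep hξ_law]
    exact hBP
  refine ⟨hprob, fun ε hε hεlt hδε N hN => ?_⟩
  have hlog : 0 < Real.log (q.μ * q.R0 ^ 2 / ε) := Real.log_pos ((one_lt_div hε).2 hεlt)
  have hN1 : 1 ≤ N := hN ▸ Nat.one_le_ceil_iff.2 hlog
  have hNge : Real.log (q.μ * q.R0 ^ 2 / ε) ≤ N := hN ▸ Nat.le_ceil _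
  have hNle : (N : ℝ) ≤ 1 + Real.log (q.μ * q.R0 ^ 2 / ε) := by
    rw [hN]
    linarith [Nat.ceil_lt_add_one hlog.le]
  refine ⟨le_trans (measure_mono fun ω hω => ?_) (hprob N hN1), hq.innerCalls_le hε hN1 hNle,
    hq.totalCalls_le hε hN1 hNle⟩
  exact lt_of_le_of_lt (hq.errorBound_le hε hδε hNge) hω
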